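/- Let $(Q,D,L=K-U)$ be a nonholonomic system: $Q$ is a smooth finite-dimensional manifold, $\langle\!\langle\cdot,\cdot\rangle\!\rangle$ the Riemannian metric defined by the kinetic energy $K$, $U\in C^\infty(Q)$, and $D\subset TQ$ a smooth vector subbundle. Let $\mathcal P:TQ\to D$ be the orthogonal projector, $i_D:D\to TQ$ the inclusion, $i_D^*:T^*Q\to D^*$ and $\mathcal P^*:D^*\to T^*Q$ their duals, $h(\alpha)=\tfrac12\|\alpha\|^2+U(q)$ for $\alpha\in T_q^*Q$, and $h_c=h\circ\mathcal P^*$. The nonholonomic vector field $X_{nh}$ on $D^*$ is the derivation $X_{nh}[\varphi]=\{\varphi,h_c\}_{D^*}$ of $C^\infty(D^*)$, where $\{\varphi,\psi\}_{D^*}=\{\varphi\circ i_D^*,\psi\circ i_D^*\}_{T^*Q}\circ\mathcal P^*$ and $\{\cdot,\cdot\}_{T^*Q}$ is the canonical Poisson bracket, with the sign $\{q^i,p_j\}=\delta^i_j$. Suppose that the system is $G$-Chaplygin: a Lie group $G$ acts smoothly, freely and properly on $Q$, by isometries that preserve $U$ and $D$, and $T_qQ=D_q\oplus\mathfrak g\cdot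 q$ for all $q\in Q$, where $\mathfrak g\cdot q$ is the tangent space of the orbit. Let $\pi:Q\to S=Q/G$ be the projection onto the quotient manifold, $\mathrm{hor}_q:T_{\pi(q)}S\to D_q$ the inverse of $T_q\pi|_{D_q}$, and $\tau_S:T^*S\to S$ the canonical projection. The map $\rho:D^*\to T^*S$, $\rho(\beta)=\beta\circ\mathrm{hor}_q$ for $\beta\in D^*_q$, identifies $T^*S$ with the orbit manifold $D^*/G$. The reduced Hamiltonian is the function $H\in C^\infty(T^*S)$ with $H\circ\rho=h_c$. The reduced nonholonomic vector field is the smooth vector field $\overline X_{nh}$ on $T^*S$ with $\overline X_{nh}[F]\circ\rho=X_{nh}[F\circ\rho]$ for all $F\in C^\infty(T^*S)$. The gyroscopic tensor $\mathcal T$ is the skew-symmetric $(1,2)$-tensor field on $S$ with $$\mathcal T(Y,Z)(\pi(q))=T_q\pi\big(\mathcal P[\mathrm{hor}\,Y,\mathrm{hor}\,Z](q)\big)-[Y,Z](\pi(q))$$ for all smooth vector fields $Y,Z$ on $S$ and all $q\in Q$. Put $\Omega_{\mathcal T}(\alpha)(V,W)=\alpha\big(\mathcal T(T_\alpha\tau_S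 V,T_\alpha\tau_S W)\big)$ for $\alpha\in T^*S$ and $V,W\in T_\alpha(T^*S)$, let $\Omega_{can}=-d\lambda_S$ be the canonical symplectic form on $T^*S$, where $\lambda_S$ is the Liouville 1-form, and let $\Omega_{nh}=\Omega_{can}+\Omega_{\mathcal T}$. Then the identification $D^*/G\cong T^*S$ holds, $\mathcal T$, $H$ and $\overline X_{nh}$ exist and are unique, and: 1. $\Omega_{nh}$ is a smooth non-degenerate 2-form on $T^*S$; 2. $\overline X_{nh}$ is the unique vector field $X$ on $T^*S$ with $\mathbf i_X\Omega_{nh}=dH$; 3. $\Omega_{nh}$ is closed (and hence symplectic) if and only if $\mathcal T=0$. -/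

import Mathlib

open scoped Manifold ContDiff Topology Bundle

noncomputable section

namespace Chaplygin

/-! ### Differential forms on manifolds -/

section Forms

variable {E : Type*} [NormedAddCommGroup E] [NormedSpace ℝ E]
  {H : Type*} [TopologicalSpace H] (I : ModelWithCorners ℝ E H)
  {M : Type*} [TopologicalSpace M] [ChartedSpace H M]

variable (M) in
/-- (Not necessarily smooth) real `k`-forms on `M`. -/
abbrev DiffForm (k : ℕ) : Type _ := (x : M) → TangentSpace I x [⋀^Fin k]→L[ℝ] ℝ

variable {I}

/-- The expression of a form in the preferred chart at `x`, i.e. its pull-back under the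
inverse of this chart; it is a form on the open set `(extChartAt I x).target` of the model space. -/
def DiffForm.inChart {k : ℕ} (η : DiffForm I M k) (x : M) (y : E) : E [⋀^Fin k]→L[ℝ] ℝ :=
  (η ((extChartAt I x).symm y)).compContinuousLinearMap
    (mfderivWithin 𝓘(ℝ, E) I (extChartAt I x).symm (Set.range I) y)

/-- A form is smooth if all its chart expressions are. -/
def DiffForm.IsSmooth {k : ℕ} (η : DiffForm I M k) : Prop :=
  ∀ x : M, ContDiffOn ℝ ∞ (η.inChart x) (extChartAt I x).target

/-- The exterior derivative: `dη` at `x` is computed in the preferred chart at `x`. For smooth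
forms the result does not depend on the chart. -/
def DiffForm.d {k : ℕ} (η : DiffForm I M k) : DiffForm I M (k + 1) := fun x ↦
  (extDerivWithin (η.inChart x) (Set.range I) (extChartAt I x x)).compContinuousLinearMap
    (mfderiv I 𝓘(ℝ, E) (extChartAt I x) x)

/-- A form is closed if its exterior derivative vanishes. -/
def DiffForm.IsClosed {k : ℕ} (η : DiffForm I M k) : Prop := ∀ x : M, η.d x = 0

/-- A 2-form is non-degenerate if at each point only the zero vector pairs to zero with all
vectors. -/
def DiffForm.Nondegenerate (η : DiffForm I M 2) : Prop :=
  ∀ (x : M) (u : TangentSpace I x), (∀ v : TangentSpace I x, η x ![u, v] = 0) → u = 0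

/-- The relation `i_X η = df` at the point `x`, for a tangent vector `X` at `x`. -/
def DiffForm.ContractsTo (η : DiffForm I M 2) (f : M → ℝ) (x : M) (X : TangentSpace I x) : Prop :=
  ∀ v : TangentSpace I x, η x ![X, v] = mvfderiv I f x v

variable [IsManifold I 1 M]

/-- Smooth vector fields. -/
def IsSmoothField (X : (x : M) → TangentSpace I x) : Prop :=
  ContMDiff I I.tangent ∞ (fun x ↦ (⟨x, X x⟩ : TangentBundle I M))

end Forms

/-! ### Cotangent bundles -/

section Cotangent

variable {E : Type*} [NormedAddCommGroup E] [NormedSpace ℝ E]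
  {M : Type*} [TopologicalSpace M] [ChartedSpace E M] [IsManifold 𝓘(ℝ, E) ∞ M]

variable (E M) in
/-- The cotangent bundle `T*M` (with Mathlib's structure of a smooth vector bundle). -/
abbrev CotangentBundle : Type _ :=
  Bundle.TotalSpace (E →L[ℝ] ℝ)
    (fun x : M ↦ TangentSpace 𝓘(ℝ, E) x →L[ℝ] Bundle.Trivial M ℝ x)

variable (E) in
/-- The model with corners of `T*M`. -/
abbrev cotModel : ModelWithCorners ℝ (E × (E →L[ℝ] ℝ)) (ModelProd E (E →L[ℝ] ℝ)) :=
  𝓘(ℝ, E).prod 𝓘(ℝ, E →L[ℝ] ℝ)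

/-- A point of `T*M` as a linear form. -/
def covector (α : CotangentBundle E M) : TangentSpace 𝓘(ℝ, E) α.proj →L[ℝ] ℝ := α.snd

/-- The point of `T*M` given by a linear form on `T_x M`. -/
def mkCovector (x : M) (a : TangentSpace 𝓘(ℝ, E) x →L[ℝ] ℝ) : CotangentBundle E M := ⟨x, a⟩

/-- The derivative at `α` of the projection `τ : T*M → M`. -/
def tangentProj (α : CotangentBundle E M) :
    TangentSpace (cotModel E) α →L[ℝ] TangentSpace 𝓘(ℝ, E) α.proj :=
  mfderiv (cotModel E) 𝓘(ℝ, E)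
    (fun a : CotangentBundle E M ↦ a.proj) α

variable (E M) in
/-- The Liouville 1-form `λ(α)(U) = α(Tτ U)`. -/
def liouvilleForm : DiffForm (cotModel E) (CotangentBundle E M) 1 := fun α ↦
  ContinuousAlternatingMap.ofSubsingleton ℝ (TangentSpace (cotModel E) α) ℝ (0 : Fin 1)
    ((covector α).comp (tangentProj α))

variable (E M) in
/-- The canonical symplectic form `Ω_can = -dλ`, locally `∑ dsⁱ ∧ dpᵢ`. -/
def canonicalForm : DiffForm (cotModel E) (CotangentBundle E M) 2 := fun α ↦
  -(liouvilleForm E M).d α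

/-- The Hamiltonian vector of `f` at `α`: the vector `X` with `i_X Ω_can = df`. -/
def hamiltonianVector (f : CotangentBundle E M → ℝ) (α : CotangentBundle E M) :
    TangentSpace (cotModel E) α :=
  Classical.epsilon fun X ↦ (canonicalForm E M).ContractsTo f α X

/-- The canonical Poisson bracket `{f, k} = df(X_k)` on `T*M`; thus `{qⁱ, pⱼ} = δⁱⱼ`. -/
def poissonBracket (f k : CotangentBundle E M → ℝ) (α : CotangentBundle E M) : ℝ :=
  mvfderiv (cotModel E) f α (hamiltonianVector k α)

/-- Smooth functions on `T*M`. -/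
def IsSmoothFun (f : CotangentBundle E M → ℝ) : Prop :=
  ContMDiff (cotModel E) 𝓘(ℝ, ℝ) ∞ f

end Cotangent

/-! ### Nonholonomic systems -/

/-- A nonholonomic system `(Q, D, L = K - U)`: a Riemannian metric (twice the kinetic energy), a
smooth potential `U` and a smooth vector subbundle `D ⊆ TQ` (a distribution of constant rank
that is locally spanned by smooth frames). -/
structure NonholonomicSystem (E : Type*) [NormedAddCommGroup E] [NormedSpace ℝ E]
    (Q : Type*) [TopologicalSpace Q] [ChartedSpace E Q] [IsManifold 𝓘(ℝ, E) ∞ Q] where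
  metric : Bundle.ContMDiffRiemannianMetric 𝓘(ℝ, E) ∞ E (fun q : Q ↦ TangentSpace 𝓘(ℝ, E) q)
  U : Q → ℝ
  smooth_U : ContMDiff 𝓘(ℝ, E) 𝓘(ℝ, ℝ) ∞ U
  rank : ℕ
  D : (q : Q) → Submodule ℝ (TangentSpace 𝓘(ℝ, E) q)
  smooth_D : ∀ q₀ : Q, ∃ V : Set Q, IsOpen V ∧ q₀ ∈ V ∧
    ∃ X : Fin rank → (q : Q) → TangentSpace 𝓘(ℝ, E) q,
      (∀ i, ContMDiffOn 𝓘(ℝ, E) 𝓘(ℝ, E).tangent ∞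
        (fun q ↦ (⟨q, X i q⟩ : TangentBundle 𝓘(ℝ, E) Q)) V) ∧
      ∀ q ∈ V, LinearIndependent ℝ (fun i ↦ X i q) ∧
        Submodule.span ℝ (Set.range fun i ↦ X i q) = D q

namespace NonholonomicSystem

variable {E : Type*} [NormedAddCommGroup E] [NormedSpace ℝ E]
  {Q : Type*} [TopologicalSpace Q] [ChartedSpace E Q] [IsManifold 𝓘(ℝ, E) ∞ Q]
  (N : NonholonomicSystem E Q)

/-- The orthogonal complement `D_q^⊥` with respect to the kinetic energy metric. -/
def orth (q : Q) : Submodule ℝ (TangentSpace 𝓘(ℝ, E) q) where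
  carrier := {v | ∀ u ∈ N.D q, N.metric.inner q v u = 0}
  add_mem' := by
    intro a b ha hb u hu
    simp [ha u hu, hb u hu]
  zero_mem' := by
    intro u _
    simp
  smul_mem' := by
    intro c a ha u hu
    simp [ha u hu]

instance [FiniteDimensional ℝ E] (q : Q) : FiniteDimensional ℝ (TangentSpace 𝓘(ℝ, E) q) :=
  inferInstanceAs (FiniteDimensional ℝ E)

instance (q : Q) : T2Space (TangentSpace 𝓘(ℝ, E) q) :=
  inferInstanceAs (T2Space E)

variable [FiniteDimensional ℝ E]

theorem isCompl_orth (q : Q) : IsCompl (N.D q) (N.orth q) := by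
  have hdis : Disjoint (N.D q) (N.orth q) := by
    rw [Submodule.disjoint_def]
    intro v hv hv'
    by_contra hne
    exact (N.metric.pos q v hne).ne' (hv' v hv)
  refine ⟨hdis, codisjoint_iff.mpr (eq_top_iff.mpr fun v _ ↦ ?_)⟩
  let f : N.D q →ₗ[ℝ] Module.Dual ℝ (N.D q) :=
    { toFun := fun u ↦ (N.metric.inner q u).toLinearMap.comp (N.D q).subtype
      map_add' := by intro a b; ext w; simp
      map_smul' := by intro c a; ext w; simp }
  have hinj : Function.Injective f := by
    rw [← LinearMap.ker_eq_bot, LinearMap.ker_eq_bot']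
    intro u hu
    by_contra hne
    have h0 : N.metric.inner q u u = 0 := LinearMap.congr_fun hu u
    exact (N.metric.pos q u (by simpa using hne)).ne' h0
  have hsurj : Function.Surjective f :=
    (LinearMap.injective_iff_surjective_of_finrank_eq_finrank
      (Subspace.dual_finrank_eq (K := ℝ) (V := N.D q)).symm).mp hinj
  obtain ⟨w, hw⟩ := hsurj ((N.metric.inner q v).toLinearMap.comp (N.D q).subtype)
  refine Submodule.mem_sup.mpr ⟨w, w.2, v - w, fun u hu ↦ ?_, by simp⟩
  have h1 : N.metric.inner q w u = N.metric.inner q v u := LinearMap.congr_fun hw ⟨u, hu⟩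
  simp [h1]

/-- The orthogonal projector `𝒫 : T_q Q → D_q`, along `D_q^⊥`. -/
def projD (q : Q) : TangentSpace 𝓘(ℝ, E) q →L[ℝ] N.D q :=
  LinearMap.toContinuousLinearMap ((N.D q).projectionOnto (N.orth q) (N.isCompl_orth q))

/-- The dual bundle `D*` of `D`. -/
abbrev DualBundle : Type _ := (q : Q) × (N.D q →L[ℝ] ℝ)

/-- The projection `i_D^* : T*Q → D*`, restricting a covector to `D`. -/
def iDstar (α : CotangentBundle E Q) : N.DualBundle :=
  ⟨α.proj, (covector α).comp (N.D α.proj).subtypeL⟩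

/-- The inclusion `𝒫^* : D* → T*Q`, composing a linear form with `𝒫`. -/
def projDstar (β : N.DualBundle) : CotangentBundle E Q :=
  mkCovector β.1 (β.2.comp (N.projD β.1))

/-- Smooth functions on `D*`. As `i_D^* : T*Q → D*` is a surjective submersion, a function on `D*`
is smooth exactly if its pull-back to `T*Q` is. -/
def IsSmoothOnDual (φ : N.DualBundle → ℝ) : Prop :=
  IsSmoothFun (fun α : CotangentBundle E Q ↦ φ (N.iDstar α))

/-- The nonholonomic bracket `{φ, ψ}_{D*} = {φ ∘ i_D^*, ψ ∘ i_D^*}_{T*Q} ∘ 𝒫^*`. -/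
def bracket (φ ψ : N.DualBundle → ℝ) (β : N.DualBundle) : ℝ :=
  poissonBracket (fun α ↦ φ (N.iDstar α)) (fun α ↦ ψ (N.iDstar α)) (N.projDstar β)

/-- The metric dual vector of a covector: `⟪sharp a, v⟫ = a v`. -/
def sharp (q : Q) (a : TangentSpace 𝓘(ℝ, E) q →L[ℝ] ℝ) : TangentSpace 𝓘(ℝ, E) q :=
  (N.metric.inner q).inverse a

/-- The Hamiltonian `h(α) = ½ ‖α‖² + U(q)` on `T*Q`, where `‖α‖² = α(α^♯)` is the
norm on covectors induced by the kinetic energy metric. -/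
def hamiltonian (α : CotangentBundle E Q) : ℝ :=
  (1 / 2 : ℝ) * covector α (N.sharp α.proj (covector α)) + N.U α.proj

/-- The constrained Hamiltonian `h_c = h ∘ 𝒫^*` on `D*`. -/
def constrainedHamiltonian (β : N.DualBundle) : ℝ := N.hamiltonian (N.projDstar β)

/-- The nonholonomic vector field `X_nh` on `D*`, as the derivation
`φ ↦ X_nh[φ] = {φ, h_c}_{D*}`. -/
def nonholonomicField (φ : N.DualBundle → ℝ) : N.DualBundle → ℝ :=
  N.bracket φ N.constrainedHamiltonian

end NonholonomicSystem

/-! ### Chaplygin systems -/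

/-- A nonholonomic `G`-Chaplygin system on `Q` with shape space `S = Q/G`: the Lie group `G` acts
smoothly, freely and properly on `Q`, by isometries that preserve the potential and the constraint
distribution `D`, and `T_q Q = D_q ⊕ 𝔤·q`. The shape space is the quotient manifold `Q/G`: the
manifold `S` comes with a surjective submersion `prj = π : Q → S` whose fibres are the orbits. -/
structure ChaplyginSystem (E : Type*) [NormedAddCommGroup E] [NormedSpace ℝ E]
    (Q : Type*) [TopologicalSpace Q] [ChartedSpace E Q] [IsManifold 𝓘(ℝ, E) ∞ Q]
    (EG : Type*) [NormedAddCommGroup EG] [NormedSpace ℝ EG]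
    (G : Type*) [TopologicalSpace G] [ChartedSpace EG G] [Group G]
    (ES : Type*) [NormedAddCommGroup ES] [NormedSpace ℝ ES]
    (S : Type*) [TopologicalSpace S] [ChartedSpace ES S] [IsManifold 𝓘(ℝ, ES) ∞ S]
    [MulAction G Q]
    extends NonholonomicSystem E Q where
  smooth_action : ContMDiffSMul 𝓘(ℝ, EG) 𝓘(ℝ, E) ∞ G Q
  free : ∀ (a : G) (q : Q), a • q = q → a = 1
  proper : ProperSMul G Q
  isometric : ∀ (a : G) (q : Q) (u v : TangentSpace 𝓘(ℝ, E) q),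
    metric.inner (a • q) (mfderiv 𝓘(ℝ, E) 𝓘(ℝ, E) (fun x : Q ↦ a • x) q u)
      (mfderiv 𝓘(ℝ, E) 𝓘(ℝ, E) (fun x : Q ↦ a • x) q v) = metric.inner q u v
  invariant_U : ∀ (a : G) (q : Q), U (a • q) = U q
  invariant_D : ∀ (a : G) (q : Q),
    (D q).map (mfderiv 𝓘(ℝ, E) 𝓘(ℝ, E) (fun x : Q ↦ a • x) q).toLinearMap = D (a • q)
  /-- `𝔤·q` is the image of `𝔤 = T_1 G` under the derivative of `a ↦ a • q`; this is a
  subspace of the tangent space at `1 • q`, which is the point `q`. -/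
  splitting : ∀ q : Q, IsCompl (D ((1 : G) • q))
    (mfderiv 𝓘(ℝ, EG) 𝓘(ℝ, E) (fun a : G ↦ a • q) (1 : G)).toLinearMap.range
  prj : Q → S
  submersion_prj : Manifold.IsSubmersion 𝓘(ℝ, E) 𝓘(ℝ, ES) ∞ prj
  surjective_prj : Function.Surjective prj
  fibre_prj : ∀ q q' : Q, prj q = prj q' ↔ ∃ a : G, q' = a • q

namespace ChaplyginSystem

variable {E : Type*} [NormedAddCommGroup E] [NormedSpace ℝ E] [FiniteDimensional ℝ E]
  {Q : Type*} [TopologicalSpace Q] [ChartedSpace E Q] [IsManifold 𝓘(ℝ, E) ∞ Q]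
  {EG : Type*} [NormedAddCommGroup EG] [NormedSpace ℝ EG]
  {G : Type*} [TopologicalSpace G] [ChartedSpace EG G] [Group G]
  {ES : Type*} [NormedAddCommGroup ES] [NormedSpace ℝ ES]
  {S : Type*} [TopologicalSpace S] [ChartedSpace ES S] [IsManifold 𝓘(ℝ, ES) ∞ S]
  [MulAction G Q]
  (C : ChaplyginSystem E Q EG G ES S)

/-- The derivative `T_q π`. -/
def Tprj (q : Q) : TangentSpace 𝓘(ℝ, E) q →L[ℝ] TangentSpace 𝓘(ℝ, ES) (C.prj q) :=
  mfderiv 𝓘(ℝ, E) 𝓘(ℝ, ES) C.prj q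

/-- The horizontal lift `hor_q : T_{π(q)} S → D_q`, the inverse of the isomorphism
`T_q π : D_q → T_{π(q)} S`. -/
def hor (q : Q) : TangentSpace 𝓘(ℝ, ES) (C.prj q) →L[ℝ] C.D q :=
  ((C.Tprj q).comp (C.D q).subtypeL).inverse

/-- The horizontal lift of a vector field on `S`. -/
def horField (Y : (s : S) → TangentSpace 𝓘(ℝ, ES) s) (q : Q) : TangentSpace 𝓘(ℝ, E) q :=
  (C.hor q (Y (C.prj q)) : TangentSpace 𝓘(ℝ, E) q)

/-- `𝒯` is the gyroscopic tensor: for all smooth vector fields `Y, Z` on `S` and `s = π(q)`,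
`𝒯(Y, Z)(s) = T_q π (𝒫 [hor Y, hor Z](q)) - [Y, Z](s)`. -/
def IsGyroscopicTensor
    (T : (s : S) → TangentSpace 𝓘(ℝ, ES) s [⋀^Fin 2]→L[ℝ] TangentSpace 𝓘(ℝ, ES) s) : Prop :=
  ∀ Y Z : (s : S) → TangentSpace 𝓘(ℝ, ES) s, IsSmoothField Y → IsSmoothField Z → ∀ q : Q,
    T (C.prj q) ![Y (C.prj q), Z (C.prj q)] =
      C.Tprj q (C.projD q (VectorField.mlieBracket 𝓘(ℝ, E) (C.horField Y) (C.horField Z) q))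
        - VectorField.mlieBracket 𝓘(ℝ, ES) Y Z (C.prj q)

/-- The gyroscopic tensor `𝒯` of the system. -/
def gyroscopicTensor :
    (s : S) → TangentSpace 𝓘(ℝ, ES) s [⋀^Fin 2]→L[ℝ] TangentSpace 𝓘(ℝ, ES) s :=
  Classical.epsilon C.IsGyroscopicTensor

/-- The gyroscopic 2-form `Ω_𝒯(α)(U, V) = α(𝒯(Tτ U, Tτ V))` on `T*S`. -/
def gyroscopicForm : DiffForm (cotModel ES) (CotangentBundle ES S) 2 := fun α ↦
  (covector α).compContinuousAlternatingMap
    ((C.gyroscopicTensor α.proj).compContinuousLinearMap (tangentProj α))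

/-- The 2-form `Ω_nh = Ω_can + Ω_𝒯` on `T*S`. -/
def Ωnh : DiffForm (cotModel ES) (CotangentBundle ES S) 2 := fun α ↦
  canonicalForm ES S α + C.gyroscopicForm α

/-- Two points of `D*` lie on the same orbit of the lifted action of `G` on `D*`, which
sends `β ∈ D_q^*` to the form `T_q a (u) ↦ β(u)` on `D_{a • q}`. -/
def SameOrbit (β β' : C.DualBundle) : Prop :=
  ∃ (a : G) (b : C.D (a • β.1) →L[ℝ] ℝ), β' = ⟨a • β.1, b⟩ ∧
    ∀ u : C.D β.1, b ⟨mfderiv 𝓘(ℝ, E) 𝓘(ℝ, E) (fun x : Q ↦ a • x) β.1 u,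
      C.invariant_D a β.1 ▸ Submodule.mem_map_of_mem u.2⟩ = β.2 u

/-- The reduction map `D* → D*/G ≅ T*S`, sending `β ∈ D_q^*` to the covector
`u ↦ β(hor_q u)` at `π(q)`. -/
def reduction (β : C.DualBundle) : CotangentBundle ES S :=
  mkCovector (C.prj β.1) (β.2.comp (C.hor β.1))

/-- `T*S` is, via the reduction map, the orbit manifold `D*/G`: the map is onto, its fibres
are the `G`-orbits, and a function on `T*S` is smooth exactly if its pull-back to `D*` is. -/
def CotangentIsReducedSpace : Prop :=
  Function.Surjective C.reduction ∧
  (∀ β β' : C.DualBundle, C.reduction β = C.reduction β' ↔ C.SameOrbit β β') ∧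
  ∀ F : CotangentBundle ES S → ℝ,
    IsSmoothFun F ↔ C.IsSmoothOnDual (fun β ↦ F (C.reduction β))

/-- `H` is the reduced Hamiltonian, seen on `T*S`: it pulls back to `h_c` on `D*`. -/
def IsReducedHamiltonian (H : CotangentBundle ES S → ℝ) : Prop :=
  IsSmoothFun H ∧ ∀ β : C.DualBundle, H (C.reduction β) = C.constrainedHamiltonian β

/-- The reduced Hamiltonian on `T*S`. -/
def reducedHamiltonian : CotangentBundle ES S → ℝ :=
  Classical.epsilon C.IsReducedHamiltonian

/-- `X` is the reduced nonholonomic vector field, seen on `T*S`: it is related to `X_nh` by the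
reduction map, i.e. `X[F]` pulls back to `X_nh[F ∘ reduction]` for all smooth `F`. -/
def IsReducedField
    (X : (α : CotangentBundle ES S) → TangentSpace (cotModel ES) α) : Prop :=
  IsSmoothField X ∧
  ∀ F : CotangentBundle ES S → ℝ, IsSmoothFun F → ∀ β : C.DualBundle,
    mvfderiv (cotModel ES) F (C.reduction β) (X (C.reduction β)) =
      C.nonholonomicField (fun β' ↦ F (C.reduction β')) β

/-- The reduced nonholonomic vector field on `T*S`. -/
def reducedField : (α : CotangentBundle ES S) → TangentSpace (cotModel ES) α :=
  Classical.epsilon C.IsReducedField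

end ChaplyginSystem

end Chaplygin

end

open scoped Manifold ContDiff Topology Bundle

set_option linter.unusedSectionVars false

noncomputable section

/-! Everything passes through Φ = ρ ∘ i_D^* : T*Q → T*S (`cotReduction`). By the definition of the
nonholonomic bracket, X_nh[F ∘ ρ] at β is the derivative of F ∘ Φ along V, the Hamiltonian vector of
H ∘ Φ at α = 𝒫^*β. So the reduced field at ρ(β) = Φ(α) can only be TΦ(V), and the point is that
TΦ(V) solves i_X Ω_nh = dH.

In charts centred at the points involved, TΦ(X₁, X₂) = (Tπ X₁, X₂ ∘ hor + α ∘ dhor(X₁)), where dhor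
is the derivative of the horizontal lift (`mfderiv_cotReduction`). The relation Ω_can(V, W) = dH(TΦ
W) is tested on two kinds of W. The vectors (0, ℓ ∘ (1 - 𝒫)) are killed by TΦ and force V₁ ∈ D,
which is the constraint. A lift W of Z with horizontal base part gives dH(Z) - Ω_can(TΦ V, Z) =
α(dhor(V₁) Z₁ - dhor(hor Z₁)(Tπ V₁)). Since α = α ∘ 𝒫 and [hor Y, hor Z] = dhor(hor Y) Z - dhor(hor
Z) Y + hor [Y, Z] (`mlieBracket_horField`), the right-hand side is the gyroscopic term. This is
`gyroscopic_contraction`.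

The other assertions on Ω_nh are read off from canonical coordinates (s, p), where Ω_nh is ∑ dsⁱ ∧
dpᵢ plus p(𝒯_s(·, ·)). The second term involves base components only, so it does not affect
non-degeneracy. It is linear in p, so its fibre derivative recovers 𝒯, and dΩ_nh = 0 forces 𝒯 = 0.
For 𝒯 = 0 the coefficients are constant.

Two kinds of preparation are needed. The horizontal lift exists because 𝔤·q is all of ker T_qπ
(`range_infinitesimal_action`): freeness makes the infinitesimal action injective, and comparing
Hausdorff dimensions bounds the dimension of a fibre by dim G. Objects on Q descend to S because
hor, the metric and Lie brackets of horizontal lifts are equivariant, and they descend smoothly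
because π and Φ have smooth local sections. -/

namespace Chaplygin

/-! ### Exterior derivatives in charts -/

section Forms

variable {E : Type*} [NormedAddCommGroup E] [NormedSpace ℝ E]
  {H : Type*} [TopologicalSpace H] {I : ModelWithCorners ℝ E H}
  {M : Type*} [TopologicalSpace M] [ChartedSpace H M]

/-- Change of base point in the pull-back of a form under a linear map defined on the model
space. -/
theorem DiffForm.compContinuousLinearMap_congr {k : ℕ} (η : DiffForm I M k) {p p' : M}
    (h : p = p') {F : Type*} [NormedAddCommGroup F] [NormedSpace ℝ F] (L : F →L[ℝ] E) :
    (η p).compContinuousLinearMap (show F →L[ℝ] TangentSpace I p from L) =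
      (η p').compContinuousLinearMap (show F →L[ℝ] TangentSpace I p' from L) := by
  subst h; rfl

theorem DiffForm.d_apply [IsManifold I 1 M] [I.Boundaryless] {k : ℕ} (η : DiffForm I M k) (x : M) :
    η.d x = extDeriv (η.inChart x) (extChartAt I x x) := by
  rw [DiffForm.d, mfderiv_extChartAt_self, I.range_eq_univ, extDerivWithin_univ]
  rfl

theorem DiffForm.inChart_self [IsManifold I 1 M] {k : ℕ} (η : DiffForm I M k) (x : M) :
    η.inChart x (extChartAt I x x) = η x := by
  rw [DiffForm.inChart, mfderivWithin_range_extChartAt_symm]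
  exact η.compContinuousLinearMap_congr (extChartAt_to_inv x) (ContinuousLinearMap.id ℝ E)

variable [IsManifold I ∞ M] [I.Boundaryless]

theorem contDiffAt_chartChange (x z : M) {y : E} (hy : y ∈ (extChartAt I z).target)
    (hyx : (extChartAt I z).symm y ∈ (extChartAt I x).source) :
    ContDiffAt ℝ ∞ (extChartAt I x ∘ (extChartAt I z).symm) y := by
  have h := contDiffWithinAt_ext_coord_change (I := I) (n := ∞) x z (y := y) (by
    rw [PartialEquiv.trans_source]
    exact ⟨hy, hyx⟩)
  rwa [I.range_eq_univ, contDiffWithinAt_univ] at h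

theorem DiffForm.inChart_eq_pullback {k : ℕ} (η : DiffForm I M k) (x z : M) {y : E}
    (hy : y ∈ (extChartAt I z).target) (hyx : (extChartAt I z).symm y ∈ (extChartAt I x).source) :
    η.inChart z y =
      (η.inChart x ((extChartAt I x ∘ (extChartAt I z).symm) y)).compContinuousLinearMap
      (fderiv ℝ (extChartAt I x ∘ (extChartAt I z).symm) y) := by
  have hE : ∀ᶠ y' in 𝓝 y, y' ∈ (extChartAt I z).target ∧
      (extChartAt I z).symm y' ∈ (extChartAt I x).source := by
    refine Filter.Eventually.and ((isOpen_extChartAt_target z).mem_nhds hy) ?_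
    exact (continuousAt_extChartAt_symm'' hy).preimage_mem_nhds
      ((isOpen_extChartAt_source x).mem_nhds hyx)
  have hψ : DifferentiableAt ℝ (extChartAt I x ∘ (extChartAt I z).symm) y :=
    (contDiffAt_chartChange x z hy hyx).differentiableAt (by simp)
  have hmap : (extChartAt I x ∘ (extChartAt I z).symm) y ∈ (extChartAt I x).target :=
    (extChartAt I x).map_source hyx
  have key : mfderivWithin 𝓘(ℝ, E) I (extChartAt I z).symm (Set.range I) y =
      (mfderivWithin 𝓘(ℝ, E) I (extChartAt I x).symm (Set.range I)
        ((extChartAt I x ∘ (extChartAt I z).symm) y)).comp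
      (mfderiv 𝓘(ℝ, E) 𝓘(ℝ, E) (extChartAt I x ∘ (extChartAt I z).symm) y) := by
    have h1 := mdifferentiableWithinAt_extChartAt_symm (I := I) hmap
    rw [I.range_eq_univ, mdifferentiableWithinAt_univ] at h1
    rw [I.range_eq_univ, mfderivWithin_univ, mfderivWithin_univ,
      ← mfderiv_comp y (I := 𝓘(ℝ, E)) (I' := 𝓘(ℝ, E)) (I'' := I) h1 hψ.mdifferentiableAt]
    apply Filter.EventuallyEq.mfderiv_eq
    filter_upwards [hE] with y' hy'
    exact ((extChartAt I x).left_inv hy'.2).symm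
  rw [DiffForm.inChart, DiffForm.inChart, key, mfderiv_eq_fderiv]
  exact η.compContinuousLinearMap_congr ((extChartAt I x).left_inv hyx).symm
    ((mfderivWithin 𝓘(ℝ, E) I (extChartAt I x).symm (Set.range I)
        ((extChartAt I x ∘ (extChartAt I z).symm) y)).comp
      (fderiv ℝ (extChartAt I x ∘ (extChartAt I z).symm) y))

/-- The derivative `η.d` uses a different chart at each point: at the point over y it is the chart
centred there. The two chart expressions of the form differ by pull-back along the transition map,
and `extDeriv` commutes with pull-backs. Hence one chart computes dη on its whole target and not
only at its centre. -/
theorem DiffForm.d_inChart {k : ℕ} (η : DiffForm I M k) (x : M) {y : E}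
    (hy : y ∈ (extChartAt I x).target) (hη : DifferentiableAt ℝ (η.inChart x) y) :
    (η.d).inChart x y = extDeriv (η.inChart x) y := by
  set z := (extChartAt I x).symm y with hz
  have hzx : z ∈ (extChartAt I x).source := (extChartAt I x).map_target hy
  have hzz : extChartAt I z z ∈ (extChartAt I z).target := mem_extChartAt_target z
  have hzx' : (extChartAt I z).symm (extChartAt I z z) ∈ (extChartAt I x).source := by
    rwa [extChartAt_to_inv]
  have hψ := contDiffAt_chartChange x z hzz hzx'
  have hψz : (extChartAt I x ∘ (extChartAt I z).symm) (extChartAt I z z) = y := by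
    simp only [Function.comp_apply, extChartAt_to_inv, hz, (extChartAt I x).right_inv hy]
  have heq : η.inChart z =ᶠ[𝓝 (extChartAt I z z)] fun y' ↦
      (η.inChart x ((extChartAt I x ∘ (extChartAt I z).symm) y')).compContinuousLinearMap
      (fderiv ℝ (extChartAt I x ∘ (extChartAt I z).symm) y') := by
    have h1 := (isOpen_extChartAt_target (I := I) z).mem_nhds hzz
    have h2 := (continuousAt_extChartAt_symm'' hzz).preimage_mem_nhds
      ((isOpen_extChartAt_source (I := I) x).mem_nhds hzx')
    filter_upwards [h1, h2] with y' hy' hy''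
    exact η.inChart_eq_pullback x z hy' hy''
  have hd : η.d z = (extDeriv (η.inChart x) y).compContinuousLinearMap
      (fderiv ℝ (extChartAt I x ∘ (extChartAt I z).symm) (extChartAt I z z)) := by
    rw [η.d_apply z, heq.extDeriv_eq, extDeriv_pullback (r := ∞) (by rwa [hψz]) hψ
      (by simpa using ENat.LEInfty.out), hψz]
  have hmf : fderiv ℝ (extChartAt I x ∘ (extChartAt I z).symm) (extChartAt I z z) =
      mfderiv I 𝓘(ℝ, E) (extChartAt I x) z := by
    rw [(mdifferentiableAt_extChartAt (by rwa [← extChartAt_source I])).mfderiv, I.range_eq_univ,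
      fderivWithin_univ]
    rfl
  have hid := mfderiv_extChartAt_comp_mfderivWithin_extChartAt_symm (I := I) hy
  rw [DiffForm.inChart, ← hz, hd, hmf]
  ext v
  change extDeriv (η.inChart x) y _ = _
  congr 1
  ext i
  exact congrArg (fun L ↦ L (v i)) hid

theorem DiffForm.isClosed_iff {k : ℕ} (η : DiffForm I M k) :
    η.IsClosed ↔ ∀ x, extDeriv (η.inChart x) (extChartAt I x x) = 0 := by
  simp only [DiffForm.IsClosed, η.d_apply]
  rfl

end Forms

/-! ### Smoothness of tensors from their components -/

section Components

variable {E : Type*} [NormedAddCommGroup E] [NormedSpace ℝ E]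
  {H : Type*} [TopologicalSpace H] {I : ModelWithCorners ℝ E H}
  {M : Type*} [TopologicalSpace M] [ChartedSpace H M]
  {F : Type*} [NormedAddCommGroup F] [NormedSpace ℝ F] [FiniteDimensional ℝ F]
  {G : Type*} [NormedAddCommGroup G] [NormedSpace ℝ G]

/-- A family of linear maps on a finite-dimensional space is smooth if its values are. -/
theorem contMDiffAt_clm_of_apply {n : WithTop ℕ∞} {f : M → F →L[ℝ] G} {x : M}
    (h : ∀ v, ContMDiffAt I 𝓘(ℝ, G) n (fun m ↦ f m v) x) :
    ContMDiffAt I 𝓘(ℝ, F →L[ℝ] G) n f x := by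
  let b := Module.finBasis ℝ F
  let T : (Fin (Module.finrank ℝ F) → G) →L[ℝ] (F →L[ℝ] G) :=
    ∑ i, (ContinuousLinearMap.smulRightL ℝ F G (LinearMap.toContinuousLinearMap (b.coord i))).comp
      (ContinuousLinearMap.proj i)
  have hT : f = T ∘ fun m i ↦ f m (b i) := by
    funext m
    ext v
    conv_lhs => rw [← b.sum_repr v, map_sum]
    simp [T]
  rw [hT]
  exact T.contMDiff.contMDiffAt.comp x (contMDiffAt_pi_space.2 fun i ↦ h (b i))

theorem contDiffAt_clm_of_apply {n : WithTop ℕ∞} {f : E → F →L[ℝ] G} {x : E}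
    (h : ∀ v, ContDiffAt ℝ n (fun m ↦ f m v) x) : ContDiffAt ℝ n f x :=
  (contMDiffAt_clm_of_apply (I := 𝓘(ℝ, E)) fun v ↦ (h v).contMDiffAt).contDiffAt

/-- A family of alternating maps on a finite-dimensional space is smooth if its values are. -/
theorem contDiffAt_alternating_of_apply {n : WithTop ℕ∞} {k : ℕ} {f : E → F [⋀^Fin k]→L[ℝ] ℝ}
    {x : E} (h : ∀ v, ContDiffAt ℝ n (fun m ↦ f m v) x) : ContDiffAt ℝ n f x := by
  let b := Module.finBasis ℝ F
  let L : (F [⋀^Fin k]→L[ℝ] ℝ) →ₗ[ℝ] ((Fin k → Fin (Module.finrank ℝ F)) → ℝ) :=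
    { toFun := fun η j ↦ η fun i ↦ b (j i)
      map_add' := fun _ _ ↦ rfl
      map_smul' := fun _ _ ↦ rfl }
  have hL : LinearMap.ker L = ⊥ := by
    rw [LinearMap.ker_eq_bot']
    intro η hη
    apply ContinuousAlternatingMap.toContinuousMultilinearMap_injective
    apply ContinuousMultilinearMap.toMultilinearMap_injective
    refine Module.Basis.ext_multilinear (fun _ ↦ b) fun j ↦ ?_
    exact congrFun hη j
  -- Evaluation on tuples of basis vectors is injective. A linear left inverse rebuilds the form
  -- from finitely many smooth scalar functions.
  obtain ⟨g, hg⟩ := L.exists_leftInverse_of_injective hL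
  have hf : f = (LinearMap.toContinuousLinearMap g) ∘ fun m j ↦ f m fun i ↦ b (j i) := by
    funext m
    exact (LinearMap.congr_fun hg (f m)).symm
  rw [hf]
  exact (ContinuousLinearMap.contDiff _).contDiffAt.comp x (contDiffAt_pi.2 fun j ↦ h _)

theorem alternating_map_add_right (η : F [⋀^Fin 2]→L[ℝ] G) (v w w' : F) :
    η ![v, w + w'] = η ![v, w] + η ![v, w'] := by
  have h : ∀ u, Function.update ![v, 0] 1 u = ![v, u] := fun u ↦ by ext i; fin_cases i <;> rfl
  simpa only [h] using η.map_update_add ![v, 0] 1 w w'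

theorem alternating_map_smul_right (η : F [⋀^Fin 2]→L[ℝ] G) (c : ℝ) (v w : F) :
    η ![v, c • w] = c • η ![v, w] := by
  have h : ∀ u, Function.update ![v, 0] 1 u = ![v, u] := fun u ↦ by ext i; fin_cases i <;> rfl
  simpa only [h] using η.map_update_smul ![v, 0] 1 c w

/-- The bilinear map of an alternating 2-form. -/
def bilinOfAlternating (η : F [⋀^Fin 2]→L[ℝ] G) : F →L[ℝ] F →L[ℝ] G :=
  LinearMap.toContinuousBilinearMap (LinearMap.mk₂ ℝ (fun v w ↦ η ![v, w])
    (fun v v' w ↦ η.map_vecCons_add ![w] v v')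
    (fun c v w ↦ η.map_vecCons_smul ![w] c v)
    (alternating_map_add_right η) (alternating_map_smul_right η))

end Components

/-! ### Solving `i_X η = df` for a non-degenerate 2-form -/

section Nondegenerate

variable {E : Type*} [NormedAddCommGroup E] [NormedSpace ℝ E] [FiniteDimensional ℝ E]
  {H : Type*} [TopologicalSpace H] {I : ModelWithCorners ℝ E H} [I.Boundaryless]
  {M : Type*} [TopologicalSpace M] [ChartedSpace H M] [IsManifold I ∞ M]

theorem DiffForm.isSmooth_of_apply {k : ℕ} {η : DiffForm I M k}
    (h : ∀ x, ∀ y ∈ (extChartAt I x).target, ∀ v, ContDiffAt ℝ ∞ (fun y ↦ η.inChart x y v) y) :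
    η.IsSmooth :=
  fun x y hy ↦ (contDiffAt_alternating_of_apply (h x y hy)).contDiffWithinAt

/-- A non-degenerate bilinear form on a finite-dimensional space is invertible. -/
theorem isInvertible_of_nondegenerate (B : E →L[ℝ] E →L[ℝ] ℝ)
    (hB : ∀ u, (∀ v, B u v = 0) → u = 0) : B.IsInvertible := by
  have hinj : Function.Injective B.toLinearMap :=
    (injective_iff_map_eq_zero _).2 fun u hu ↦ hB u fun v ↦ by
      have : B u = 0 := hu
      rw [this]; rfl
  have hdim : Module.finrank ℝ E = Module.finrank ℝ (E →L[ℝ] ℝ) := by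
    rw [← Subspace.dual_finrank_eq (K := ℝ) (V := E)]
    exact (LinearMap.toContinuousLinearMap (𝕜 := ℝ) (E := E) (F' := ℝ)).finrank_eq
  let e := LinearEquiv.ofInjectiveOfFinrankEq B.toLinearMap hinj hdim
  exact ⟨e.toContinuousLinearEquiv, by ext; rfl⟩

theorem DiffForm.ContractsTo.unique {η : DiffForm I M 2} (hη : η.Nondegenerate) {f : M → ℝ} {x : M}
    {X X' : TangentSpace I x} (h : η.ContractsTo f x X) (h' : η.ContractsTo f x X') : X = X' := by
  have key : ∀ v : TangentSpace I x, η x ![X - X', v] = 0 := fun v ↦ by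
    have := (η x).map_vecCons_sub X X' ![v]
    rw [this, h v, h' v, sub_self]
  exact sub_eq_zero.1 (hη x _ key)

theorem DiffForm.Nondegenerate.isInvertible_inChart {η : DiffForm I M 2} (hη : η.Nondegenerate)
    (x : M) {y : E} (hy : y ∈ (extChartAt I x).target) :
    (bilinOfAlternating (η.inChart x y)).IsInvertible := by
  refine isInvertible_of_nondegenerate _ fun u hu ↦ ?_
  obtain ⟨e, he⟩ := isInvertible_mfderivWithin_extChartAt_symm (I := I) hy
  have h0 : mfderivWithin 𝓘(ℝ, E) I (extChartAt I x).symm (Set.range I) y u = 0 := by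
    refine hη _ _ fun v ↦ ?_
    have := hu (e.symm v)
    simp only [DiffForm.inChart] at this
    have h2 : mfderivWithin 𝓘(ℝ, E) I (extChartAt I x).symm (Set.range I) y (e.symm v) = v := by
      rw [← he]
      exact e.apply_symm_apply v
    rw [← this]
    change _ = (η ((extChartAt I x).symm y)) _
    congr 1
    funext i
    fin_cases i
    · rfl
    · exact h2.symm
  rw [← he] at h0
  exact e.map_eq_zero_iff.1 h0

/-- A smooth non-degenerate 2-form turns every function into a vector field, smooth if the
function is. -/
theorem DiffForm.Nondegenerate.exists_contractsTo {η : DiffForm I M 2} (hη : η.Nondegenerate)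
    (f : M → ℝ) (x : M) : ∃ X, η.ContractsTo f x X := by
  obtain ⟨e, he⟩ := hη.isInvertible_inChart x (mem_extChartAt_target x)
  rw [η.inChart_self] at he
  refine ⟨e.symm (mvfderiv I f x), fun v ↦ ?_⟩
  have h2 : e (e.symm (mvfderiv I f x)) = (show E →L[ℝ] ℝ from mvfderiv I f x) :=
    e.apply_symm_apply _
  exact (congrArg (fun L : E →L[ℝ] E →L[ℝ] ℝ ↦ L (e.symm (mvfderiv I f x)) v) he.symm).trans
    (congrArg (fun L : E →L[ℝ] ℝ ↦ L v) h2)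

/-- In a chart the field solves a linear system whose operator and right-hand side depend smoothly
on the point, and inversion of operators is smooth at invertible ones. -/
theorem DiffForm.Nondegenerate.isSmoothField {η : DiffForm I M 2} (hη : η.Nondegenerate)
    (hs : η.IsSmooth) {f : M → ℝ} (hf : ContMDiff I 𝓘(ℝ, ℝ) ∞ f)
    {X : (x : M) → TangentSpace I x} (hX : ∀ x, η.ContractsTo f x (X x)) : IsSmoothField X := by
  intro x
  refine (Bundle.contMDiffAt_section x).2 (contMDiffAt_iff_source.2 ?_)
  rw [I.range_eq_univ, contMDiffWithinAt_univ, contMDiffAt_iff_contDiffAt]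
  have hx := mem_extChartAt_target (I := I) x
  have hopen := isOpen_extChartAt_target (I := I) x
  let B : E → E →L[ℝ] E →L[ℝ] ℝ := fun y ↦ bilinOfAlternating (η.inChart x y)
  have hB : ContDiffAt ℝ ∞ B (extChartAt I x x) := by
    refine contDiffAt_clm_of_apply fun v ↦ contDiffAt_clm_of_apply fun w ↦ ?_
    exact (ContinuousAlternatingMap.apply ℝ E ℝ ![v, w]).contDiff.contDiffAt.comp _
      ((hs x).contDiffAt (hopen.mem_nhds hx))
  have hfc : ContDiffAt ℝ ∞ (f ∘ (extChartAt I x).symm) (extChartAt I x x) := by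
    have := contMDiffAt_iff_source.1 (hf x)
    rwa [I.range_eq_univ, contMDiffWithinAt_univ, contMDiffAt_iff_contDiffAt] at this
  have hsol : ContDiffAt ℝ ∞ (fun y ↦ (B y).inverse (fderiv ℝ (f ∘ (extChartAt I x).symm) y))
      (extChartAt I x x) := by
    have hinv : ContDiffAt ℝ ∞ ContinuousLinearMap.inverse (B (extChartAt I x x)) :=
      (hη.isInvertible_inChart x hx).contDiffAt_map_inverse
    exact (hinv.comp (extChartAt I x x) hB).clm_apply (hfc.fderiv_right le_rfl)
  refine hsol.congr_of_eventuallyEq ?_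
  filter_upwards [hopen.mem_nhds hx] with y hy
  have hsrc : (extChartAt I x).symm y ∈ (chartAt H x).source := by
    rw [← extChartAt_source I]; exact (extChartAt I x).map_target hy
  obtain ⟨e, he⟩ := hη.isInvertible_inChart x hy
  set Y : E := mfderiv I 𝓘(ℝ, E) (extChartAt I x) ((extChartAt I x).symm y)
    (X ((extChartAt I x).symm y)) with hY
  have hYX : mfderivWithin 𝓘(ℝ, E) I (extChartAt I x).symm (Set.range I) y Y =
      X ((extChartAt I x).symm y) :=
    congrArg (fun L ↦ L (X ((extChartAt I x).symm y)))
      (mfderivWithin_extChartAt_symm_comp_mfderiv_extChartAt (I := I) hy)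
  have hcoord : (trivializationAt E (TangentSpace I) x
      ⟨(extChartAt I x).symm y, X ((extChartAt I x).symm y)⟩).2 = Y := by
    rw [hY, ← TangentBundle.continuousLinearMapAt_trivializationAt hsrc]
    exact ((trivializationAt E (TangentSpace I) x).coe_linearMapAt_of_mem (R := ℝ)
      (b := (extChartAt I x).symm y) hsrc ▸ rfl)
  have hBY : B y Y = fderiv ℝ (f ∘ (extChartAt I x).symm) y := by
    ext v
    have h1 : B y Y v = η ((extChartAt I x).symm y) ![X ((extChartAt I x).symm y),
        mfderivWithin 𝓘(ℝ, E) I (extChartAt I x).symm (Set.range I) y v] := by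
      change η ((extChartAt I x).symm y) _ = _
      congr 1
      funext i
      fin_cases i
      · exact hYX
      · rfl
    rw [h1, hX _ _]
    have h2 := mdifferentiableWithinAt_extChartAt_symm (I := I) hy
    rw [I.range_eq_univ, mdifferentiableWithinAt_univ] at h2
    rw [I.range_eq_univ, mfderivWithin_univ, ← mfderiv_eq_fderiv,
      mfderiv_comp y (I' := I) ((hf _).mdifferentiableAt (by simp)) h2]
    rfl
  change (trivializationAt E (TangentSpace I) x
      ⟨(extChartAt I x).symm y, X ((extChartAt I x).symm y)⟩).2 = _
  rw [hcoord, ← hBY]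
  change _ = (bilinOfAlternating (η.inChart x y)).inverse _
  have : B y = e := he.symm
  rw [this, ← he, ContinuousLinearMap.inverse_equiv]
  exact (e.symm_apply_apply Y).symm

end Nondegenerate

/-! ### Linear algebra of the canonical 2-form -/

section Linear

variable {E : Type*} [NormedAddCommGroup E] [NormedSpace ℝ E]
  {F : Type*} [NormedAddCommGroup F] [NormedSpace ℝ F]

theorem extDeriv_one_form_apply {f : E → E [⋀^Fin 1]→L[ℝ] ℝ} {y : E}
    (hf : DifferentiableAt ℝ f y) (u : Fin 2 → E) :
    extDeriv f y u = fderiv ℝ (fun y ↦ f y ![u 1]) y (u 0) -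
      fderiv ℝ (fun y ↦ f y ![u 0]) y (u 1) := by
  rw [extDeriv_apply hf]
  have h0 : (0 : Fin 2).removeNth u = ![u 1] := by ext i; fin_cases i; rfl
  have h1 : (1 : Fin 2).removeNth u = ![u 0] := by ext i; fin_cases i; rfl
  rw [Fin.sum_univ_two, h0, h1]
  simp [sub_eq_add_neg]

theorem eq_zero_of_forall_canonical_eq_zero (u : E × (E →L[ℝ] ℝ))
    (h : ∀ v : E × (E →L[ℝ] ℝ), v.2 u.1 - u.2 v.1 = 0) : u = 0 := by
  refine Prod.ext ?_ ?_
  · refine (SeparatingDual.eq_zero_iff_forall_dual_eq_zero (R := ℝ) _).2 fun g ↦ ?_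
    simpa using h (0, g)
  · ext w
    simpa using h (w, 0)

end Linear

/-! ### Canonical coordinates on the cotangent bundle -/

section Cotangent

variable {E : Type*} [NormedAddCommGroup E] [NormedSpace ℝ E]
  {M : Type*} [TopologicalSpace M] [ChartedSpace E M] [IsManifold 𝓘(ℝ, E) ∞ M]

/-- The fibre coordinate of a covector in the preferred chart at `x`. -/
theorem cotangent_trivializationAt_snd (x : M) (α : CotangentBundle E M) :
    (trivializationAt (E →L[ℝ] ℝ)
      (fun x : M ↦ TangentSpace 𝓘(ℝ, E) x →L[ℝ] Bundle.Trivial M ℝ x) x α).2 =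
      (covector α).comp ((trivializationAt E (TangentSpace 𝓘(ℝ, E)) x).symmL ℝ α.proj) := by
  rw [hom_trivializationAt_apply]
  ext v
  simp [ContinuousLinearMap.inCoordinates, covector]

theorem cotangent_extChartAt_fst (α₀ α : CotangentBundle E M) :
    (extChartAt (cotModel E) α₀ α).1 = extChartAt 𝓘(ℝ, E) α₀.proj α.proj := by
  rw [FiberBundle.extChartAt]
  rfl

theorem cotangent_extChartAt_snd (α₀ α : CotangentBundle E M) :
    (extChartAt (cotModel E) α₀ α).2 =
      (covector α).comp ((trivializationAt E (TangentSpace 𝓘(ℝ, E)) α₀.proj).symmL ℝ α.proj) := by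
  rw [← cotangent_trivializationAt_snd, FiberBundle.extChartAt]
  rfl

theorem cotangent_mem_target_iff (α₀ : CotangentBundle E M) (y : E × (E →L[ℝ] ℝ)) :
    y ∈ (extChartAt (cotModel E) α₀).target ↔ y.1 ∈ (extChartAt 𝓘(ℝ, E) α₀.proj).target := by
  rw [FiberBundle.extChartAt_target]
  have : (trivializationAt (E →L[ℝ] ℝ)
      (fun x : M ↦ TangentSpace 𝓘(ℝ, E) x →L[ℝ] Bundle.Trivial M ℝ x) α₀.proj).baseSet =
      (chartAt E α₀.proj).source := by
    rw [hom_trivializationAt_baseSet]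
    simp
  rw [this, ← extChartAt_source 𝓘(ℝ, E)]
  constructor
  · rintro ⟨h, -⟩
    exact h.1
  · intro h
    exact ⟨⟨h, (extChartAt 𝓘(ℝ, E) α₀.proj).map_target h⟩, trivial⟩

theorem cotangent_mem_source_iff (α₀ α : CotangentBundle E M) :
    α ∈ (extChartAt (cotModel E) α₀).source ↔ α.proj ∈ (extChartAt 𝓘(ℝ, E) α₀.proj).source := by
  rw [extChartAt_source, extChartAt_source, FiberBundle.chartedSpace_chartAt]
  constructor
  · intro h
    have := h.1
    simpa using this
  · intro h
    simp [h]

theorem cotangent_symm_proj (α₀ : CotangentBundle E M) {y : E × (E →L[ℝ] ℝ)}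
    (hy : y ∈ (extChartAt (cotModel E) α₀).target) :
    ((extChartAt (cotModel E) α₀).symm y).proj = (extChartAt 𝓘(ℝ, E) α₀.proj).symm y.1 := by
  have h := cotangent_extChartAt_fst α₀ ((extChartAt (cotModel E) α₀).symm y)
  rw [(extChartAt (cotModel E) α₀).right_inv hy] at h
  have hs := (extChartAt (cotModel E) α₀).map_target hy
  rw [h, (extChartAt 𝓘(ℝ, E) α₀.proj).left_inv ((cotangent_mem_source_iff _ _).1 hs)]

theorem tangentProj_comp_mfderivWithin_symm (α₀ : CotangentBundle E M) {y : E × (E →L[ℝ] ℝ)}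
    (hy : y ∈ (extChartAt (cotModel E) α₀).target) (u : E × (E →L[ℝ] ℝ)) :
    tangentProj ((extChartAt (cotModel E) α₀).symm y)
      (mfderivWithin 𝓘(ℝ, E × (E →L[ℝ] ℝ)) (cotModel E) (extChartAt (cotModel E) α₀).symm
        (Set.range (cotModel E)) y u) =
      mfderivWithin 𝓘(ℝ, E) 𝓘(ℝ, E) (extChartAt 𝓘(ℝ, E) α₀.proj).symm (Set.range 𝓘(ℝ, E)) y.1 u.1 := by
  have hy1 := (cotangent_mem_target_iff α₀ y).1 hy
  have h1 := mdifferentiableWithinAt_extChartAt_symm hy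
  have h2 := mdifferentiableWithinAt_extChartAt_symm hy1
  rw [ModelWithCorners.range_eq_univ] at h1 h2 ⊢
  rw [mdifferentiableWithinAt_univ] at h1 h2
  rw [ModelWithCorners.range_eq_univ, mfderivWithin_univ, mfderivWithin_univ]
  have hproj : MDifferentiableAt (cotModel E) 𝓘(ℝ, E) (fun a : CotangentBundle E M ↦ a.proj)
      ((extChartAt (cotModel E) α₀).symm y) :=
    (Bundle.contMDiff_proj (n := 1) _).mdifferentiableAt (by simp)
  have c1 := mfderiv_comp y hproj h1
  have hfst : MDifferentiableAt 𝓘(ℝ, E × (E →L[ℝ] ℝ)) 𝓘(ℝ, E) (Prod.fst : E × (E →L[ℝ] ℝ) → E) y :=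
    differentiableAt_fst.mdifferentiableAt
  have c2 := mfderiv_comp y (I' := 𝓘(ℝ, E)) h2 hfst
  have heq : (fun a : CotangentBundle E M ↦ a.proj) ∘ (extChartAt (cotModel E) α₀).symm =ᶠ[𝓝 y]
      (extChartAt 𝓘(ℝ, E) α₀.proj).symm ∘ Prod.fst := by
    filter_upwards [(isOpen_extChartAt_target α₀).mem_nhds hy] with y' hy'
    exact cotangent_symm_proj α₀ hy'
  have hu : mfderiv 𝓘(ℝ, E × (E →L[ℝ] ℝ)) 𝓘(ℝ, E) (Prod.fst : E × (E →L[ℝ] ℝ) → E) y u = u.1 := by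
    rw [mfderiv_eq_fderiv, fderiv_fst]
    rfl
  have c3 := congrArg (fun L : E × (E →L[ℝ] ℝ) →L[ℝ] E ↦ L u)
    (show (_ : E × (E →L[ℝ] ℝ) →L[ℝ] E) = _ from c1.symm.trans (heq.mfderiv_eq.trans c2))
  refine Eq.trans c3 ?_
  exact congrArg (mfderiv 𝓘(ℝ, E) 𝓘(ℝ, E) (extChartAt 𝓘(ℝ, E) α₀.proj).symm y.1) hu

/-- The fibre coordinate of a covector is its composition with the derivative of the inverse chart
of the base. This makes the bundle charts canonical: the Liouville form becomes p ds. -/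
theorem covector_symm_apply (α₀ : CotangentBundle E M) {y : E × (E →L[ℝ] ℝ)}
    (hy : y ∈ (extChartAt (cotModel E) α₀).target) (v : E) :
    covector ((extChartAt (cotModel E) α₀).symm y)
      (mfderivWithin 𝓘(ℝ, E) 𝓘(ℝ, E) (extChartAt 𝓘(ℝ, E) α₀.proj).symm (Set.range 𝓘(ℝ, E)) y.1 v) =
      y.2 v := by
  have hy1 := (cotangent_mem_target_iff α₀ y).1 hy
  have h := cotangent_extChartAt_snd α₀ ((extChartAt (cotModel E) α₀).symm y)
  rw [(extChartAt (cotModel E) α₀).right_inv hy, TangentBundle.symmL_trivializationAt,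
    cotangent_symm_proj α₀ hy, PartialEquiv.right_inv _ hy1] at h
  · rw [h]
    rfl
  · rw [cotangent_symm_proj α₀ hy, ← extChartAt_source 𝓘(ℝ, E)]
    exact PartialEquiv.map_target _ hy1

theorem liouvilleForm_inChart (α₀ : CotangentBundle E M) {y : E × (E →L[ℝ] ℝ)}
    (hy : y ∈ (extChartAt (cotModel E) α₀).target) (u : Fin 1 → E × (E →L[ℝ] ℝ)) :
    (liouvilleForm E M).inChart α₀ y u = y.2 (u 0).1 := by
  rw [← covector_symm_apply α₀ hy]
  change covector ((extChartAt (cotModel E) α₀).symm y)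
    (tangentProj ((extChartAt (cotModel E) α₀).symm y) _) = _
  rw [← tangentProj_comp_mfderivWithin_symm α₀ hy]
  rfl

/-- The preferred charts have identity derivative at their centres, so the tangent space at α may be
treated as E × E*. Pointwise computations on T*M thereby become linear algebra. -/
theorem tangentProj_apply (α : CotangentBundle E M) (u : E × (E →L[ℝ] ℝ)) :
    tangentProj α u = u.1 := by
  have h := tangentProj_comp_mfderivWithin_symm α (mem_extChartAt_target α) u
  rw [mfderivWithin_range_extChartAt_symm, cotangent_extChartAt_fst,
    mfderivWithin_range_extChartAt_symm, extChartAt_to_inv] at h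
  exact h

variable [FiniteDimensional ℝ E]

theorem contDiffAt_liouvilleForm_inChart (α₀ : CotangentBundle E M) {y : E × (E →L[ℝ] ℝ)}
    (hy : y ∈ (extChartAt (cotModel E) α₀).target) :
    ContDiffAt ℝ ∞ ((liouvilleForm E M).inChart α₀) y := by
  refine contDiffAt_alternating_of_apply fun v ↦ ?_
  have : ContDiffAt ℝ ∞ (fun y : E × (E →L[ℝ] ℝ) ↦ y.2 (v 0).1) y :=
    contDiffAt_snd.clm_apply contDiffAt_const
  refine this.congr_of_eventuallyEq ?_
  filter_upwards [(isOpen_extChartAt_target α₀).mem_nhds hy] with y' hy'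
  exact liouvilleForm_inChart α₀ hy' v

theorem fderiv_liouvilleForm_inChart (α₀ : CotangentBundle E M) {y : E × (E →L[ℝ] ℝ)}
    (hy : y ∈ (extChartAt (cotModel E) α₀).target) (u : E × (E →L[ℝ] ℝ))
    (v : Fin 1 → E × (E →L[ℝ] ℝ)) :
    fderiv ℝ (fun y' ↦ (liouvilleForm E M).inChart α₀ y' v) y u = u.2 (v 0).1 := by
  have heq : (fun y' ↦ (liouvilleForm E M).inChart α₀ y' v) =ᶠ[𝓝 y]
      fun y : E × (E →L[ℝ] ℝ) ↦ y.2 (v 0).1 := by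
    filter_upwards [(isOpen_extChartAt_target α₀).mem_nhds hy] with y' hy'
    exact liouvilleForm_inChart α₀ hy' v
  rw [heq.fderiv_eq]
  have h2 : HasFDerivAt (fun y : E × (E →L[ℝ] ℝ) ↦ y.2 (v 0).1)
      ((ContinuousLinearMap.apply ℝ ℝ (v 0).1).comp (ContinuousLinearMap.snd ℝ E (E →L[ℝ] ℝ))) y :=
    ((ContinuousLinearMap.apply ℝ ℝ (v 0).1).comp
      (ContinuousLinearMap.snd ℝ E (E →L[ℝ] ℝ))).hasFDerivAt
  rw [h2.fderiv]
  rfl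

/-- In canonical coordinates, the symplectic form is `∑ dsⁱ ∧ dpᵢ`. -/
theorem canonicalForm_inChart (α₀ : CotangentBundle E M) {y : E × (E →L[ℝ] ℝ)}
    (hy : y ∈ (extChartAt (cotModel E) α₀).target) (u : Fin 2 → E × (E →L[ℝ] ℝ)) :
    (canonicalForm E M).inChart α₀ y u = (u 1).2 (u 0).1 - (u 0).2 (u 1).1 := by
  have hd : DifferentiableAt ℝ ((liouvilleForm E M).inChart α₀) y :=
    (contDiffAt_liouvilleForm_inChart α₀ hy).differentiableAt (by simp)
  have h1 : (canonicalForm E M).inChart α₀ y u = -((liouvilleForm E M).d.inChart α₀ y u) := rfl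
  rw [h1, DiffForm.d_inChart _ _ hy hd, extDeriv_one_form_apply hd,
    fderiv_liouvilleForm_inChart α₀ hy, fderiv_liouvilleForm_inChart α₀ hy]
  simp

theorem canonicalForm_apply (α : CotangentBundle E M) (u v : E × (E →L[ℝ] ℝ)) :
    canonicalForm E M α ![u, v] = v.2 u.1 - u.2 v.1 := by
  have := canonicalForm_inChart α (mem_extChartAt_target α) ![u, v]
  rw [DiffForm.inChart_self] at this
  exact this

theorem canonicalForm_nondegenerate : (canonicalForm E M).Nondegenerate := by
  intro α u hu
  refine eq_zero_of_forall_canonical_eq_zero (E := E) u fun v ↦ ?_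
  exact (canonicalForm_apply α u v).symm.trans (hu v)

theorem contractsTo_hamiltonianVector (f : CotangentBundle E M → ℝ) (α : CotangentBundle E M) :
    (canonicalForm E M).ContractsTo f α (hamiltonianVector f α) :=
  Classical.epsilon_spec (canonicalForm_nondegenerate.exists_contractsTo f α)

end Cotangent

/-! ### Submersions: local sections and fibre dimension -/

section Submersion

universe u

variable {E : Type u} [NormedAddCommGroup E] [NormedSpace ℝ E]
  {M : Type*} [TopologicalSpace M] [ChartedSpace E M] [IsManifold 𝓘(ℝ, E) ∞ M]
  {E' : Type*} [NormedAddCommGroup E'] [NormedSpace ℝ E']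
  {M' : Type*} [TopologicalSpace M'] [ChartedSpace E' M'] [IsManifold 𝓘(ℝ, E') ∞ M']

/-- A submersion has smooth local sections. -/
theorem _root_.Manifold.IsSubmersionAt.exists_local_section {f : M → M'} {x : M}
    (hf : Manifold.IsSubmersionAt 𝓘(ℝ, E) 𝓘(ℝ, E') ∞ f x) :
    ∃ σ : M' → M, ContMDiffAt 𝓘(ℝ, E') 𝓘(ℝ, E) ∞ σ (f x) ∧ σ (f x) = x ∧
      ∀ᶠ y in 𝓝 (f x), f (σ y) = y := by
  obtain ⟨F, _, _, h⟩ := hf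
  set φ := h.domChart
  set ψ := h.codChart
  have hxφ : x ∈ φ.source := h.mem_domChart_source
  have hxψ : f x ∈ ψ.source := h.mem_codChart_source
  have hw : ∀ z ∈ φ.target, ψ (f (φ.symm z)) = (h.equiv z).1 := fun z hz ↦ by
    have hz' : z ∈ (h.domChart.extend 𝓘(ℝ, E)).target := by simpa using hz
    simpa using h.writtenInCharts hz'
  -- In the submersion charts f is the projection of E' × F to E'. The section freezes the
  -- F-coordinate at its value at x.
  let c : M' → E := fun y ↦ h.equiv.symm (ψ y, (h.equiv (φ x)).2)
  have hcx : c (f x) = φ x := by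
    have h1 := hw (φ x) (φ.map_source hxφ)
    rw [φ.left_inv hxφ] at h1
    simp only [c, h1, Prod.mk.eta, ContinuousLinearEquiv.symm_apply_apply]
  have hψ : ContMDiffAt 𝓘(ℝ, E') 𝓘(ℝ, E') ∞ ψ (f x) :=
    contMDiffAt_of_mem_maximalAtlas h.codChart_mem_maximalAtlas hxψ
  have hc : ContMDiffAt 𝓘(ℝ, E') 𝓘(ℝ, E) ∞ c (f x) := by
    have h1 : ContMDiffAt 𝓘(ℝ, E') 𝓘(ℝ, E' × F) ∞ (fun y ↦ (ψ y, (h.equiv (φ x)).2)) (f x) :=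
      hψ.prodMk_space contMDiffAt_const
    exact h.equiv.symm.contDiff.contMDiff.contMDiffAt.comp (f x) h1
  have hmem : ∀ᶠ y in 𝓝 (f x), c y ∈ φ.target :=
    hc.continuousAt.eventually_mem (φ.open_target.mem_nhds (by rw [hcx]; exact φ.map_source hxφ))
  refine ⟨φ.symm ∘ c, ?_, ?_, ?_⟩
  · refine ContMDiffAt.comp (f x) ?_ hc
    rw [hcx]
    exact contMDiffAt_symm_of_mem_maximalAtlas h.domChart_mem_maximalAtlas (φ.map_source hxφ)
  · simp only [Function.comp_apply, hcx, φ.left_inv hxφ]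
  · filter_upwards [hmem, ψ.open_source.mem_nhds hxψ] with y hy hyψ
    have h1 := hw (c y) hy
    have h2 : f (φ.symm (c y)) ∈ ψ.source := h.mapsto_domChart_source_codChart_source
      (φ.map_target hy)
    have h3 : (h.equiv (c y)).1 = ψ y := by simp [c]
    rw [h3] at h1
    exact ψ.injOn h2 hyψ h1

theorem _root_.Manifold.IsSubmersionAt.surjective_mfderiv {f : M → M'} {x : M}
    (hf : Manifold.IsSubmersionAt 𝓘(ℝ, E) 𝓘(ℝ, E') ∞ f x) :
    Function.Surjective (mfderiv 𝓘(ℝ, E) 𝓘(ℝ, E') f x) := by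
  obtain ⟨σ, hσ, hσx, hfσ⟩ := hf.exists_local_section
  have h1 : HasMFDerivAt 𝓘(ℝ, E') 𝓘(ℝ, E') (f ∘ σ) (f x) (ContinuousLinearMap.id ℝ E') :=
    (hasMFDerivAt_id (f x)).congr_of_eventuallyEq hfσ
  have hfd : ∀ z, z = x → HasMFDerivAt 𝓘(ℝ, E) 𝓘(ℝ, E') f z
      (show E →L[ℝ] E' from mfderiv 𝓘(ℝ, E) 𝓘(ℝ, E') f x) := by
    rintro _ rfl
    exact (hf.contMDiffAt.mdifferentiableAt (by simp)).hasMFDerivAt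
  have h2 := (hfd _ hσx).comp (f x) (hσ.mdifferentiableAt (by simp)).hasMFDerivAt
  intro v
  refine ⟨mfderiv 𝓘(ℝ, E') 𝓘(ℝ, E) σ (f x) v, ?_⟩
  exact congrArg (fun L : E' →L[ℝ] E' ↦ L v) (hasMFDerivAt_unique h2 h1)

/-- The fibre of a submersion through a point has local coordinates: there is a local smooth map
to a complement of the model space of the target that sends the fibre onto a neighbourhood. -/
theorem _root_.Manifold.IsSubmersionAt.exists_fibre_coordinate {f : M → M'} {x : M}
    (hf : Manifold.IsSubmersionAt 𝓘(ℝ, E) 𝓘(ℝ, E') ∞ f x) :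
    ∃ (F : Type u) (_ : NormedAddCommGroup F) (_ : NormedSpace ℝ F) (_ : E ≃L[ℝ] E' × F)
      (U : Set M) (κ : M → F), IsOpen U ∧ x ∈ U ∧ ContMDiffOn 𝓘(ℝ, E) 𝓘(ℝ, F) ∞ κ U ∧
        κ '' (U ∩ f ⁻¹' {f x}) ∈ 𝓝 (κ x) := by
  obtain ⟨F, _, _, h⟩ := hf
  set φ := h.domChart
  set ψ := h.codChart
  have hxφ : x ∈ φ.source := h.mem_domChart_source
  have hw : ∀ z ∈ φ.target, ψ (f (φ.symm z)) = (h.equiv z).1 := fun z hz ↦ by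
    have hz' : z ∈ (h.domChart.extend 𝓘(ℝ, E)).target := by simpa using hz
    simpa using h.writtenInCharts hz'
  refine ⟨F, _, _, h.equiv, φ.source, fun y ↦ (h.equiv (φ y)).2, φ.open_source, hxφ, ?_, ?_⟩
  · have h1 : ContMDiffOn 𝓘(ℝ, E) 𝓘(ℝ, E) ∞ φ φ.source :=
      contMDiffOn_of_mem_maximalAtlas h.domChart_mem_maximalAtlas
    have h2 : ContMDiff 𝓘(ℝ, E) 𝓘(ℝ, F) ∞ (fun z ↦ (h.equiv z).2) :=
      (contDiff_snd.comp h.equiv.contDiff).contMDiff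
    exact h2.comp_contMDiffOn h1
  -- The fibre is the slice of constant E'-coordinate, and `j` inserts w into this slice.
  · let j : F → E := fun w ↦ h.equiv.symm ((h.equiv (φ x)).1, w)
    have hj : Continuous j := h.equiv.symm.continuous.comp (by fun_prop)
    have hjx : j (h.equiv (φ x)).2 = φ x := by simp [j]
    have hmem : ∀ᶠ w in 𝓝 (h.equiv (φ x)).2, j w ∈ φ.target :=
      hj.continuousAt.eventually_mem (φ.open_target.mem_nhds (by rw [hjx]; exact φ.map_source hxφ))
    filter_upwards [hmem] with w hwt
    refine ⟨φ.symm (j w), ⟨φ.map_target hwt, ?_⟩, by simp [φ.right_inv hwt, j]⟩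
    have h1 := hw (j w) hwt
    have h2 := hw (φ x) (φ.map_source hxφ)
    rw [φ.left_inv hxφ] at h2
    have h3 : (h.equiv (j w)).1 = (h.equiv (φ x)).1 := by simp [j]
    rw [h3, ← h2] at h1
    exact ψ.injOn (h.mapsto_domChart_source_codChart_source (φ.map_target hwt))
      (h.mapsto_domChart_source_codChart_source hxφ) h1

/-- The image of an open subset of a manifold under a smooth map has at most the dimension of
the manifold. -/
theorem dimH_image_le_finrank [FiniteDimensional ℝ E] [SecondCountableTopology M]
    {F : Type*} [NormedAddCommGroup F] [NormedSpace ℝ F]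
    {κ : M → F} {V : Set M} (hV : IsOpen V) (hκ : ContMDiffOn 𝓘(ℝ, E) 𝓘(ℝ, F) ∞ κ V) :
    dimH (κ '' V) ≤ Module.finrank ℝ E := by
  -- A C¹ map is locally Lipschitz in charts, and Lipschitz maps do not raise Hausdorff dimension.
  -- Second countability then leaves a countable union of such pieces.
  have hloc : ∀ x ∈ V, ∃ N ∈ 𝓝[V] x, dimH (κ '' N) ≤ Module.finrank ℝ E := by
    intro x hx
    have h1 : ContMDiffAt 𝓘(ℝ, E) 𝓘(ℝ, F) ∞ κ x := hκ.contMDiffAt (hV.mem_nhds hx)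
    have h2 := contMDiffAt_iff_source.1 h1
    rw [ModelWithCorners.range_eq_univ, contMDiffWithinAt_univ, contMDiffAt_iff_contDiffAt] at h2
    obtain ⟨K, t, ht, hlip⟩ := (h2.of_le (m := 1) (by simp)).exists_lipschitzOnWith
    refine ⟨(extChartAt 𝓘(ℝ, E) x).source ∩ extChartAt 𝓘(ℝ, E) x ⁻¹' t, mem_nhdsWithin_of_mem_nhds
      (Filter.inter_mem (extChartAt_source_mem_nhds x)
        ((continuousAt_extChartAt x).preimage_mem_nhds ht)), ?_⟩
    have hsub : κ '' ((extChartAt 𝓘(ℝ, E) x).source ∩ extChartAt 𝓘(ℝ, E) x ⁻¹' t) ⊆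
        (κ ∘ (extChartAt 𝓘(ℝ, E) x).symm) '' t := by
      rintro _ ⟨y, ⟨hy, hyt⟩, rfl⟩
      exact ⟨_, hyt, by simp only [Function.comp_apply, (extChartAt 𝓘(ℝ, E) x).left_inv hy]⟩
    calc _ ≤ dimH ((κ ∘ (extChartAt 𝓘(ℝ, E) x).symm) '' t) := dimH_mono hsub
      _ ≤ dimH t := hlip.dimH_image_le
      _ ≤ dimH (Set.univ : Set E) := dimH_mono (Set.subset_univ _)
      _ = _ := Real.dimH_univ_eq_finrank E
  choose! N hN hdim using hloc
  obtain ⟨t, htV, htc, hcov⟩ := TopologicalSpace.countable_cover_nhdsWithin hN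
  have hsub : κ '' V ⊆ ⋃ x ∈ t, κ '' N x := by
    rintro _ ⟨y, hy, rfl⟩
    obtain ⟨x, hxt, hxy⟩ := Set.mem_iUnion₂.1 (hcov hy)
    exact Set.mem_iUnion₂.2 ⟨x, hxt, y, hxy, rfl⟩
  refine (dimH_mono hsub).trans ?_
  rw [dimH_bUnion htc]
  exact iSup₂_le fun x hx ↦ hdim x (htV hx)

end Submersion

/-! ### Free actions are infinitesimally free -/

section Action

variable {E : Type*} [NormedAddCommGroup E] [NormedSpace ℝ E]
  {Q : Type*} [TopologicalSpace Q] [ChartedSpace E Q] [IsManifold 𝓘(ℝ, E) ∞ Q]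
  {EG : Type*} [NormedAddCommGroup EG] [NormedSpace ℝ EG]
  {G : Type*} [TopologicalSpace G] [ChartedSpace EG G] [Group G]
  [MulAction G Q]

variable (EG) in
theorem contMDiff_smul_left [hG : ContMDiffSMul 𝓘(ℝ, EG) 𝓘(ℝ, E) ∞ G Q] (a : G) :
    ContMDiff 𝓘(ℝ, E) 𝓘(ℝ, E) ∞ (fun x : Q ↦ a • x) :=
  hG.contMDiff_smul.comp (contMDiff_const.prodMk contMDiff_id)

theorem contMDiff_orbitMap [ContMDiffSMul 𝓘(ℝ, EG) 𝓘(ℝ, E) ∞ G Q] (q : Q) :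
    ContMDiff 𝓘(ℝ, EG) 𝓘(ℝ, E) ∞ (fun a : G ↦ a • q) :=
  (contMDiff_smul (I := 𝓘(ℝ, EG)) (I' := 𝓘(ℝ, E)) (G := G) (M := Q)).comp
    (contMDiff_id.prodMk contMDiff_const)

/-- The infinitesimal action of a free action is injective. -/
theorem injective_infinitesimal_action [CompleteSpace EG] [CompleteSpace E]
    [LieGroup 𝓘(ℝ, EG) ∞ G] [ContMDiffSMul 𝓘(ℝ, EG) 𝓘(ℝ, E) ∞ G Q]
    (hfree : ∀ (a : G) (q : Q), a • q = q → a = 1) (q : Q) :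
    Function.Injective (mfderiv 𝓘(ℝ, EG) 𝓘(ℝ, E) (fun a : G ↦ a • q) (1 : G)) := by
  rw [injective_iff_map_eq_zero]
  intro ξ hξ
  let o : G → Q := fun a ↦ a • q
  have ho : ∀ a, MDifferentiableAt 𝓘(ℝ, EG) 𝓘(ℝ, E) o a := fun a ↦
    (contMDiff_orbitMap q).mdifferentiableAt (by simp)
  -- The left-invariant extension of ξ. Equivariance of the orbit map `o` spreads To(ξ) = 0 from 1
  -- to all of G, so `o` sends the integral curve through 1 to a constant curve. Freeness makes the
  -- integral curve itself constant, hence ξ = 0.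
  let X : (g : G) → TangentSpace 𝓘(ℝ, EG) g := mulInvariantVectorField (I := 𝓘(ℝ, EG)) ξ
  have hX : ∀ g, mfderiv 𝓘(ℝ, EG) 𝓘(ℝ, E) o g (X g) = 0 := by
    intro g
    have hod : ∀ z, z = g → HasMFDerivAt 𝓘(ℝ, EG) 𝓘(ℝ, E) o z
        (show EG →L[ℝ] E from mfderiv 𝓘(ℝ, EG) 𝓘(ℝ, E) o g) := by
      rintro _ rfl
      exact (ho _).hasMFDerivAt
    have hmul : MDifferentiableAt 𝓘(ℝ, EG) 𝓘(ℝ, EG) (fun a : G ↦ g * a) 1 :=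
      (contMDiff_mul_left (I := 𝓘(ℝ, EG)) (n := ∞) (a := g)).mdifferentiableAt (by simp)
    have h1 := (hod (g * 1) (mul_one g)).comp (1 : G) hmul.hasMFDerivAt
    have h2 := (((contMDiff_smul_left EG g : ContMDiff 𝓘(ℝ, E) 𝓘(ℝ, E) ∞ (fun x : Q ↦ g • x)
      ).mdifferentiableAt (by simp) : MDifferentiableAt 𝓘(ℝ, E) 𝓘(ℝ, E) (fun x : Q ↦ g • x)
      (o 1)).hasMFDerivAt).comp (1 : G) (ho 1).hasMFDerivAt
    have heq : o ∘ (fun a : G ↦ g * a) = (fun x : Q ↦ g • x) ∘ o := by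
      funext a
      exact mul_smul g a q
    rw [heq] at h1
    have h3 := congrArg (fun L : EG →L[ℝ] E ↦ L ξ) (hasMFDerivAt_unique h1 h2)
    refine Eq.trans h3 ?_
    change mfderiv 𝓘(ℝ, E) 𝓘(ℝ, E) (fun x : Q ↦ g • x) (o 1)
      (mfderiv 𝓘(ℝ, EG) 𝓘(ℝ, E) o 1 ξ) = 0
    have : mfderiv 𝓘(ℝ, EG) 𝓘(ℝ, E) o 1 ξ = 0 := hξ
    rw [this, map_zero]
  have hsm : ContMDiff 𝓘(ℝ, EG) 𝓘(ℝ, EG).tangent 1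
      (fun g : G ↦ (⟨g, X g⟩ : TangentBundle 𝓘(ℝ, EG) G)) := by
    have : LieGroup 𝓘(ℝ, EG) (minSmoothness ℝ 3) G := by
      rw [minSmoothness_of_isRCLikeNormedField]
      infer_instance
    have h := contMDiff_mulInvariantVectorField (I := 𝓘(ℝ, EG)) (G := G) ξ
    exact h.of_le (by rw [minSmoothness_of_isRCLikeNormedField]; exact one_le_two)
  obtain ⟨γ, hγ0, hγ⟩ := exists_isMIntegralCurveAt_of_contMDiffAt_boundaryless 0
    (hsm.contMDiffAt (x := (1 : G)))
  -- That a curve with zero velocity is constant is obtained from uniqueness of integral curves of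
  -- the zero field.
  have hγq : IsMIntegralCurveAt (I := 𝓘(ℝ, E)) (fun t ↦ γ t • q) (fun _ ↦ 0) 0 := by
    filter_upwards [hγ] with t ht
    have h1 := (ho (γ t)).hasMFDerivAt.comp t ht
    refine h1.congr_mfderiv (ContinuousLinearMap.ext_ring ?_)
    change mfderiv 𝓘(ℝ, EG) 𝓘(ℝ, E) o (γ t) ((1 : ℝ) • X (γ t)) = (1 : ℝ) • (0 : E)
    rw [one_smul, hX, smul_zero]
    rfl
  have hconst : IsMIntegralCurveAt (I := 𝓘(ℝ, E)) (fun _ ↦ q) (fun _ ↦ 0) 0 := by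
    refine Filter.Eventually.of_forall fun t ↦ ?_
    refine (hasMFDerivAt_const (I := 𝓘(ℝ, ℝ)) (I' := 𝓘(ℝ, E)) q t).congr_mfderiv
      (ContinuousLinearMap.ext_ring ?_)
    change (0 : E) = (1 : ℝ) • (0 : E)
    rw [smul_zero]
  have h0 : ContMDiffAt 𝓘(ℝ, E) 𝓘(ℝ, E).tangent 1
      (fun x : Q ↦ (⟨x, 0⟩ : TangentBundle 𝓘(ℝ, E) Q)) (γ 0 • q) :=
    (Bundle.contMDiff_zeroSection ℝ (TangentSpace 𝓘(ℝ, E) : Q → Type _)).contMDiffAt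
  have hev := isMIntegralCurveAt_eventuallyEq_of_contMDiffAt_boundaryless h0 hγq hconst
    (by simp [hγ0])
  have hγ1 : γ =ᶠ[𝓝 0] fun _ ↦ (1 : G) := by
    filter_upwards [hev] with t ht
    exact hfree _ _ ht
  have h1 : HasMFDerivAt 𝓘(ℝ, ℝ) 𝓘(ℝ, EG) γ 0 (0 : ℝ →L[ℝ] EG) :=
    (hasMFDerivAt_const (1 : G) (0 : ℝ)).congr_of_eventuallyEq hγ1
  have h2 := congrArg (fun L : ℝ →L[ℝ] EG ↦ L 1) (hasMFDerivAt_unique hγ.hasMFDerivAt h1)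
  have h3 : X (γ 0) = (0 : EG) := by
    have : (1 : ℝ) • (show EG from X (γ 0)) = 0 := h2
    rwa [one_smul] at this
  have h4 : X 1 = ξ := by
    change mfderiv 𝓘(ℝ, EG) 𝓘(ℝ, EG) (fun a : G ↦ 1 * a) 1 ξ = ξ
    have h5 : HasMFDerivAt 𝓘(ℝ, EG) 𝓘(ℝ, EG) (fun a : G ↦ 1 * a) 1
        (ContinuousLinearMap.id ℝ EG) := by
      have h6 : (fun a : G ↦ 1 * a) = id := funext one_mul
      rw [h6]
      exact hasMFDerivAt_id 1
    exact congrArg (fun L : EG →L[ℝ] EG ↦ L ξ) h5.mfderiv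
  rw [hγ0] at h3
  exact h4.symm.trans h3

end Action

/-! ### Vertical space and horizontal lift -/

namespace ChaplyginSystem

section HorizontalLift

variable {E : Type*} [NormedAddCommGroup E] [NormedSpace ℝ E] [FiniteDimensional ℝ E]
  {Q : Type*} [TopologicalSpace Q] [ChartedSpace E Q] [IsManifold 𝓘(ℝ, E) ∞ Q]
  {EG : Type*} [NormedAddCommGroup EG] [NormedSpace ℝ EG]
  {G : Type*} [TopologicalSpace G] [ChartedSpace EG G] [Group G]
  {ES : Type*} [NormedAddCommGroup ES] [NormedSpace ℝ ES]
  {S : Type*} [TopologicalSpace S] [ChartedSpace ES S] [IsManifold 𝓘(ℝ, ES) ∞ S]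
  [MulAction G Q]
  (C : ChaplyginSystem E Q EG G ES S)

theorem contMDiff_prj : ContMDiff 𝓘(ℝ, E) 𝓘(ℝ, ES) ∞ C.prj := fun q ↦
  (C.submersion_prj.isSubmersionAt q).contMDiffAt

theorem hasMFDerivAt_prj (q : Q) : HasMFDerivAt 𝓘(ℝ, E) 𝓘(ℝ, ES) C.prj q (C.Tprj q) :=
  (C.contMDiff_prj.mdifferentiableAt (by simp)).hasMFDerivAt

theorem surjective_Tprj (q : Q) : Function.Surjective (C.Tprj q) :=
  (C.submersion_prj.isSubmersionAt q).surjective_mfderiv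

theorem prj_smul (a : G) (q : Q) : C.prj (a • q) = C.prj q :=
  ((C.fibre_prj q (a • q)).2 ⟨a, rfl⟩).symm

theorem contMDiff_smul (C : ChaplyginSystem E Q EG G ES S) (a : G) :
    ContMDiff 𝓘(ℝ, E) 𝓘(ℝ, E) ∞ (fun x : Q ↦ a • x) := by
  have := C.smooth_action
  exact contMDiff_smul_left EG a

theorem hasMFDerivAt_smul (C : ChaplyginSystem E Q EG G ES S) (a : G) (q : Q) :
    HasMFDerivAt 𝓘(ℝ, E) 𝓘(ℝ, E) (fun x : Q ↦ a • x) q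
      (mfderiv 𝓘(ℝ, E) 𝓘(ℝ, E) (fun x : Q ↦ a • x) q) :=
  ((C.contMDiff_smul a).mdifferentiableAt (by simp)).hasMFDerivAt

theorem Tprj_smul (a : G) (q : Q) (v : TangentSpace 𝓘(ℝ, E) q) :
    (C.Tprj (a • q) (mfderiv 𝓘(ℝ, E) 𝓘(ℝ, E) (fun x : Q ↦ a • x) q v) : ES) = C.Tprj q v := by
  have h1 := (C.hasMFDerivAt_prj (a • q)).comp q (C.hasMFDerivAt_smul a q)
  have h2 : C.prj ∘ (fun x : Q ↦ a • x) = C.prj := funext (C.prj_smul a)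
  rw [h2] at h1
  exact congrArg (fun L : E →L[ℝ] ES ↦ L v) (hasMFDerivAt_unique h1 (C.hasMFDerivAt_prj q))

section
variable [FiniteDimensional ℝ EG] [SecondCountableTopology G] [LieGroup 𝓘(ℝ, EG) ∞ G]
  [FiniteDimensional ℝ ES]

/-- The tangent space of the orbit is the vertical space. -/
theorem range_infinitesimal_action (q : Q) :
    (mfderiv 𝓘(ℝ, EG) 𝓘(ℝ, E) (fun a : G ↦ a • q) (1 : G)).toLinearMap.range =
      (C.Tprj ((1 : G) • q)).toLinearMap.ker := by
  have := C.smooth_action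
  have ho : ContMDiff 𝓘(ℝ, EG) 𝓘(ℝ, E) ∞ (fun a : G ↦ a • q) := contMDiff_orbitMap q
  have hle : (mfderiv 𝓘(ℝ, EG) 𝓘(ℝ, E) (fun a : G ↦ a • q) (1 : G)).toLinearMap.range ≤
      (C.Tprj ((1 : G) • q)).toLinearMap.ker := by
    rintro _ ⟨ξ, rfl⟩
    have h1 := (C.hasMFDerivAt_prj ((1 : G) • q)).comp (1 : G)
      (ho.mdifferentiableAt (by simp)).hasMFDerivAt
    have h2 : C.prj ∘ (fun a : G ↦ a • q) = fun _ ↦ C.prj q := funext fun a ↦ C.prj_smul a q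
    rw [h2] at h1
    exact congrArg (fun L : EG →L[ℝ] ES ↦ L ξ) (hasMFDerivAt_unique h1 (hasMFDerivAt_const _ _))
  -- The range has dimension dim G by freeness, and the kernel has dimension dim E - dim ES = dim F,
  -- where F models the fibre. It remains to see that dim F ≤ dim G.
  refine Submodule.eq_of_le_of_finrank_le hle ?_
  have hr : Module.finrank ℝ
      (mfderiv 𝓘(ℝ, EG) 𝓘(ℝ, E) (fun a : G ↦ a • q) (1 : G)).toLinearMap.range =
      Module.finrank ℝ EG :=
    LinearMap.finrank_range_of_inj (injective_infinitesimal_action C.free q)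
  have hk : Module.finrank ℝ ES + Module.finrank ℝ (C.Tprj ((1 : G) • q)).toLinearMap.ker =
      Module.finrank ℝ E := by
    have h1 := (C.Tprj ((1 : G) • q)).toLinearMap.finrank_range_add_finrank_ker
    rw [LinearMap.range_eq_top.2 (C.surjective_Tprj ((1 : G) • q)), finrank_top] at h1
    exact h1
  obtain ⟨F, _, _, e, U, κ, hU, hqU, hκ, hnhds⟩ :=
    (C.submersion_prj.isSubmersionAt q).exists_fibre_coordinate
  have hfin : FiniteDimensional ℝ (ES × F) := e.toLinearEquiv.finiteDimensional
  have hF : FiniteDimensional ℝ F :=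
    FiniteDimensional.of_surjective (LinearMap.snd ℝ ES F) LinearMap.snd_surjective
  have hdim : Module.finrank ℝ E = Module.finrank ℝ ES + Module.finrank ℝ F := by
    rw [e.toLinearEquiv.finrank_eq, Module.finrank_prod]
  -- The fibre is an orbit, so its F-coordinates form the image of an open subset of G under a
  -- smooth map, with Hausdorff dimension at most dim G. This image is also a neighbourhood in F, so
  -- its dimension is dim F.
  have himg : κ '' (U ∩ C.prj ⁻¹' {C.prj q}) =
      (κ ∘ fun a : G ↦ a • q) '' ((fun a : G ↦ a • q) ⁻¹' U) := by
    ext w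
    constructor
    · rintro ⟨x, ⟨hxU, hx⟩, rfl⟩
      obtain ⟨a, rfl⟩ := (C.fibre_prj q x).1 (Eq.symm hx)
      exact ⟨a, hxU, rfl⟩
    · rintro ⟨a, ha, rfl⟩
      exact ⟨a • q, ⟨ha, C.prj_smul a q⟩, rfl⟩
  have h1 : dimH (κ '' (U ∩ C.prj ⁻¹' {C.prj q})) = Module.finrank ℝ F :=
    Real.dimH_of_mem_nhds hnhds
  have h2 : dimH (κ '' (U ∩ C.prj ⁻¹' {C.prj q})) ≤ Module.finrank ℝ EG := by
    rw [himg]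
    exact dimH_image_le_finrank (hU.preimage ho.continuous)
      (hκ.comp ho.contMDiffOn (fun _ h ↦ h))
  rw [h1] at h2
  have h3 : Module.finrank ℝ F ≤ Module.finrank ℝ EG := by exact_mod_cast h2
  omega

theorem isCompl_D_ker (q : Q) : IsCompl (C.D q) (C.Tprj q).toLinearMap.ker := by
  -- The hypothesis `splitting` lives at `1 • q`, which equals q only propositionally.
  have h : ∀ z, z = q → IsCompl (C.D z) (C.Tprj z).toLinearMap.ker →
      IsCompl (C.D q) (C.Tprj q).toLinearMap.ker := by
    rintro _ rfl h
    exact h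
  have h1 := C.splitting q
  rw [C.range_infinitesimal_action q] at h1
  exact h _ (one_smul G q) h1

theorem isInvertible_Tprj_D (q : Q) : ((C.Tprj q).comp (C.D q).subtypeL).IsInvertible := by
  have hinj : Function.Injective ((C.Tprj q).comp (C.D q).subtypeL) := by
    rw [injective_iff_map_eq_zero]
    intro u hu
    have := Submodule.disjoint_def.1 (C.isCompl_D_ker q).disjoint u u.2 hu
    exact Subtype.ext this
  have hsurj : Function.Surjective ((C.Tprj q).comp (C.D q).subtypeL) := by
    intro y
    obtain ⟨v, rfl⟩ := C.surjective_Tprj q y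
    have hv : v ∈ C.D q ⊔ (C.Tprj q).toLinearMap.ker := by
      rw [(C.isCompl_D_ker q).sup_eq_top]
      trivial
    obtain ⟨u, hu, w, hw, rfl⟩ := Submodule.mem_sup.1 hv
    refine ⟨⟨u, hu⟩, ?_⟩
    have hw0 : C.Tprj q w = 0 := hw
    simp [hw0]
  exact ⟨(LinearEquiv.ofBijective ((C.Tprj q).comp (C.D q).subtypeL).toLinearMap
    ⟨hinj, hsurj⟩).toContinuousLinearEquiv, by ext; rfl⟩

theorem Tprj_hor (q : Q) (y : TangentSpace 𝓘(ℝ, ES) (C.prj q)) :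
    C.Tprj q (C.hor q y : TangentSpace 𝓘(ℝ, E) q) = y :=
  (C.isInvertible_Tprj_D q).self_apply_inverse y

theorem hor_Tprj (q : Q) (u : C.D q) : C.hor q (C.Tprj q u) = u :=
  (C.isInvertible_Tprj_D q).inverse_apply_self u

theorem hor_eq (q : Q) (y : TangentSpace 𝓘(ℝ, ES) (C.prj q)) (u : TangentSpace 𝓘(ℝ, E) q)
    (hu : u ∈ C.D q) (h : C.Tprj q u = y) : (C.hor q y : TangentSpace 𝓘(ℝ, E) q) = u := by
  rw [← h]
  exact congrArg Subtype.val (C.hor_Tprj q ⟨u, hu⟩)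

end

end HorizontalLift

end ChaplyginSystem

/-! ### Coordinates of tangent vectors, extension to global fields and functions -/

section TangentCoordinates

variable {E : Type*} [NormedAddCommGroup E] [NormedSpace ℝ E]
  {M : Type*} [TopologicalSpace M] [ChartedSpace E M] [IsManifold 𝓘(ℝ, E) ∞ M]

/-- The coordinates of tangent vectors at `x` in the preferred chart at `x₀`. -/
def toCoord (x₀ x : M) : TangentSpace 𝓘(ℝ, E) x →L[ℝ] E :=
  (trivializationAt E (TangentSpace 𝓘(ℝ, E)) x₀).continuousLinearMapAt ℝ x

/-- The tangent vector at `x` with given coordinates in the preferred chart at `x₀`. -/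
def ofCoord (x₀ x : M) : E →L[ℝ] TangentSpace 𝓘(ℝ, E) x :=
  (trivializationAt E (TangentSpace 𝓘(ℝ, E)) x₀).symmL ℝ x

theorem toCoord_ofCoord {x₀ x : M} (hx : x ∈ (chartAt E x₀).source) (v : E) :
    toCoord x₀ x (ofCoord x₀ x v) = v :=
  (trivializationAt E (TangentSpace 𝓘(ℝ, E)) x₀).continuousLinearMapAt_symmL (R := ℝ) hx v

theorem ofCoord_toCoord {x₀ x : M} (hx : x ∈ (chartAt E x₀).source)
    (v : TangentSpace 𝓘(ℝ, E) x) : ofCoord x₀ x (toCoord x₀ x v) = v :=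
  (trivializationAt E (TangentSpace 𝓘(ℝ, E)) x₀).symmL_continuousLinearMapAt (R := ℝ) hx v

theorem trivializationAt_snd {x₀ x : M} (hx : x ∈ (chartAt E x₀).source)
    (v : TangentSpace 𝓘(ℝ, E) x) :
    (trivializationAt E (TangentSpace 𝓘(ℝ, E)) x₀ ⟨x, v⟩).2 = toCoord x₀ x v :=
  ((trivializationAt E (TangentSpace 𝓘(ℝ, E)) x₀).coe_linearMapAt_of_mem (R := ℝ)
      (b := x) hx ▸ rfl)

theorem toCoord_eq_mfderiv {x₀ x : M} (hx : x ∈ (chartAt E x₀).source) :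
    toCoord x₀ x = show E →L[ℝ] E from mfderiv 𝓘(ℝ, E) 𝓘(ℝ, E) (extChartAt 𝓘(ℝ, E) x₀) x :=
  TangentBundle.continuousLinearMapAt_trivializationAt hx

theorem ofCoord_eq_mfderivWithin {x₀ x : M} (hx : x ∈ (chartAt E x₀).source) :
    (show E →L[ℝ] E from ofCoord (E := E) x₀ x) = show E →L[ℝ] E from
      mfderivWithin 𝓘(ℝ, E) 𝓘(ℝ, E) (extChartAt 𝓘(ℝ, E) x₀).symm
      (Set.range 𝓘(ℝ, E)) (extChartAt 𝓘(ℝ, E) x₀ x) :=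
  TangentBundle.symmL_trivializationAt hx

theorem toCoord_self (x : M) (v : TangentSpace 𝓘(ℝ, E) x) : toCoord x x v = v := by
  rw [toCoord_eq_mfderiv (mem_chart_source E x), mfderiv_extChartAt_self]
  rfl

theorem ofCoord_self (x : M) (v : E) : ofCoord x x v = v := by
  have := toCoord_ofCoord (mem_chart_source E x) v
  rwa [toCoord_self] at this

/-- A vector field along a map is smooth if its coordinates in a chart are. -/
theorem contMDiffAt_along_iff {E' : Type*} [NormedAddCommGroup E'] [NormedSpace ℝ E']
    {H' : Type*} [TopologicalSpace H'] {I' : ModelWithCorners ℝ E' H'}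
    {N : Type*} [TopologicalSpace N] [ChartedSpace H' N] {f : N → M} {z : N}
    (hf : ContMDiffAt I' 𝓘(ℝ, E) ∞ f z) {x₀ : M} (hx : f z ∈ (chartAt E x₀).source)
    (X : (n : N) → TangentSpace 𝓘(ℝ, E) (f n)) :
    ContMDiffAt I' 𝓘(ℝ, E).tangent ∞ (fun n ↦ (⟨f n, X n⟩ : TangentBundle 𝓘(ℝ, E) M)) z ↔
      ContMDiffAt I' 𝓘(ℝ, E) ∞ (fun n ↦ toCoord x₀ (f n) (X n)) z := by
  have he : (⟨f z, X z⟩ : TangentBundle 𝓘(ℝ, E) M) ∈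
      (trivializationAt E (TangentSpace 𝓘(ℝ, E)) x₀).source :=
    (trivializationAt E (TangentSpace 𝓘(ℝ, E)) x₀).mem_source.2 hx
  rw [(trivializationAt E (TangentSpace 𝓘(ℝ, E)) x₀).contMDiffAt_iff
    (f := fun n ↦ (⟨f n, X n⟩ : TangentBundle 𝓘(ℝ, E) M)) he]
  have h : (fun n ↦ (trivializationAt E (TangentSpace 𝓘(ℝ, E)) x₀ ⟨f n, X n⟩).2) =ᶠ[𝓝 z]
      fun n ↦ toCoord x₀ (f n) (X n) := by
    filter_upwards [hf.continuousAt.preimage_mem_nhds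
      ((chartAt E x₀).open_source.mem_nhds hx)] with n hn
    exact trivializationAt_snd hn _
  constructor
  · intro h1
    exact h1.2.congr_of_eventuallyEq h.symm
  · intro h1
    exact ⟨hf, h1.congr_of_eventuallyEq h⟩

theorem contMDiffAt_field_iff {X : (x : M) → TangentSpace 𝓘(ℝ, E) x} {x : M} :
    ContMDiffAt 𝓘(ℝ, E) 𝓘(ℝ, E).tangent ∞ (fun x ↦ (⟨x, X x⟩ : TangentBundle 𝓘(ℝ, E) M)) x ↔
      ContMDiffAt 𝓘(ℝ, E) 𝓘(ℝ, E) ∞ (fun y ↦ toCoord x y (X y)) x :=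
  contMDiffAt_along_iff contMDiffAt_id (mem_chart_source E x) X

theorem contMDiffAt_ofCoord (x : M) (v : E) :
    ContMDiffAt 𝓘(ℝ, E) 𝓘(ℝ, E).tangent ∞
      (fun y ↦ (⟨y, ofCoord x y v⟩ : TangentBundle 𝓘(ℝ, E) M)) x := by
  refine contMDiffAt_field_iff.2 ((contMDiffAt_const (c := v)).congr_of_eventuallyEq ?_)
  filter_upwards [chart_source_mem_nhds E x] with y hy
  exact toCoord_ofCoord hy v

theorem contMDiffAt_mfderiv_coord {E' : Type*} [NormedAddCommGroup E'] [NormedSpace ℝ E']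
    {M' : Type*} [TopologicalSpace M'] [ChartedSpace E' M'] [IsManifold 𝓘(ℝ, E') ∞ M']
    {f : M → M'} {x : M} (hf : ContMDiffAt 𝓘(ℝ, E) 𝓘(ℝ, E') ∞ f x) :
    ContMDiffAt 𝓘(ℝ, E) 𝓘(ℝ, E →L[ℝ] E') ∞ (fun y ↦ (toCoord (f x) (f y)).comp
      ((mfderiv 𝓘(ℝ, E) 𝓘(ℝ, E') f y).comp (ofCoord x y))) x :=
  hf.mfderiv_const (m := ∞) (by simp)

theorem covector_coord (α₀ α : CotangentBundle E M) :
    (extChartAt (cotModel E) α₀ α).2 = (covector α).comp (ofCoord α₀.proj α.proj) :=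
  cotangent_extChartAt_snd α₀ α

variable [FiniteDimensional ℝ E] [T2Space M]

/-- Tangent vectors extend to smooth vector fields that are locally constant in a chart. -/
theorem exists_field {x₀ x : M} (hx : x ∈ (chartAt E x₀).source) (v : E) :
    ∃ X : (x : M) → TangentSpace 𝓘(ℝ, E) x,
      IsSmoothField X ∧ ∀ᶠ y in 𝓝 x, X y = ofCoord x₀ y v := by
  obtain ⟨f, -, hf⟩ := (SmoothBumpFunction.nhds_basis_tsupport (I := 𝓘(ℝ, E)) x).mem_iff.1
    ((chartAt E x₀).open_source.mem_nhds hx)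
  refine ⟨fun y ↦ f y • ofCoord x₀ y v, ?_, ?_⟩
  · intro y
    by_cases hy : y ∈ (chartAt E x₀).source
    · refine ContMDiffAt.smul_section f.contMDiffAt ?_
      refine (contMDiffAt_along_iff contMDiffAt_id hy _).2 ?_
      refine (contMDiffAt_const (c := v)).congr_of_eventuallyEq ?_
      filter_upwards [(chartAt E x₀).open_source.mem_nhds hy] with z hz
      exact toCoord_ofCoord hz v
    · have h0 : ∀ᶠ z in 𝓝 y, f z = 0 :=
        notMem_tsupport_iff_eventuallyEq.1 fun h ↦ hy (hf h)
      have h1 : ContMDiffAt 𝓘(ℝ, E) 𝓘(ℝ, E).tangent ∞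
          (fun x : M ↦ (⟨x, 0⟩ : TangentBundle 𝓘(ℝ, E) M)) y :=
        (Bundle.contMDiff_zeroSection ℝ (TangentSpace 𝓘(ℝ, E) : M → Type _)).contMDiffAt
      refine h1.congr_of_eventuallyEq ?_
      filter_upwards [h0] with z hz
      rw [hz]
      exact congrArg (Bundle.TotalSpace.mk z) (zero_smul ℝ _)
  · filter_upwards [f.eventuallyEq_one] with y hy
    rw [hy]
    exact one_smul _ _

/-- Every linear form on a tangent space of `T*M` is the differential of a smooth function. -/
theorem exists_isSmoothFun_mvfderiv (α : CotangentBundle E M) (ℓ : E × (E →L[ℝ] ℝ) →L[ℝ] ℝ) :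
    ∃ F : CotangentBundle E M → ℝ, IsSmoothFun F ∧
      ∀ X : TangentSpace (cotModel E) α, mvfderiv (cotModel E) F α X = ℓ X := by
  obtain ⟨f⟩ : Nonempty (SmoothBumpFunction 𝓘(ℝ, E) α.proj) := inferInstance
  have hℓ : ∀ a ∈ (extChartAt (cotModel E) α).source, ContMDiffAt (cotModel E) 𝓘(ℝ, ℝ) ∞
      (fun a ↦ ℓ (extChartAt (cotModel E) α a)) a := fun a ha ↦
    ℓ.contMDiff.contMDiffAt.comp a (contMDiffAt_extChartAt' (by rwa [extChartAt_source] at ha))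
  refine ⟨fun a ↦ f a.proj * ℓ (extChartAt (cotModel E) α a), fun a ↦ ?_, fun X ↦ ?_⟩
  · by_cases ha : a ∈ (extChartAt (cotModel E) α).source
    · exact (f.contMDiffAt.comp a (Bundle.contMDiff_proj _).contMDiffAt).mul (hℓ a ha)
    · have h0 : ∀ᶠ z in 𝓝 a.proj, f z = 0 := by
        refine notMem_tsupport_iff_eventuallyEq.1 fun h ↦ ha ?_
        rw [cotangent_mem_source_iff, extChartAt_source]
        exact f.tsupport_subset_chartAt_source h
      refine (contMDiffAt_const (c := (0 : ℝ))).congr_of_eventuallyEq ?_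
      have hc : ContinuousAt (fun a : CotangentBundle E M ↦ a.proj) a :=
        (Bundle.contMDiff_proj (IB := 𝓘(ℝ, E)) (n := 1) _).continuous.continuousAt
      filter_upwards [hc.eventually h0] with z hz
      rw [hz, zero_mul]
  · have hc : ContinuousAt (fun a : CotangentBundle E M ↦ a.proj) α :=
      (Bundle.contMDiff_proj (IB := 𝓘(ℝ, E)) (n := 1) _).continuous.continuousAt
    have h1 : (fun a ↦ f a.proj * ℓ (extChartAt (cotModel E) α a)) =ᶠ[𝓝 α]
        fun a ↦ ℓ (extChartAt (cotModel E) α a) := by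
      filter_upwards [hc.eventually f.eventuallyEq_one] with z hz
      simp only [hz, Pi.one_apply, one_mul]
    have h2 : HasMFDerivAt (cotModel E) 𝓘(ℝ, ℝ) (fun a ↦ ℓ (extChartAt (cotModel E) α a)) α ℓ := by
      have h3 := ℓ.hasMFDerivAt.comp α
        ((mdifferentiableAt_extChartAt (I := cotModel E) (mem_chart_source _ α)).hasMFDerivAt)
      rw [mfderiv_extChartAt_self] at h3
      exact h3
    have h3 := (h2.congr_of_eventuallyEq h1).mfderiv
    exact congrArg (fun L : E × (E →L[ℝ] ℝ) →L[ℝ] ℝ ↦ L X) h3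

theorem eq_of_forall_mvfderiv_eq {α : CotangentBundle E M} {X X' : TangentSpace (cotModel E) α}
    (h : ∀ F : CotangentBundle E M → ℝ, IsSmoothFun F →
      mvfderiv (cotModel E) F α X = mvfderiv (cotModel E) F α X') : X = X' := by
  refine (SeparatingDual.eq_iff_forall_dual_eq (R := ℝ) (V := E × (E →L[ℝ] ℝ))).2 fun ℓ ↦ ?_
  obtain ⟨F, hF, hd⟩ := exists_isSmoothFun_mvfderiv α ℓ
  exact (hd X).symm.trans ((h F hF).trans (hd X'))

end TangentCoordinates

/-! ### The Lie bracket in coordinates -/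

section Bracket

variable {E : Type*} [NormedAddCommGroup E] [NormedSpace ℝ E]
  {M : Type*} [TopologicalSpace M] [ChartedSpace E M] [IsManifold 𝓘(ℝ, E) ∞ M]

/-- The Lie bracket in terms of the coordinates of the vector fields. -/
theorem mlieBracket_coord {V W : (x : M) → TangentSpace 𝓘(ℝ, E) x} {x : M}
    (hV : MDifferentiableAt 𝓘(ℝ, E) 𝓘(ℝ, E) (fun y ↦ toCoord x y (V y)) x)
    (hW : MDifferentiableAt 𝓘(ℝ, E) 𝓘(ℝ, E) (fun y ↦ toCoord x y (W y)) x) :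
    (VectorField.mlieBracket 𝓘(ℝ, E) V W x : E) =
      mvfderiv 𝓘(ℝ, E) (fun y ↦ toCoord x y (W y)) x (V x) -
        mvfderiv 𝓘(ℝ, E) (fun y ↦ toCoord x y (V y)) x (W x) := by
  have hx := mem_extChartAt_target (I := 𝓘(ℝ, E)) x
  -- Pulling a field back to the chart gives its `toCoord` coordinates. The chart has identity
  -- derivative at its centre, so values and first derivatives carry over without correction terms.
  have key : ∀ (X : (x : M) → TangentSpace 𝓘(ℝ, E) x),
      MDifferentiableAt 𝓘(ℝ, E) 𝓘(ℝ, E) (fun y ↦ toCoord x y (X y)) x →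
      VectorField.mpullbackWithin 𝓘(ℝ, E) 𝓘(ℝ, E) (extChartAt 𝓘(ℝ, E) x).symm X
        (Set.range 𝓘(ℝ, E)) (extChartAt 𝓘(ℝ, E) x x) = (show E from X x) ∧
      ∀ v : E, fderiv ℝ (show E → E from (VectorField.mpullbackWithin 𝓘(ℝ, E) 𝓘(ℝ, E)
        (extChartAt 𝓘(ℝ, E) x).symm X (Set.range 𝓘(ℝ, E)))) (extChartAt 𝓘(ℝ, E) x x) v =
      mvfderiv 𝓘(ℝ, E) (fun y ↦ toCoord x y (X y)) x v := by
    intro X hX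
    have h1 : (show E → E from (VectorField.mpullbackWithin 𝓘(ℝ, E) 𝓘(ℝ, E)
        (extChartAt 𝓘(ℝ, E) x).symm X (Set.range 𝓘(ℝ, E)))) =ᶠ[𝓝 (extChartAt 𝓘(ℝ, E) x x)]
        fun z ↦ toCoord x ((extChartAt 𝓘(ℝ, E) x).symm z) (X ((extChartAt 𝓘(ℝ, E) x).symm z)) := by
      filter_upwards [(isOpen_extChartAt_target (I := 𝓘(ℝ, E)) x).mem_nhds hx] with z hz
      have hs : (extChartAt 𝓘(ℝ, E) x).symm z ∈ (chartAt E x).source := by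
        rw [← extChartAt_source 𝓘(ℝ, E)]; exact (extChartAt 𝓘(ℝ, E) x).map_target hz
      have hinv := isInvertible_mfderivWithin_extChartAt_symm (I := 𝓘(ℝ, E)) hz
      refine (ContinuousLinearMap.IsInvertible.inverse_apply_eq hinv).2 ?_
      rw [toCoord_eq_mfderiv hs]
      exact (congrArg (fun L ↦ L (X ((extChartAt 𝓘(ℝ, E) x).symm z)))
        (mfderivWithin_extChartAt_symm_comp_mfderiv_extChartAt (I := 𝓘(ℝ, E)) hz)).symm
    refine ⟨h1.eq_of_nhds.trans ?_, fun v ↦ ?_⟩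
    · rw [extChartAt_to_inv]
      exact toCoord_self x (X x)
    · rw [h1.fderiv_eq]
      have h2 : HasMFDerivAt 𝓘(ℝ, E) 𝓘(ℝ, E) (extChartAt 𝓘(ℝ, E) x).symm
          (extChartAt 𝓘(ℝ, E) x x) (ContinuousLinearMap.id ℝ E) := by
        have h3 := mdifferentiableWithinAt_extChartAt_symm hx
        have h4 := h3.hasMFDerivWithinAt
        rw [mfderivWithin_range_extChartAt_symm, ModelWithCorners.range_eq_univ] at h4
        exact h4.hasMFDerivAt Filter.univ_mem
      have h5 : ∀ z, z = x → HasMFDerivAt 𝓘(ℝ, E) 𝓘(ℝ, E) (fun y ↦ toCoord x y (X y)) z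
          (show E →L[ℝ] E from mvfderiv 𝓘(ℝ, E) (fun y ↦ toCoord x y (X y)) x) := by
        rintro _ rfl
        exact hX.hasMFDerivAt
      have h6 := (h5 _ (extChartAt_to_inv x)).comp _ h2
      have h7 : HasFDerivAt (fun z ↦ toCoord x ((extChartAt 𝓘(ℝ, E) x).symm z)
          (X ((extChartAt 𝓘(ℝ, E) x).symm z)))
          (show E →L[ℝ] E from mvfderiv 𝓘(ℝ, E) (fun y ↦ toCoord x y (X y)) x)
          (extChartAt 𝓘(ℝ, E) x x) := hasMFDerivAt_iff_hasFDerivAt.1 h6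
      exact congrArg (fun L : E →L[ℝ] E ↦ L v) h7.fderiv
  let p : ((x : M) → TangentSpace 𝓘(ℝ, E) x) → E → E := fun X ↦
    VectorField.mpullbackWithin 𝓘(ℝ, E) 𝓘(ℝ, E) (extChartAt 𝓘(ℝ, E) x).symm X (Set.range 𝓘(ℝ, E))
  have hb : (VectorField.mlieBracket 𝓘(ℝ, E) V W x : E) =
      (show E →L[ℝ] E from mfderiv 𝓘(ℝ, E) 𝓘(ℝ, E) (extChartAt 𝓘(ℝ, E) x) x).inverse
        (VectorField.lieBracketWithin ℝ (p V) (p W)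
          ((extChartAt 𝓘(ℝ, E) x).symm ⁻¹' Set.univ ∩ Set.range 𝓘(ℝ, E))
            (extChartAt 𝓘(ℝ, E) x x)) := rfl
  have hid : (show E →L[ℝ] E from mfderiv 𝓘(ℝ, E) 𝓘(ℝ, E) (extChartAt 𝓘(ℝ, E) x) x) =
      ContinuousLinearMap.id ℝ E := mfderiv_extChartAt_self
  obtain ⟨hV1, hV2⟩ := key V hV
  obtain ⟨hW1, hW2⟩ := key W hW
  rw [hb, hid, ContinuousLinearMap.inverse_id, Set.preimage_univ, Set.univ_inter,
    ModelWithCorners.range_eq_univ, VectorField.lieBracketWithin_univ]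
  refine Eq.trans ?_ (congrArg₂ (fun a b : E ↦ a - b) (hW2 (V x)) (hV2 (W x)))
  have hV1' : p V (extChartAt 𝓘(ℝ, E) x x) = V x := hV1
  have hW1' : p W (extChartAt 𝓘(ℝ, E) x x) = W x := hW1
  simp only [VectorField.lieBracket, hV1', hW1', ContinuousLinearMap.id_apply]
  rfl

end Bracket

/-! ### The orthogonal projector and the metric -/

namespace NonholonomicSystem

variable {E : Type*} [NormedAddCommGroup E] [NormedSpace ℝ E]
  {Q : Type*} [TopologicalSpace Q] [ChartedSpace E Q] [IsManifold 𝓘(ℝ, E) ∞ Q]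
  (N : NonholonomicSystem E Q) [FiniteDimensional ℝ E]

theorem projD_of_mem (q : Q) (u : N.D q) : N.projD q u = u :=
  Submodule.projectionOnto_apply_left (N.isCompl_orth q) u

theorem sub_projD_mem_orth (q : Q) (v : TangentSpace 𝓘(ℝ, E) q) :
    v - (N.projD q v : TangentSpace 𝓘(ℝ, E) q) ∈ N.orth q := by
  have h : N.projD q (v - (N.projD q v : TangentSpace 𝓘(ℝ, E) q)) = 0 := by
    rw [map_sub, projD_of_mem, sub_self]
  exact (Submodule.projectionOnto_apply_eq_zero_iff (N.isCompl_orth q)).1 h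

theorem inner_projD (q : Q) (v : TangentSpace 𝓘(ℝ, E) q) (u : N.D q) :
    N.metric.inner q (N.projD q v : TangentSpace 𝓘(ℝ, E) q) u = N.metric.inner q v u := by
  have h := N.sub_projD_mem_orth q v u u.2
  rw [map_sub] at h
  exact (sub_eq_zero.1 h).symm

theorem inner_sharp (q : Q) (a : TangentSpace 𝓘(ℝ, E) q →L[ℝ] ℝ) (v : TangentSpace 𝓘(ℝ, E) q) :
    N.metric.inner q (N.sharp q a) v = a v := by
  have h : (N.metric.inner q).IsInvertible := by
    refine isInvertible_of_nondegenerate (E := E) _ fun u hu ↦ ?_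
    by_contra hne
    exact (N.metric.pos q u hne).ne' (hu u)
  exact congrArg (fun L : E →L[ℝ] ℝ ↦ L v) (h.self_apply_inverse a)

/-- Let u be the dual vector and w = u - 𝒫u. Then 𝒫w = 0, so ⟪u, w⟫ = β(𝒫w) = 0, while ⟪𝒫u, w⟫ = 0
by orthogonality. Hence ⟪w, w⟫ = 0. Consequently h_c involves only the metric on D. -/
theorem sharp_projDstar_mem (β : N.DualBundle) :
    N.sharp β.1 (β.2.comp (N.projD β.1)) ∈ N.D β.1 := by
  set u := N.sharp β.1 (β.2.comp (N.projD β.1)) with hu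
  have h1 := N.sub_projD_mem_orth β.1 u
  have h2 : N.metric.inner β.1 u (u - (N.projD β.1 u : TangentSpace 𝓘(ℝ, E) β.1)) = 0 := by
    rw [hu, inner_sharp]
    simp [projD_of_mem]
  have h3 := h1 _ (N.projD β.1 u).2
  have h4 : N.metric.inner β.1 (u - (N.projD β.1 u : TangentSpace 𝓘(ℝ, E) β.1))
      (u - (N.projD β.1 u : TangentSpace 𝓘(ℝ, E) β.1)) = 0 := by
    rw [map_sub, h3, N.metric.symm, h2, sub_zero]
  by_contra hne
  refine (N.metric.pos β.1 _ fun h0 ↦ hne ?_).ne' h4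
  rw [sub_eq_zero.1 h0]
  exact (N.projD β.1 u).2

theorem iDstar_projDstar (β : N.DualBundle) : N.iDstar (N.projDstar β) = β := by
  obtain ⟨q, b⟩ := β
  refine congrArg (Sigma.mk q) ?_
  ext u
  exact congrArg b (N.projD_of_mem q u)

/-- The metric in coordinates. -/
def metricCoord (q₀ q : Q) : E →L[ℝ] E →L[ℝ] ℝ :=
  (show E →L[ℝ] E →L[ℝ] ℝ from N.metric.inner q).bilinearComp (ofCoord q₀ q) (ofCoord q₀ q)

theorem contMDiffAt_metricCoord (q : Q) :
    ContMDiffAt 𝓘(ℝ, E) 𝓘(ℝ, E →L[ℝ] E →L[ℝ] ℝ) ∞ (N.metricCoord q) q := by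
  refine contMDiffAt_clm_of_apply fun a ↦ contMDiffAt_clm_of_apply fun b ↦ ?_
  have h := ContMDiffAt.clm_bundle_apply₂ (N.metric.contMDiff.contMDiffAt (x := q))
    (contMDiffAt_ofCoord q a) (contMDiffAt_ofCoord q b)
  exact (Bundle.contMDiffAt_totalSpace.1 h).2

end NonholonomicSystem

/-! ### Product rules for families of linear maps -/

section Calculus

variable {E : Type*} [NormedAddCommGroup E] [NormedSpace ℝ E]
  {H : Type*} [TopologicalSpace H] {I : ModelWithCorners ℝ E H}
  {M : Type*} [TopologicalSpace M] [ChartedSpace H M]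
  {F : Type*} [NormedAddCommGroup F] [NormedSpace ℝ F]
  {F' : Type*} [NormedAddCommGroup F'] [NormedSpace ℝ F']
  {F'' : Type*} [NormedAddCommGroup F''] [NormedSpace ℝ F'']

theorem hasMFDerivAt_clm_apply {c : M → F →L[ℝ] F'} {u : M → F} {x : M}
    {c' : E →L[ℝ] F →L[ℝ] F'} {u' : E →L[ℝ] F}
    (hc : HasMFDerivAt I 𝓘(ℝ, F →L[ℝ] F') c x c') (hu : HasMFDerivAt I 𝓘(ℝ, F) u x u') :
    HasMFDerivAt I 𝓘(ℝ, F') (fun m ↦ c m (u m)) x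
      (show E →L[ℝ] F' from (c x).comp u' + c'.flip (u x)) := by
  refine ⟨hc.1.clm_apply hu.1, ?_⟩
  have h := HasFDerivWithinAt.clm_apply hc.2 hu.2
  simp only [writtenInExtChartAt, extChartAt_model_space_eq_id, PartialEquiv.refl_coe,
    Function.comp_apply, id, extChartAt_to_inv] at h
  exact h

theorem hasMFDerivAt_clm_comp {c : M → F' →L[ℝ] F''} {d : M → F →L[ℝ] F'} {x : M}
    {c' : E →L[ℝ] F' →L[ℝ] F''} {d' : E →L[ℝ] F →L[ℝ] F'}
    (hc : HasMFDerivAt I 𝓘(ℝ, F' →L[ℝ] F'') c x c')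
    (hd : HasMFDerivAt I 𝓘(ℝ, F →L[ℝ] F') d x d') :
    HasMFDerivAt I 𝓘(ℝ, F →L[ℝ] F'') (fun m ↦ (c m).comp (d m)) x
      (show E →L[ℝ] F →L[ℝ] F'' from
        (ContinuousLinearMap.compL ℝ F F' F'' (c x)).comp d' +
          ((ContinuousLinearMap.compL ℝ F F' F'').flip (d x)).comp c') := by
  refine ⟨hc.1.clm_comp hd.1, ?_⟩
  have h := HasFDerivWithinAt.clm_comp hc.2 hd.2
  simp only [writtenInExtChartAt, extChartAt_model_space_eq_id, PartialEquiv.refl_coe,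
    Function.comp_apply, id, extChartAt_to_inv] at h
  exact h

end Calculus

/-! ### Smoothness of the horizontal lift, its brackets and the reduced metric -/

namespace ChaplyginSystem

section Smoothness

variable {E : Type*} [NormedAddCommGroup E] [NormedSpace ℝ E] [FiniteDimensional ℝ E]
  {Q : Type*} [TopologicalSpace Q] [ChartedSpace E Q] [IsManifold 𝓘(ℝ, E) ∞ Q]
  {EG : Type*} [NormedAddCommGroup EG] [NormedSpace ℝ EG] [FiniteDimensional ℝ EG]
  {G : Type*} [TopologicalSpace G] [SecondCountableTopology G]
  [ChartedSpace EG G] [Group G] [LieGroup 𝓘(ℝ, EG) ∞ G]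
  {ES : Type*} [NormedAddCommGroup ES] [NormedSpace ℝ ES] [FiniteDimensional ℝ ES]
  {S : Type*} [TopologicalSpace S] [ChartedSpace ES S] [IsManifold 𝓘(ℝ, ES) ∞ S]
  [MulAction G Q]
  (C : ChaplyginSystem E Q EG G ES S)

/-- The horizontal lift as a map to `T_q Q`. -/
def horL (q : Q) : TangentSpace 𝓘(ℝ, ES) (C.prj q) →L[ℝ] TangentSpace 𝓘(ℝ, E) q :=
  (C.D q).subtypeL.comp (C.hor q)

theorem horL_mem (q : Q) (y : TangentSpace 𝓘(ℝ, ES) (C.prj q)) : C.horL q y ∈ C.D q :=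
  (C.hor q y).2

theorem Tprj_horL (q : Q) (y : TangentSpace 𝓘(ℝ, ES) (C.prj q)) : C.Tprj q (C.horL q y) = y :=
  C.Tprj_hor q y

theorem horL_Tprj (q : Q) {u : TangentSpace 𝓘(ℝ, E) q} (hu : u ∈ C.D q) :
    C.horL q (C.Tprj q u) = u :=
  C.hor_eq q _ u hu rfl

/-- The horizontal lift in coordinates. -/
def horCoord (q₀ q : Q) : ES →L[ℝ] E :=
  (toCoord q₀ q).comp ((C.horL q).comp (ofCoord (C.prj q₀) (C.prj q)))

theorem horCoord_self (q : Q) (y : TangentSpace 𝓘(ℝ, ES) (C.prj q)) :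
    C.horCoord q q y = C.horL q y := by
  change toCoord q q (C.horL q (ofCoord (C.prj q) (C.prj q) y)) = _
  rw [toCoord_self]
  exact congrArg (C.horL q) (ofCoord_self (E := ES) (C.prj q) y)

theorem horCoord_toCoord {q₀ q : Q} (hs : C.prj q ∈ (chartAt ES (C.prj q₀)).source)
    (y : TangentSpace 𝓘(ℝ, ES) (C.prj q)) :
    C.horCoord q₀ q (toCoord (C.prj q₀) (C.prj q) y) = toCoord q₀ q (C.horL q y) := by
  change toCoord q₀ q (C.horL q (ofCoord _ _ (toCoord _ _ y))) = _
  rw [ofCoord_toCoord hs]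

theorem eventually_mem_charts (q : Q) : ∀ᶠ x in 𝓝 q, x ∈ (chartAt E q).source ∧
    C.prj x ∈ (chartAt ES (C.prj q)).source :=
  Filter.Eventually.and (chart_source_mem_nhds E q)
    (C.contMDiff_prj.continuous.continuousAt.eventually_mem (chart_source_mem_nhds ES (C.prj q)))

/-- The horizontal lift depends smoothly on the point. -/
theorem contMDiffAt_horCoord (q : Q) :
    ContMDiffAt 𝓘(ℝ, E) 𝓘(ℝ, ES →L[ℝ] E) ∞ (C.horCoord q) q := by
  obtain ⟨V, hV, hqV, X, hX, hD⟩ := C.smooth_D q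
  -- `A` parametrizes D by a local frame and `B` is Tπ in coordinates. As D is a complement of ker
  -- Tπ, the square system BA is invertible, and the lift is A (BA)⁻¹.
  let A : Q → (Fin C.rank → ℝ) →L[ℝ] E := fun x ↦
    ∑ i, (ContinuousLinearMap.proj (R := ℝ) (φ := fun _ : Fin C.rank ↦ ℝ) i).smulRight
      (toCoord q x (X i x))
  have hA_apply : ∀ x c, A x c = toCoord q x (∑ i, c i • X i x) := fun x c ↦ by
    simp [A, map_sum]
  have hA : ContMDiffAt 𝓘(ℝ, E) 𝓘(ℝ, (Fin C.rank → ℝ) →L[ℝ] E) ∞ A q := by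
    refine contMDiffAt_clm_of_apply fun c ↦ ?_
    have h1 : (fun x ↦ A x c) = fun x ↦ ∑ i, c i • toCoord q x (X i x) := by
      funext x
      simp [A]
    rw [h1]
    refine contMDiffAt_finsetSum fun i _ ↦ ?_
    exact (contMDiffAt_const (I' := 𝓘(ℝ, ℝ))).smul
      (contMDiffAt_field_iff.1 ((hX i).contMDiffAt (hV.mem_nhds hqV)))
  let B : Q → E →L[ℝ] ES := fun x ↦ (toCoord (C.prj q) (C.prj x)).comp
      ((C.Tprj x).comp (ofCoord q x))
  have hB : ContMDiffAt 𝓘(ℝ, E) 𝓘(ℝ, E →L[ℝ] ES) ∞ B q :=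
    contMDiffAt_mfderiv_coord C.contMDiff_prj.contMDiffAt
  have hBA : ContMDiffAt 𝓘(ℝ, E) 𝓘(ℝ, (Fin C.rank → ℝ) →L[ℝ] ES) ∞
      (fun x ↦ (B x).comp (A x)) q := hB.clm_comp hA
  have hmem : ∀ x ∈ V, ∀ c : Fin C.rank → ℝ, ∑ i, c i • X i x ∈ C.D x := fun x hx c ↦ by
    rw [← (hD x hx).2]
    exact Submodule.sum_mem _ fun i _ ↦ Submodule.smul_mem _ _ (Submodule.subset_span ⟨i, rfl⟩)
  have hBA_apply : ∀ x, x ∈ (chartAt E q).source → ∀ c, (B x).comp (A x) c =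
      toCoord (C.prj q) (C.prj x) (C.Tprj x (∑ i, c i • X i x)) := fun x hx c ↦ by
    change toCoord (C.prj q) (C.prj x) (C.Tprj x (ofCoord q x (A x c))) = _
    rw [hA_apply, ofCoord_toCoord hx]
  have hinv : ∀ x ∈ V, x ∈ (chartAt E q).source → C.prj x ∈ (chartAt ES (C.prj q)).source →
      ((B x).comp (A x)).IsInvertible := by
    intro x hxV hx hs
    have hinj : Function.Injective ((B x).comp (A x)) := by
      rw [injective_iff_map_eq_zero]
      intro c hc
      rw [hBA_apply x hx] at hc
      have h1 := congrArg (ofCoord (C.prj q) (C.prj x)) hc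
      rw [ofCoord_toCoord hs, map_zero] at h1
      have h2 := Submodule.disjoint_def.1 (C.isCompl_D_ker x).disjoint _ (hmem x hxV c) h1
      funext i
      exact Fintype.linearIndependent_iff.1 (hD x hxV).1 c h2 i
    have hsurj : Function.Surjective ((B x).comp (A x)) := by
      intro y
      have h1 := C.horL_mem x (ofCoord (C.prj q) (C.prj x) y)
      rw [← (hD x hxV).2] at h1
      obtain ⟨c, hc⟩ := (Submodule.mem_span_range_iff_exists_fun ℝ).1 h1
      refine ⟨c, ?_⟩
      rw [hBA_apply x hx, hc, Tprj_horL, toCoord_ofCoord hs]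
    exact ⟨(LinearEquiv.ofBijective ((B x).comp (A x)).toLinearMap
      ⟨hinj, hsurj⟩).toContinuousLinearEquiv, by ext; rfl⟩
  have hq1 := mem_chart_source E q
  have hq2 := mem_chart_source ES (C.prj q)
  have hI : ContMDiffAt 𝓘(ℝ, E) 𝓘(ℝ, ES →L[ℝ] (Fin C.rank → ℝ)) ∞
      (fun x ↦ ((B x).comp (A x)).inverse) q :=
    ContMDiffAt.comp q ((hinv q hqV hq1 hq2).contDiffAt_map_inverse (n := ∞)).contMDiffAt hBA
  refine (hA.clm_comp hI).congr_of_eventuallyEq ?_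
  filter_upwards [hV.mem_nhds hqV, C.eventually_mem_charts q] with x hxV ⟨hx, hs⟩
  ext y
  change toCoord q x (C.horL x (ofCoord (C.prj q) (C.prj x) y)) =
    A x (((B x).comp (A x)).inverse y)
  have h1 := (hinv x hxV hx hs).self_apply_inverse y
  rw [hBA_apply x hx] at h1
  rw [hA_apply, ← h1, ofCoord_toCoord hs, h1, C.horL_Tprj x (hmem x hxV _)]

/-- Horizontal lifts of smooth vector fields are smooth. -/
theorem isSmoothField_horField {Y : (s : S) → TangentSpace 𝓘(ℝ, ES) s} (hY : IsSmoothField Y) :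
    IsSmoothField (C.horField Y) := by
  intro q
  refine contMDiffAt_field_iff.2 ?_
  have h1 : ContMDiffAt 𝓘(ℝ, E) 𝓘(ℝ, ES) ∞
      (fun x ↦ toCoord (C.prj q) (C.prj x) (Y (C.prj x))) q :=
    (contMDiffAt_field_iff.1 (hY (C.prj q))).comp q C.contMDiff_prj.contMDiffAt
  refine ((C.contMDiffAt_horCoord q).clm_apply h1).congr_of_eventuallyEq ?_
  filter_upwards [C.eventually_mem_charts q] with x ⟨hx, hs⟩
  exact (C.horCoord_toCoord hs _).symm

/-- The derivative of the horizontal lift, in the preferred charts at the point. -/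
def dhor (q : Q) : TangentSpace 𝓘(ℝ, E) q →L[ℝ] (ES →L[ℝ] E) :=
  mvfderiv 𝓘(ℝ, E) (C.horCoord q) q

theorem hasMFDerivAt_horCoord (q : Q) :
    HasMFDerivAt 𝓘(ℝ, E) 𝓘(ℝ, ES →L[ℝ] E) (C.horCoord q) q (C.dhor q) :=
  ((C.contMDiffAt_horCoord q).mdifferentiableAt (by simp)).hasMFDerivAt

/-- The Lie bracket of horizontal lifts. -/
theorem mlieBracket_horField {Y Z : (s : S) → TangentSpace 𝓘(ℝ, ES) s} (hY : IsSmoothField Y)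
    (hZ : IsSmoothField Z) (q : Q) :
    (VectorField.mlieBracket 𝓘(ℝ, E) (C.horField Y) (C.horField Z) q : E) =
      C.dhor q (C.horL q (Y (C.prj q))) (Z (C.prj q)) -
        C.dhor q (C.horL q (Z (C.prj q))) (Y (C.prj q)) +
        show E from C.horL q (VectorField.mlieBracket 𝓘(ℝ, ES) Y Z (C.prj q)) := by
  have hmd : ∀ {X : (s : S) → TangentSpace 𝓘(ℝ, ES) s}, IsSmoothField X →
      MDifferentiableAt 𝓘(ℝ, ES) 𝓘(ℝ, ES) (fun s ↦ toCoord (C.prj q) s (X s)) (C.prj q) :=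
    fun hX ↦ (contMDiffAt_field_iff.1 (hX (C.prj q))).mdifferentiableAt (by simp)
  have hmd' : ∀ {X : (s : S) → TangentSpace 𝓘(ℝ, ES) s}, IsSmoothField X →
      MDifferentiableAt 𝓘(ℝ, E) 𝓘(ℝ, E) (fun x ↦ toCoord q x (C.horField X x)) q :=
    fun hX ↦ (contMDiffAt_field_iff.1
      (C.isSmoothField_horField hX q)).mdifferentiableAt (by simp)
  -- The product rule for x ↦ hor_x(X(π(x))): one term differentiates the lift, the other
  -- differentiates X along Tπ v. For horizontal v the terms of the second kind assemble into the
  -- lift of [Y, Z].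
  have hd : ∀ {X : (s : S) → TangentSpace 𝓘(ℝ, ES) s}, IsSmoothField X →
      ∀ v : E, mvfderiv 𝓘(ℝ, E) (fun x ↦ toCoord q x (C.horField X x)) q v =
        C.dhor q v (X (C.prj q)) + C.horCoord q q
          (mvfderiv 𝓘(ℝ, ES) (fun s ↦ toCoord (C.prj q) s (X s)) (C.prj q) (C.Tprj q v)) := by
    intro X hX v
    have h1 := (hmd hX).hasMFDerivAt.comp q (C.hasMFDerivAt_prj q)
    have h2 := hasMFDerivAt_clm_apply (C.hasMFDerivAt_horCoord q) h1
    have h3 : (fun x ↦ toCoord q x (C.horField X x)) =ᶠ[𝓝 q] fun x ↦ C.horCoord q x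
        (((fun s ↦ toCoord (C.prj q) s (X s)) ∘ C.prj) x) := by
      filter_upwards [C.eventually_mem_charts q] with x ⟨hx, hs⟩
      exact (C.horCoord_toCoord hs _).symm
    have h4 := (h2.congr_of_eventuallyEq h3).mfderiv
    refine (congrArg (fun L : E →L[ℝ] E ↦ L v) h4).trans ?_
    have h5 : toCoord (C.prj q) (C.prj q) (X (C.prj q)) = X (C.prj q) := toCoord_self _ _
    change C.horCoord q q _ + C.dhor q v (toCoord (C.prj q) (C.prj q) (X (C.prj q))) = _
    rw [h5, add_comm]
    rfl
  rw [mlieBracket_coord (hmd' hY) (hmd' hZ)]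
  have e1 := hd hZ (C.horL q (Y (C.prj q)))
  have e2 := hd hY (C.horL q (Z (C.prj q)))
  have e3 := congrArg (C.horCoord q q) (mlieBracket_coord (hmd hY) (hmd hZ))
  have e4 := C.horCoord_self q (VectorField.mlieBracket 𝓘(ℝ, ES) Y Z (C.prj q))
  rw [Tprj_horL] at e1 e2
  rw [map_sub] at e3
  refine (congrArg₂ (fun a b : E ↦ a - b) e1 e2).trans ?_
  refine Eq.trans ?_ (congrArg (fun a : E ↦ _ + a) (e3.symm.trans e4))
  exact add_sub_add_comm _ _ _ _

/-- The kinetic energy metric on horizontal vectors. -/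
def redMetric (q : Q) : ES →L[ℝ] ES →L[ℝ] ℝ :=
  (show E →L[ℝ] E →L[ℝ] ℝ from C.metric.inner q).bilinearComp (C.horL q) (C.horL q)

theorem redMetric_apply (q : Q) (y z : TangentSpace 𝓘(ℝ, ES) (C.prj q)) :
    C.redMetric q y z = C.metric.inner q (C.horL q y) (C.horL q z) := rfl

/-- The projection `Tπ ∘ 𝒫`. -/
def TprjProj (q : Q) : TangentSpace 𝓘(ℝ, E) q →L[ℝ] TangentSpace 𝓘(ℝ, ES) (C.prj q) :=
  (C.Tprj q).comp ((C.D q).subtypeL.comp (C.projD q))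

theorem TprjProj_apply (q : Q) (v : TangentSpace 𝓘(ℝ, E) q) :
    C.TprjProj q v = C.Tprj q (C.projD q v : TangentSpace 𝓘(ℝ, E) q) := rfl

theorem horL_TprjProj (q : Q) (v : TangentSpace 𝓘(ℝ, E) q) :
    C.horL q (C.TprjProj q v) = (C.projD q v : TangentSpace 𝓘(ℝ, E) q) :=
  C.horL_Tprj q (C.projD q v).2

theorem TprjProj_horL (q : Q) (y : TangentSpace 𝓘(ℝ, ES) (C.prj q)) :
    C.TprjProj q (C.horL q y) = y := by
  have h : C.projD q (C.horL q y) = C.hor q y := C.projD_of_mem q (C.hor q y)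
  rw [TprjProj_apply, h]
  exact C.Tprj_hor q y

/-- As 𝒫 is orthogonal, it can be dropped when pairing with a horizontal vector. This characterizes
Tπ ∘ 𝒫 by the metric and hor alone, which yields both its smoothness and its invariance. -/
theorem redMetric_TprjProj (q : Q) (v : TangentSpace 𝓘(ℝ, E) q)
    (z : TangentSpace 𝓘(ℝ, ES) (C.prj q)) :
    C.redMetric q (C.TprjProj q v) z = C.metric.inner q v (C.horL q z) := by
  refine (C.redMetric_apply q _ z).trans ?_
  rw [horL_TprjProj]
  exact C.inner_projD q v ⟨_, C.horL_mem q z⟩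

theorem redMetric_eq_zero {q : Q} {y : TangentSpace 𝓘(ℝ, ES) (C.prj q)}
    (h : C.redMetric q y y = 0) : y = 0 := by
  by_contra hne
  refine (C.metric.pos q (C.horL q y) fun h0 ↦ hne ?_).ne' h
  rw [← C.Tprj_horL q y, h0, map_zero]

theorem isInvertible_redMetric (q : Q) : (C.redMetric q).IsInvertible :=
  isInvertible_of_nondegenerate _ fun y hy ↦ C.redMetric_eq_zero (hy y)

/-- The constrained Hamiltonian in terms of the metric on horizontal vectors. -/
theorem constrainedHamiltonian_eq (β : C.DualBundle) :
    C.constrainedHamiltonian β = (1 / 2 : ℝ) *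
      (show ES →L[ℝ] ℝ from β.2.comp (C.hor β.1))
        ((C.redMetric β.1).inverse (β.2.comp (C.hor β.1))) + C.U β.1 := by
  obtain ⟨q, b⟩ := β
  set u := C.sharp q (b.comp (C.projD q)) with hu
  have huD : u ∈ C.D q := C.sharp_projDstar_mem ⟨q, b⟩
  -- Since u lies in D it is the lift of Tπ u, so Tπ u is dual to b ∘ hor in the reduced metric.
  have h1 : (C.redMetric q).inverse (show ES →L[ℝ] ℝ from b.comp (C.hor q)) = C.Tprj q u := by
    refine ((C.isInvertible_redMetric q).inverse_apply_eq).2 ?_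
    ext z
    have h2 : C.redMetric q (C.Tprj q u) z = C.metric.inner q u (C.horL q z) :=
      (C.redMetric_apply q _ z).trans (by rw [C.horL_Tprj q huD])
    rw [h2, hu, C.inner_sharp]
    exact (congrArg b (C.projD_of_mem q (C.hor q z))).symm
  have h3 : b (C.projD q u) = b (C.hor q (C.Tprj q u)) := by
    congr 1
    refine (C.projD_of_mem q ⟨u, huD⟩).trans (C.hor_Tprj q ⟨u, huD⟩).symm
  change (1 / 2 : ℝ) * b (C.projD q u) + C.U q = _
  rw [h3, h1]
  rfl

/-- The metric on horizontal vectors, in coordinates. -/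
def redMetricCoord (q₀ q : Q) : ES →L[ℝ] ES →L[ℝ] ℝ :=
  (C.redMetric q).bilinearComp (ofCoord (C.prj q₀) (C.prj q)) (ofCoord (C.prj q₀) (C.prj q))

theorem metricCoord_horCoord {q₀ q : Q} (hq : q ∈ (chartAt E q₀).source) (e : E) (z : ES) :
    C.metricCoord q₀ q e (C.horCoord q₀ q z) =
      C.metric.inner q (ofCoord q₀ q e) (C.horL q (ofCoord (C.prj q₀) (C.prj q) z)) := by
  change C.metric.inner q _ (ofCoord q₀ q (toCoord q₀ q _)) = _
  rw [ofCoord_toCoord hq]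
  rfl

theorem contMDiffAt_redMetricCoord (q : Q) :
    ContMDiffAt 𝓘(ℝ, E) 𝓘(ℝ, ES →L[ℝ] ES →L[ℝ] ℝ) ∞ (C.redMetricCoord q) q := by
  refine contMDiffAt_clm_of_apply fun y ↦ contMDiffAt_clm_of_apply fun z ↦ ?_
  have h : ∀ w : ES, ContMDiffAt 𝓘(ℝ, E) 𝓘(ℝ, E) ∞ (fun x ↦ C.horCoord q x w) q := fun w ↦
    (C.contMDiffAt_horCoord q).clm_apply contMDiffAt_const
  refine (((C.contMDiffAt_metricCoord q).clm_apply (h y)).clm_apply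
    (h z)).congr_of_eventuallyEq ?_
  filter_upwards [C.eventually_mem_charts q] with x ⟨hx, hs⟩
  rw [C.metricCoord_horCoord hx]
  change C.metric.inner x _ _ = C.metric.inner x (ofCoord q x (toCoord q x _)) _
  rw [ofCoord_toCoord hx]
  rfl

theorem isInvertible_redMetricCoord {q₀ q : Q} (hs : C.prj q ∈ (chartAt ES (C.prj q₀)).source) :
    (C.redMetricCoord q₀ q).IsInvertible := by
  refine isInvertible_of_nondegenerate _ fun y hy ↦ ?_
  have h : ofCoord (C.prj q₀) (C.prj q) y = 0 := C.redMetric_eq_zero (hy y)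
  rw [← toCoord_ofCoord hs y, h, map_zero]

theorem contMDiffAt_inverse_redMetricCoord (q : Q) :
    ContMDiffAt 𝓘(ℝ, E) 𝓘(ℝ, (ES →L[ℝ] ℝ) →L[ℝ] ES) ∞
      (fun x ↦ (C.redMetricCoord q x).inverse) q :=
  ContMDiffAt.comp q ((C.isInvertible_redMetricCoord
    (mem_chart_source ES (C.prj q))).contDiffAt_map_inverse (n := ∞)).contMDiffAt
    (C.contMDiffAt_redMetricCoord q)

/-- `Tπ ∘ 𝒫` depends smoothly on the point. -/
theorem contMDiffAt_TprjProj (q : Q) :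
    ContMDiffAt 𝓘(ℝ, E) 𝓘(ℝ, E →L[ℝ] ES) ∞
      (fun x ↦ (toCoord (C.prj q) (C.prj x)).comp ((C.TprjProj x).comp (ofCoord q x))) q := by
  refine contMDiffAt_clm_of_apply fun e ↦ ?_
  have h := (C.contMDiffAt_inverse_redMetricCoord q).clm_apply
    (((C.contMDiffAt_metricCoord q).clm_apply (contMDiffAt_const (c := e))).clm_comp
      (C.contMDiffAt_horCoord q))
  refine h.congr_of_eventuallyEq ?_
  filter_upwards [C.eventually_mem_charts q] with x ⟨hx, hs⟩
  refine (((C.isInvertible_redMetricCoord hs).inverse_apply_eq).2 ?_).symm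
  ext z
  refine (C.metricCoord_horCoord hx e z).trans ?_
  change _ = C.redMetric x (ofCoord _ _ (toCoord _ _ (C.TprjProj x (ofCoord q x e))))
    (ofCoord _ _ z)
  rw [ofCoord_toCoord hs]
  exact (C.redMetric_TprjProj x _ _).symm

end Smoothness

end ChaplyginSystem

/-! ### Smooth maps into cotangent bundles -/

section Covectors

variable {E : Type*} [NormedAddCommGroup E] [NormedSpace ℝ E]
  {M : Type*} [TopologicalSpace M] [ChartedSpace E M] [IsManifold 𝓘(ℝ, E) ∞ M]

theorem mkCovector_congr {x x' : M} (h : x = x') {a : TangentSpace 𝓘(ℝ, E) x →L[ℝ] ℝ}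
    {a' : TangentSpace 𝓘(ℝ, E) x' →L[ℝ] ℝ}
    (ha : (show E →L[ℝ] ℝ from a) = (show E →L[ℝ] ℝ from a')) :
    mkCovector x a = mkCovector x' a' := by
  subst h
  exact congrArg (mkCovector x) ha

theorem covector_congr {γ γ' : CotangentBundle E M} (h : γ = γ') :
    (show E →L[ℝ] ℝ from covector γ) = (show E →L[ℝ] ℝ from covector γ') := by
  subst h
  rfl

/-- A map to the cotangent bundle is smooth if its base point and its coordinates are. -/
theorem contMDiffAt_cotangent {E' : Type*} [NormedAddCommGroup E'] [NormedSpace ℝ E']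
    {H' : Type*} [TopologicalSpace H'] {I' : ModelWithCorners ℝ E' H'}
    {N : Type*} [TopologicalSpace N] [ChartedSpace H' N] {f : N → CotangentBundle E M} {z : N}
    (h1 : ContMDiffAt I' 𝓘(ℝ, E) ∞ (fun n ↦ (f n).proj) z)
    (h2 : ContMDiffAt I' 𝓘(ℝ, E →L[ℝ] ℝ) ∞
      (fun n ↦ (covector (f n)).comp (ofCoord (f z).proj (f n).proj)) z) :
    ContMDiffAt I' (cotModel E) ∞ f z :=
  Bundle.contMDiffAt_totalSpace.2 ⟨h1, h2.congr_of_eventuallyEq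
    (Filter.Eventually.of_forall fun _ ↦ cotangent_trivializationAt_snd _ _)⟩

theorem contMDiffAt_covector_coord (α : CotangentBundle E M) :
    ContMDiffAt (cotModel E) 𝓘(ℝ, E →L[ℝ] ℝ) ∞
      (fun a ↦ (covector a).comp (ofCoord α.proj a.proj)) α :=
  (Bundle.contMDiffAt_totalSpace.1 (contMDiffAt_id (x := α))).2.congr_of_eventuallyEq
    (Filter.Eventually.of_forall fun _ ↦ (cotangent_trivializationAt_snd _ _).symm)

theorem contMDiff_cotangent_proj :
    ContMDiff (cotModel E) 𝓘(ℝ, E) ∞ (fun a : CotangentBundle E M ↦ a.proj) :=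
  Bundle.contMDiff_proj _

end Covectors

/-! ### The reduced space T*S and the reduced Hamiltonian -/

namespace ChaplyginSystem

section Reduction

variable {E : Type*} [NormedAddCommGroup E] [NormedSpace ℝ E] [FiniteDimensional ℝ E]
  {Q : Type*} [TopologicalSpace Q] [ChartedSpace E Q] [IsManifold 𝓘(ℝ, E) ∞ Q]
  {EG : Type*} [NormedAddCommGroup EG] [NormedSpace ℝ EG] [FiniteDimensional ℝ EG]
  {G : Type*} [TopologicalSpace G] [SecondCountableTopology G]
  [ChartedSpace EG G] [Group G] [LieGroup 𝓘(ℝ, EG) ∞ G]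
  {ES : Type*} [NormedAddCommGroup ES] [NormedSpace ℝ ES] [FiniteDimensional ℝ ES]
  {S : Type*} [TopologicalSpace S] [ChartedSpace ES S] [IsManifold 𝓘(ℝ, ES) ∞ S]
  [MulAction G Q]
  (C : ChaplyginSystem E Q EG G ES S)

/-- The reduction map, pulled back to `T*Q`. -/
def cotReduction (α : CotangentBundle E Q) : CotangentBundle ES S := C.reduction (C.iDstar α)

theorem covector_cotReduction_coord {α₀ α : CotangentBundle E Q}
    (h : α.proj ∈ (chartAt E α₀.proj).source) :
    (covector (C.cotReduction α)).comp (ofCoord (C.prj α₀.proj) (C.prj α.proj)) =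
      ((covector α).comp (ofCoord α₀.proj α.proj)).comp (C.horCoord α₀.proj α.proj) := by
  ext y
  change covector α (C.horL α.proj _) = covector α (ofCoord _ _ (toCoord _ _ (C.horL α.proj _)))
  rw [ofCoord_toCoord h]
  rfl

theorem eventually_proj_mem_charts (α : CotangentBundle E Q) :
    ∀ᶠ a in 𝓝 α, a.proj ∈ (chartAt E α.proj).source ∧
      C.prj a.proj ∈ (chartAt ES (C.prj α.proj)).source :=
  (contMDiff_cotangent_proj.continuous.continuousAt (x := α)).eventually
    (C.eventually_mem_charts α.proj)

theorem contMDiffAt_horCoord_proj (α : CotangentBundle E Q) :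
    ContMDiffAt (cotModel E) 𝓘(ℝ, ES →L[ℝ] E) ∞ (fun a ↦ C.horCoord α.proj a.proj) α :=
  ContMDiffAt.comp α (C.contMDiffAt_horCoord α.proj) contMDiff_cotangent_proj.contMDiffAt

theorem contMDiff_cotReduction : ContMDiff (cotModel E) (cotModel ES) ∞ C.cotReduction := by
  intro α
  refine contMDiffAt_cotangent ?_ ?_
  · exact ContMDiffAt.comp (g := C.prj) (f := fun a : CotangentBundle E Q ↦ a.proj) α
      C.contMDiff_prj.contMDiffAt contMDiff_cotangent_proj.contMDiffAt
  · refine ((contMDiffAt_covector_coord α).clm_comp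
      (C.contMDiffAt_horCoord_proj α)).congr_of_eventuallyEq ?_
    filter_upwards [C.eventually_proj_mem_charts α] with a ha
    exact C.covector_cotReduction_coord ha.1

/-- The reduction map has smooth local sections. -/
theorem exists_section_cotReduction (γ : CotangentBundle ES S) :
    ∃ σ : CotangentBundle ES S → CotangentBundle E Q,
      ContMDiffAt (cotModel ES) (cotModel E) ∞ σ γ ∧ ∀ᶠ c in 𝓝 γ, C.cotReduction (σ c) = c := by
  obtain ⟨s, a⟩ := γ
  obtain ⟨q, rfl⟩ := C.surjective_prj s
  obtain ⟨σ, hσ, hσq, hsec⟩ := (C.submersion_prj.isSubmersionAt q).exists_local_section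
  set γ : CotangentBundle ES S := ⟨C.prj q, a⟩ with hγ
  have hpr : ContMDiffAt (cotModel ES) 𝓘(ℝ, ES) ∞ (fun c : CotangentBundle ES S ↦ c.proj) γ :=
    contMDiff_cotangent_proj.contMDiffAt
  have hσ' : ContMDiffAt (cotModel ES) 𝓘(ℝ, E) ∞ (fun c : CotangentBundle ES S ↦ σ c.proj) γ :=
    ContMDiffAt.comp γ hσ hpr
  have hsec' : ∀ᶠ c : CotangentBundle ES S in 𝓝 γ, C.prj (σ c.proj) = c.proj :=
    hpr.continuousAt.eventually hsec
  -- A covector on S is pulled back by Tπ at the point of the fibre chosen by σ. Reduction undoes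
  -- this, because Tπ ∘ hor = id.
  let τ : CotangentBundle ES S → CotangentBundle E Q := fun c ↦ mkCovector (σ c.proj)
    (show E →L[ℝ] ℝ from (show ES →L[ℝ] ℝ from covector c).comp
      (show E →L[ℝ] ES from C.Tprj (σ c.proj)))
  refine ⟨τ, ?_, ?_⟩
  · refine contMDiffAt_cotangent hσ' ?_
    have hB : ContMDiffAt (cotModel ES) 𝓘(ℝ, E →L[ℝ] ES) ∞
        (fun c : CotangentBundle ES S ↦ (toCoord (C.prj q) (C.prj (σ c.proj))).comp
          ((C.Tprj (σ c.proj)).comp (ofCoord q (σ c.proj)))) γ :=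
      ContMDiffAt.comp_of_eq (contMDiffAt_mfderiv_coord C.contMDiff_prj.contMDiffAt) hσ' hσq
    refine ((contMDiffAt_covector_coord γ).clm_comp hB).congr_of_eventuallyEq ?_
    filter_upwards [hsec', hpr.continuousAt.eventually_mem
      (chart_source_mem_nhds ES (C.prj q))] with c hc hs
    -- The base points π(σ(s)) and s agree only propositionally. Stating the identity for a free s
    -- allows substitution.
    have key : ∀ (x : Q) (s : S), C.prj x = s → s ∈ (chartAt ES (C.prj q)).source →
        ∀ b : TangentSpace 𝓘(ℝ, ES) s →L[ℝ] ℝ,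
        (show E →L[ℝ] ℝ from ((show ES →L[ℝ] ℝ from b).comp
          (show E →L[ℝ] ES from C.Tprj x)).comp (show E →L[ℝ] E from ofCoord (E := E) q x)) =
        (b.comp (ofCoord (C.prj q) s)).comp
          ((toCoord (C.prj q) (C.prj x)).comp ((C.Tprj x).comp (ofCoord q x))) := by
      rintro x _ rfl hs b
      ext e
      change b (C.Tprj x (ofCoord q x e)) =
        b (ofCoord _ _ (toCoord _ _ (C.Tprj x (ofCoord q x e))))
      rw [ofCoord_toCoord hs]
    have h := key (σ c.proj) c.proj hc hs (covector c)
    rw [← h]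
    change ContinuousLinearMap.comp _ (ofCoord (σ (C.prj q)) (σ c.proj)) = _
    rw [hσq]
    rfl
  · filter_upwards [hsec'] with c hc
    refine mkCovector_congr (x' := c.proj) (a' := covector c) hc ?_
    ext y
    exact congrArg (show ES →L[ℝ] ℝ from covector c) (C.Tprj_horL (σ c.proj) y)

/-- Φ is smooth and has smooth local sections. The converse direction, composition with such a
section, is what makes the descended Hamiltonian smooth. -/
theorem isSmoothFun_iff (F : CotangentBundle ES S → ℝ) :
    IsSmoothFun F ↔ IsSmoothFun (fun α : CotangentBundle E Q ↦ F (C.cotReduction α)) := by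
  refine ⟨fun h ↦ ContMDiff.comp h C.contMDiff_cotReduction, fun h γ ↦ ?_⟩
  obtain ⟨σ, hσ, hsec⟩ := C.exists_section_cotReduction γ
  refine (ContMDiffAt.comp γ (h (σ γ)) hσ).congr_of_eventuallyEq ?_
  filter_upwards [hsec] with c hc
  exact (congrArg F hc).symm

theorem surjective_reduction : Function.Surjective C.reduction := fun γ ↦ by
  obtain ⟨σ, -, hsec⟩ := C.exists_section_cotReduction γ
  exact ⟨_, hsec.self_of_nhds⟩

theorem mfderiv_smul_mem_D (a : G) (q : Q) {u : TangentSpace 𝓘(ℝ, E) q} (hu : u ∈ C.D q) :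
    mfderiv 𝓘(ℝ, E) 𝓘(ℝ, E) (fun x : Q ↦ a • x) q u ∈ C.D (a • q) :=
  C.invariant_D a q ▸ Submodule.mem_map_of_mem hu

/-- The action preserves D and π, and these determine hor. The descent arguments for h_c and 𝒯 rest
on this equivariance. The vector y is taken in the model space because the base points π(a • q) and
π(q) are only propositionally equal. -/
theorem horL_smul (a : G) (q : Q) (y : ES) :
    (C.horL (a • q) y : E) = mfderiv 𝓘(ℝ, E) 𝓘(ℝ, E) (fun x : Q ↦ a • x) q (C.horL q y) := by
  refine C.hor_eq (a • q) y _ (C.mfderiv_smul_mem_D a q (C.horL_mem q y)) ?_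
  exact (C.Tprj_smul a q _).trans (C.Tprj_horL q y)

theorem redMetric_smul (a : G) (q : Q) : C.redMetric (a • q) = C.redMetric q := by
  ext y z
  have h1 := C.horL_smul a q y
  have h2 := C.horL_smul a q z
  refine Eq.trans ?_ (C.isometric a q (C.horL q y) (C.horL q z))
  exact congrArg₂ (fun u v : E ↦ (show E →L[ℝ] E →L[ℝ] ℝ from C.metric.inner (a • q)) u v) h1 h2

theorem reduction_eq_iff (β β' : C.DualBundle) :
    C.reduction β = C.reduction β' ↔ C.SameOrbit β β' := by
  obtain ⟨q, b⟩ := β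
  constructor
  · intro h
    obtain ⟨q', b'⟩ := β'
    obtain ⟨a, rfl⟩ := (C.fibre_prj q q').1 (congrArg Bundle.TotalSpace.proj h)
    refine ⟨a, b', rfl, fun u ↦ ?_⟩
    have h1 := congrArg (fun L : ES →L[ℝ] ℝ ↦ L (C.Tprj q u)) (covector_congr h)
    have h2 : b (C.hor q (C.Tprj q u)) = b' (C.hor (a • q) (show ES from C.Tprj q u)) := h1
    rw [C.hor_Tprj] at h2
    rw [h2]
    refine congrArg b' (Subtype.ext ?_)
    have h3 := C.horL_smul a q (C.Tprj q u)
    rw [C.horL_Tprj q u.2] at h3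
    exact h3.symm
  · rintro ⟨a, b', rfl, hb⟩
    refine mkCovector_congr (C.prj_smul a q).symm ?_
    ext y
    refine (hb (C.hor q y)).symm.trans (congrArg b' (Subtype.ext ?_))
    exact (C.horL_smul a q y).symm

theorem cotangentIsReducedSpace : C.CotangentIsReducedSpace :=
  ⟨C.surjective_reduction, C.reduction_eq_iff, C.isSmoothFun_iff⟩

/-- By `constrainedHamiltonian_eq`, h_c depends only on b ∘ hor, the reduced metric and U. The first
agrees by hypothesis, the others are constant along orbits. -/
theorem constrainedHamiltonian_congr {β β' : C.DualBundle} (h : C.reduction β = C.reduction β') :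
    C.constrainedHamiltonian β = C.constrainedHamiltonian β' := by
  obtain ⟨q, b⟩ := β
  obtain ⟨q', b'⟩ := β'
  obtain ⟨a, rfl⟩ := (C.fibre_prj q q').1 (congrArg Bundle.TotalSpace.proj h)
  have h1 : (show ES →L[ℝ] ℝ from b.comp (C.hor q)) =
      show ES →L[ℝ] ℝ from b'.comp (C.hor (a • q)) := covector_congr h
  rw [constrainedHamiltonian_eq, constrainedHamiltonian_eq, C.redMetric_smul, C.invariant_U]
  exact congrArg (fun L : ES →L[ℝ] ℝ ↦ (1 / 2 : ℝ) * L ((C.redMetric q).inverse L) + C.U q) h1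

theorem isSmoothOnDual_constrainedHamiltonian :
    C.IsSmoothOnDual C.constrainedHamiltonian := by
  intro α
  let b : CotangentBundle E Q → ES →L[ℝ] ℝ := fun a ↦
    ((covector a).comp (ofCoord α.proj a.proj)).comp (C.horCoord α.proj a.proj)
  have hb : ContMDiffAt (cotModel E) 𝓘(ℝ, ES →L[ℝ] ℝ) ∞ b α :=
    (contMDiffAt_covector_coord α).clm_comp (C.contMDiffAt_horCoord_proj α)
  have hM : ContMDiffAt (cotModel E) 𝓘(ℝ, (ES →L[ℝ] ℝ) →L[ℝ] ES) ∞
      (fun a : CotangentBundle E Q ↦ (C.redMetricCoord α.proj a.proj).inverse) α :=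
    ContMDiffAt.comp α (C.contMDiffAt_inverse_redMetricCoord α.proj)
      contMDiff_cotangent_proj.contMDiffAt
  have hU : ContMDiffAt (cotModel E) 𝓘(ℝ, ℝ) ∞ (fun a : CotangentBundle E Q ↦ C.U a.proj) α :=
    ContMDiffAt.comp α C.smooth_U.contMDiffAt contMDiff_cotangent_proj.contMDiffAt
  have h := ((contMDiffAt_const (I' := 𝓘(ℝ, ℝ)) (c := (1 / 2 : ℝ))).mul
    (hb.clm_apply (hM.clm_apply hb))).add hU
  refine h.congr_of_eventuallyEq ?_
  filter_upwards [C.eventually_proj_mem_charts α] with a ⟨ha, hs⟩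
  have hba : b a = (covector (C.cotReduction a)).comp (ofCoord (C.prj α.proj) (C.prj a.proj)) :=
    (C.covector_cotReduction_coord ha).symm
  set c : ES →L[ℝ] ℝ := covector (C.cotReduction a) with hc
  have hm : (show ES from ofCoord (C.prj α.proj) (C.prj a.proj) (toCoord (C.prj α.proj)
      (C.prj a.proj) ((C.redMetric a.proj).inverse c))) = (C.redMetric a.proj).inverse c :=
    ofCoord_toCoord (E := ES) hs _
  have h1 : (C.redMetricCoord α.proj a.proj).inverse (b a) =
      toCoord (C.prj α.proj) (C.prj a.proj) ((C.redMetric a.proj).inverse c) := by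
    refine ((C.isInvertible_redMetricCoord hs).inverse_apply_eq).2 ?_
    rw [hba]
    ext z
    refine Eq.trans ?_ (congrArg (fun y : ES ↦ C.redMetric a.proj y
      (ofCoord (C.prj α.proj) (C.prj a.proj) z)) hm).symm
    exact congrArg (fun L : ES →L[ℝ] ℝ ↦ L (ofCoord (C.prj α.proj) (C.prj a.proj) z))
      ((C.isInvertible_redMetric a.proj).self_apply_inverse c).symm
  rw [constrainedHamiltonian_eq]
  change (1 / 2 : ℝ) * c ((C.redMetric a.proj).inverse c) + C.U a.proj =
    (1 / 2 : ℝ) * b a ((C.redMetricCoord α.proj a.proj).inverse (b a)) + C.U a.proj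
  rw [h1, hba]
  exact (congrArg (fun y : ES ↦ (1 / 2 : ℝ) * c y + C.U a.proj) hm).symm

theorem existsUnique_reducedHamiltonian :
    ∃! H : CotangentBundle ES S → ℝ, C.IsReducedHamiltonian H := by
  let H : CotangentBundle ES S → ℝ := fun γ ↦
    C.constrainedHamiltonian (Function.surjInv C.surjective_reduction γ)
  have hH : ∀ β, H (C.reduction β) = C.constrainedHamiltonian β := fun β ↦
    C.constrainedHamiltonian_congr (Function.surjInv_eq C.surjective_reduction _)
  refine ⟨H, ⟨(C.isSmoothFun_iff H).2 ?_, hH⟩, fun H' hH' ↦ ?_⟩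
  · have h1 : (fun α : CotangentBundle E Q ↦ H (C.cotReduction α)) =
        fun α ↦ C.constrainedHamiltonian (C.iDstar α) := funext fun α ↦ hH _
    rw [h1]
    exact C.isSmoothOnDual_constrainedHamiltonian
  · funext γ
    obtain ⟨β, rfl⟩ := C.surjective_reduction γ
    rw [hH, hH'.2]

theorem isReducedHamiltonian : C.IsReducedHamiltonian C.reducedHamiltonian :=
  Classical.epsilon_spec C.existsUnique_reducedHamiltonian.exists

end Reduction

end ChaplyginSystem

/-! ### The gyroscopic tensor -/

/-- The alternating map `(v, w) ↦ B v w - B w v` of a bilinear map. -/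
def alternatingOfBilin {F G : Type*} [NormedAddCommGroup F] [NormedSpace ℝ F]
    [NormedAddCommGroup G] [NormedSpace ℝ G] (B : F →L[ℝ] F →L[ℝ] G) : F [⋀^Fin 2]→L[ℝ] G :=
  { toFun := fun v ↦ B (v 0) (v 1) - B (v 1) (v 0)
    map_update_add' := by
      intro inst v i x y
      obtain rfl : inst = instDecidableEqFin 2 := Subsingleton.elim _ _
      fin_cases i <;> simp <;> abel
    map_update_smul' := by
      intro inst v i c x
      obtain rfl : inst = instDecidableEqFin 2 := Subsingleton.elim _ _
      fin_cases i <;> simp [smul_sub]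
    map_eq_zero_of_eq' := by
      intro v i j h hij
      have : v 0 = v 1 := by
        fin_cases i <;> fin_cases j <;> simp_all
      simp [this]
    cont := by
      change Continuous fun v : Fin 2 → F ↦ B (v 0) (v 1) - B (v 1) (v 0)
      fun_prop }

namespace ChaplyginSystem

section Gyroscopic

variable {E : Type*} [NormedAddCommGroup E] [NormedSpace ℝ E] [FiniteDimensional ℝ E]
  {Q : Type*} [TopologicalSpace Q] [ChartedSpace E Q] [IsManifold 𝓘(ℝ, E) ∞ Q]
  {EG : Type*} [NormedAddCommGroup EG] [NormedSpace ℝ EG] [FiniteDimensional ℝ EG]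
  {G : Type*} [TopologicalSpace G] [SecondCountableTopology G]
  [ChartedSpace EG G] [Group G] [LieGroup 𝓘(ℝ, EG) ∞ G]
  {ES : Type*} [NormedAddCommGroup ES] [NormedSpace ℝ ES] [FiniteDimensional ℝ ES]
  {S : Type*} [TopologicalSpace S] [T2Space S] [ChartedSpace ES S] [IsManifold 𝓘(ℝ, ES) ∞ S]
  [MulAction G Q]
  (C : ChaplyginSystem E Q EG G ES S)

/-- The gyroscopic tensor, computed at a point of `Q` from the derivative of the horizontal lift. -/
def gyroAt (q : Q) : ES [⋀^Fin 2]→L[ℝ] ES :=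
  alternatingOfBilin ((ContinuousLinearMap.compL ℝ ES E ES (C.TprjProj q)).comp
    ((show E →L[ℝ] ES →L[ℝ] E from C.dhor q).comp (show ES →L[ℝ] E from C.horL q)))

theorem gyroAt_apply (q : Q) (v : Fin 2 → ES) :
    C.gyroAt q v = C.TprjProj q (show E from
      C.dhor q (C.horL q (v 0)) (v 1) - C.dhor q (C.horL q (v 1)) (v 0)) := by
  refine Eq.trans ?_ (map_sub (show E →L[ℝ] ES from C.TprjProj q) _ _).symm
  rfl

/-- Tπ ∘ 𝒫 turns the summand hor [Y, Z] of `mlieBracket_horField` into [Y, Z]. What is left depends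
only on the values of Y and Z at the point, and this is the tensoriality of 𝒯. -/
theorem gyroAt_field {Y Z : (s : S) → TangentSpace 𝓘(ℝ, ES) s} (hY : IsSmoothField Y)
    (hZ : IsSmoothField Z) (q : Q) :
    C.gyroAt q ![Y (C.prj q), Z (C.prj q)] =
      C.TprjProj q (VectorField.mlieBracket 𝓘(ℝ, E) (C.horField Y) (C.horField Z) q)
        - VectorField.mlieBracket 𝓘(ℝ, ES) Y Z (C.prj q) := by
  refine (C.gyroAt_apply q _).trans (eq_sub_of_add_eq ?_)
  have h1 := C.TprjProj_horL q (VectorField.mlieBracket 𝓘(ℝ, ES) Y Z (C.prj q))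
  have h2 := congrArg (show E →L[ℝ] ES from C.TprjProj q) (C.mlieBracket_horField hY hZ q)
  refine Eq.trans ?_ (h2.trans (map_add (show E →L[ℝ] ES from C.TprjProj q) _ _)).symm
  exact congrArg (fun a : ES ↦ _ + a) h1.symm

theorem minSmoothness_two_le : minSmoothness ℝ 2 ≤ (∞ : WithTop ℕ∞) := by
  rw [minSmoothness_of_isRCLikeNormedField]
  exact ENat.LEInfty.out

theorem exists_field_eq (s : S) (y : ES) :
    ∃ Y : (s : S) → TangentSpace 𝓘(ℝ, ES) s, IsSmoothField Y ∧ Y s = y := by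
  obtain ⟨Y, hY, h⟩ := exists_field (mem_chart_source ES s) y
  exact ⟨Y, hY, h.self_of_nhds.trans (ofCoord_self s y)⟩

theorem isInvertible_mfderiv_smul (C : ChaplyginSystem E Q EG G ES S) (a : G) (q : Q) :
    (mfderiv 𝓘(ℝ, E) 𝓘(ℝ, E) (fun x : Q ↦ a • x) q).IsInvertible := by
  have h1 := (C.hasMFDerivAt_smul a⁻¹ (a • q)).comp q (C.hasMFDerivAt_smul a q)
  have h2 : (fun x : Q ↦ a⁻¹ • x) ∘ (fun x : Q ↦ a • x) = id := funext (inv_smul_smul a)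
  rw [h2] at h1
  have h3 := hasMFDerivAt_unique h1 (hasMFDerivAt_id q)
  have hinj : Function.Injective (show E →L[ℝ] E from
      mfderiv 𝓘(ℝ, E) 𝓘(ℝ, E) (fun x : Q ↦ a • x) q) := by
    refine Function.LeftInverse.injective (g := mfderiv 𝓘(ℝ, E) 𝓘(ℝ, E)
      (fun x : Q ↦ a⁻¹ • x) (a • q)) fun v ↦ ?_
    exact congrArg (fun L : E →L[ℝ] E ↦ L v) h3
  exact ⟨(LinearEquiv.ofInjectiveEndo (show E →L[ℝ] E from
      mfderiv 𝓘(ℝ, E) 𝓘(ℝ, E) (fun x : Q ↦ a • x) q).toLinearMap hinj).toContinuousLinearEquiv,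
    by ext; rfl⟩

/-- Horizontal lifts are invariant under the action, and brackets commute with pull-back. -/
theorem mlieBracket_horField_smul {Y Z : (s : S) → TangentSpace 𝓘(ℝ, ES) s}
    (hY : IsSmoothField Y) (hZ : IsSmoothField Z) (a : G) (q : Q) :
    VectorField.mlieBracket 𝓘(ℝ, E) (C.horField Y) (C.horField Z) (a • q) =
      mfderiv 𝓘(ℝ, E) 𝓘(ℝ, E) (fun x : Q ↦ a • x) q
        (VectorField.mlieBracket 𝓘(ℝ, E) (C.horField Y) (C.horField Z) q) := by
  have hp : ∀ X : (s : S) → TangentSpace 𝓘(ℝ, ES) s,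
      VectorField.mpullback 𝓘(ℝ, E) 𝓘(ℝ, E) (fun x : Q ↦ a • x) (C.horField X) =
        C.horField X := by
    intro X
    funext x
    refine ((C.isInvertible_mfderiv_smul a x).inverse_apply_eq).2 ?_
    refine Eq.trans ?_ (C.horL_smul a x (X (C.prj x)))
    have key : ∀ s, s = C.prj x → (show E from C.horL (a • x) (show ES from X s)) =
        C.horL (a • x) (show ES from X (C.prj x)) := by
      rintro _ rfl
      rfl
    exact key _ (C.prj_smul a x)
  have : IsManifold 𝓘(ℝ, E) (minSmoothness ℝ 2) Q := IsManifold.of_le minSmoothness_two_le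
  have h := VectorField.mpullback_mlieBracket (I := 𝓘(ℝ, E)) (I' := 𝓘(ℝ, E)) (n := ∞) (x₀ := q)
    (f := fun x : Q ↦ a • x)
    ((C.isSmoothField_horField hY (a • q)).mdifferentiableAt (by simp))
    ((C.isSmoothField_horField hZ (a • q)).mdifferentiableAt (by simp))
    (C.contMDiff_smul a).contMDiffAt minSmoothness_two_le
  rw [hp, hp] at h
  exact ((C.isInvertible_mfderiv_smul a q).inverse_apply_eq).1 h

theorem TprjProj_smul (a : G) (q : Q) (v : TangentSpace 𝓘(ℝ, E) q) :
    (C.TprjProj (a • q) (mfderiv 𝓘(ℝ, E) 𝓘(ℝ, E) (fun x : Q ↦ a • x) q v) : ES) =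
      C.TprjProj q v := by
  have hinj : Function.Injective (C.redMetric q) := by
    obtain ⟨e, he⟩ := C.isInvertible_redMetric q
    rw [← he]
    exact e.injective
  apply hinj
  ext z
  have h1 : C.redMetric (a • q) (C.TprjProj (a • q)
      (mfderiv 𝓘(ℝ, E) 𝓘(ℝ, E) (fun x : Q ↦ a • x) q v)) z =
      C.metric.inner (a • q) (mfderiv 𝓘(ℝ, E) 𝓘(ℝ, E) (fun x : Q ↦ a • x) q v)
        (C.horL (a • q) z) := C.redMetric_TprjProj (a • q) _ z
  have h2 : C.redMetric q (C.TprjProj q v) z = C.metric.inner q v (C.horL q z) :=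
    C.redMetric_TprjProj q v z
  rw [h2, ← C.isometric a q]
  refine Eq.trans ?_ (h1.trans ?_)
  · exact congrArg (fun L : ES →L[ℝ] ES →L[ℝ] ℝ ↦ L (C.TprjProj (a • q)
      (mfderiv 𝓘(ℝ, E) 𝓘(ℝ, E) (fun x : Q ↦ a • x) q v)) z) (C.redMetric_smul a q).symm
  · exact congrArg (fun w : E ↦ (show E →L[ℝ] E →L[ℝ] ℝ from C.metric.inner (a • q))
      (mfderiv 𝓘(ℝ, E) 𝓘(ℝ, E) (fun x : Q ↦ a • x) q v) w) (C.horL_smul a q z)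

/-- Extending the two vectors to fields on S expresses both sides by brackets. These are
equivariant, and Tπ ∘ 𝒫 is invariant. -/
theorem gyroAt_smul (a : G) (q : Q) : C.gyroAt (a • q) = C.gyroAt q := by
  ext v
  have hv : v = ![v 0, v 1] := by
    ext i
    fin_cases i <;> rfl
  obtain ⟨Y, hY, hYv⟩ := exists_field_eq (C.prj q) (v 0)
  obtain ⟨Z, hZ, hZv⟩ := exists_field_eq (C.prj q) (v 1)
  have h1 := C.gyroAt_field hY hZ q
  have h2 := C.gyroAt_field hY hZ (a • q)
  have key : ∀ s, s = C.prj q → ((show ES from Y s) = v 0 ∧ (show ES from Z s) = v 1 ∧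
      (show ES from VectorField.mlieBracket 𝓘(ℝ, ES) Y Z s) =
        VectorField.mlieBracket 𝓘(ℝ, ES) Y Z (C.prj q)) := by
    rintro _ rfl
    exact ⟨hYv, hZv, rfl⟩
  obtain ⟨k1, k2, k3⟩ := key _ (C.prj_smul a q)
  have hva : v = ![(show ES from Y (C.prj (a • q))), (show ES from Z (C.prj (a • q)))] := by
    rw [k1, k2]; exact hv
  have hvq : v = ![(show ES from Y (C.prj q)), (show ES from Z (C.prj q))] := by
    rw [hYv, hZv]; exact hv
  have e1 := (congrArg (C.gyroAt (a • q)) hva).trans h2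
  have e2 := (congrArg (C.gyroAt q) hvq).trans h1
  rw [mlieBracket_horField_smul C hY hZ] at e1
  refine e1.trans (Eq.trans ?_ e2.symm)
  exact congrArg₂ (fun a b : ES ↦ a - b) (C.TprjProj_smul a q _) k3

theorem gyroAt_eq {q q' : Q} (h : C.prj q = C.prj q') : C.gyroAt q = C.gyroAt q' := by
  obtain ⟨a, rfl⟩ := (C.fibre_prj q q').1 h
  exact (C.gyroAt_smul a q).symm

/-- By invariance any point of the fibre may be used to define 𝒯. Uniqueness holds because every
pair of tangent vectors extends to smooth fields. -/
theorem existsUnique_gyroscopicTensor :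
    ∃! T : (s : S) → TangentSpace 𝓘(ℝ, ES) s [⋀^Fin 2]→L[ℝ] TangentSpace 𝓘(ℝ, ES) s,
      C.IsGyroscopicTensor T := by
  refine ⟨fun s ↦ C.gyroAt (Function.surjInv C.surjective_prj s), ?_, fun T hT ↦ ?_⟩
  · intro Y Z hY hZ q
    refine Eq.trans ?_ (C.gyroAt_field hY hZ q)
    exact congrArg (fun L : ES [⋀^Fin 2]→L[ℝ] ES ↦ L ![Y (C.prj q), Z (C.prj q)])
      (C.gyroAt_eq (Function.surjInv_eq C.surjective_prj _))
  · funext s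
    obtain ⟨q, rfl⟩ := C.surjective_prj s
    ext v
    obtain ⟨Y, hY, hYv⟩ := exists_field_eq (ES := ES) (C.prj q) (v 0)
    obtain ⟨Z, hZ, hZv⟩ := exists_field_eq (ES := ES) (C.prj q) (v 1)
    have hv : v = ![Y (C.prj q), Z (C.prj q)] := by
      ext i
      fin_cases i
      · exact hYv.symm
      · exact hZv.symm
    rw [hv]
    refine (hT Y Z hY hZ q).trans ((C.gyroAt_field hY hZ q).symm.trans ?_)
    exact congrArg (fun L : ES [⋀^Fin 2]→L[ℝ] ES ↦ L ![Y (C.prj q), Z (C.prj q)])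
      (C.gyroAt_eq (Function.surjInv_eq C.surjective_prj _)).symm

theorem isGyroscopicTensor : C.IsGyroscopicTensor C.gyroscopicTensor :=
  Classical.epsilon_spec C.existsUnique_gyroscopicTensor.exists

theorem gyroscopicTensor_prj (q : Q) (y z : ES) :
    C.gyroscopicTensor (C.prj q) ![y, z] = C.TprjProj q (show E from
      C.dhor q (C.horL q y) z - C.dhor q (C.horL q z) y) := by
  obtain ⟨Y, hY, rfl⟩ := exists_field_eq (C.prj q) y
  obtain ⟨Z, hZ, rfl⟩ := exists_field_eq (C.prj q) z
  exact (C.isGyroscopicTensor Y Z hY hZ q).trans ((C.gyroAt_field hY hZ q).symm.trans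
    (C.gyroAt_apply q _))

/-- The gyroscopic tensor in coordinates is smooth. -/
theorem contMDiffAt_gyroscopicTensor {s₀ s : S} (hs : s ∈ (chartAt ES s₀).source) (y z : ES) :
    ContMDiffAt 𝓘(ℝ, ES) 𝓘(ℝ, ES) ∞ (fun x ↦ toCoord s₀ x
      (C.gyroscopicTensor x ![ofCoord s₀ x y, ofCoord s₀ x z])) s := by
  -- Near s the coordinate vectors coincide with global smooth fields, so 𝒯 is there a bracket
  -- expression on Q pulled back along a local section of π.
  obtain ⟨Y, hY, hYs⟩ := exists_field hs y
  obtain ⟨Z, hZ, hZs⟩ := exists_field hs z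
  obtain ⟨q, rfl⟩ := C.surjective_prj s
  obtain ⟨σ, hσ, hσq, hsec⟩ := (C.submersion_prj.isSubmersionAt q).exists_local_section
  have hm : minSmoothness ℝ ((⊤ : ℕ∞) + 1) ≤ ((⊤ : ℕ∞) : WithTop ℕ∞) := by
    rw [minSmoothness_of_isRCLikeNormedField]
    exact le_rfl
  have : IsManifold 𝓘(ℝ, E) (minSmoothness ℝ 2) Q := IsManifold.of_le minSmoothness_two_le
  have : IsManifold 𝓘(ℝ, ES) (minSmoothness ℝ 2) S := IsManifold.of_le minSmoothness_two_le
  have : IsManifold 𝓘(ℝ, E) (∞ + 1) Q := inferInstanceAs (IsManifold 𝓘(ℝ, E) ∞ Q)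
  have : IsManifold 𝓘(ℝ, ES) (∞ + 1) S := inferInstanceAs (IsManifold 𝓘(ℝ, ES) ∞ S)
  have hB : ContMDiffAt 𝓘(ℝ, E) 𝓘(ℝ, E) ∞ (fun x ↦ toCoord q x
      (VectorField.mlieBracket 𝓘(ℝ, E) (C.horField Y) (C.horField Z) x)) q := by
    refine contMDiffAt_field_iff.1 ?_
    exact ContMDiffAt.mlieBracket_vectorField (m := ⊤) (n := ⊤)
      (C.isSmoothField_horField hY q) (C.isSmoothField_horField hZ q) hm
  have hB' : ContMDiffAt 𝓘(ℝ, ES) 𝓘(ℝ, ES) ∞ (fun x ↦ toCoord s₀ x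
      (VectorField.mlieBracket 𝓘(ℝ, ES) Y Z x)) (C.prj q) := by
    refine (contMDiffAt_along_iff contMDiffAt_id hs _).1 ?_
    exact ContMDiffAt.mlieBracket_vectorField (m := ⊤) (n := ⊤)
      (hY (C.prj q)) (hZ (C.prj q)) hm
  have h1 : ContMDiffAt 𝓘(ℝ, E) 𝓘(ℝ, ES) ∞ (fun x ↦ toCoord s₀ (C.prj x) (C.TprjProj x
      (VectorField.mlieBracket 𝓘(ℝ, E) (C.horField Y) (C.horField Z) x))) q := by
    -- Smoothness along π may be checked in any chart. This passes from the chart at s₀ to the one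
    -- at π(q) used in `contMDiffAt_TprjProj`.
    refine (contMDiffAt_along_iff C.contMDiff_prj.contMDiffAt hs _).1 ?_
    refine (contMDiffAt_along_iff C.contMDiff_prj.contMDiffAt
      (mem_chart_source ES (C.prj q)) _).2 ?_
    refine ((C.contMDiffAt_TprjProj q).clm_apply hB).congr_of_eventuallyEq ?_
    filter_upwards [chart_source_mem_nhds E q] with x hx
    change _ = toCoord _ _ (C.TprjProj x (ofCoord q x (toCoord q x _)))
    rw [ofCoord_toCoord hx]
  have h2 : ContMDiffAt 𝓘(ℝ, E) 𝓘(ℝ, ES) ∞ (fun x ↦ toCoord s₀ (C.prj x) (C.TprjProj x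
      (VectorField.mlieBracket 𝓘(ℝ, E) (C.horField Y) (C.horField Z) x)) -
      toCoord s₀ (C.prj x) (VectorField.mlieBracket 𝓘(ℝ, ES) Y Z (C.prj x))) q :=
    h1.sub (ContMDiffAt.comp q hB' C.contMDiff_prj.contMDiffAt)
  refine (ContMDiffAt.comp_of_eq h2 hσ hσq).congr_of_eventuallyEq ?_
  filter_upwards [hsec, hYs, hZs] with x hx hYx hZx
  rw [← hYx, ← hZx]
  have key : ∀ (x : Q) (s : S), C.prj x = s →
      toCoord s₀ s (C.gyroscopicTensor s ![Y s, Z s]) =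
      toCoord s₀ (C.prj x) (C.TprjProj x
        (VectorField.mlieBracket 𝓘(ℝ, E) (C.horField Y) (C.horField Z) x)) -
        toCoord s₀ (C.prj x) (VectorField.mlieBracket 𝓘(ℝ, ES) Y Z (C.prj x)) := by
    rintro x _ rfl
    rw [C.isGyroscopicTensor Y Z hY hZ x, map_sub]
    rfl
  exact key _ _ hx

end Gyroscopic

end ChaplyginSystem

/-! ### Derivatives of maps into cotangent bundles -/

section CotangentDerivative

variable {E : Type*} [NormedAddCommGroup E] [NormedSpace ℝ E]
  {M : Type*} [TopologicalSpace M] [ChartedSpace E M] [IsManifold 𝓘(ℝ, E) ∞ M]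
  {E' : Type*} [NormedAddCommGroup E'] [NormedSpace ℝ E']
  {H' : Type*} [TopologicalSpace H'] {I' : ModelWithCorners ℝ E' H'}
  {N : Type*} [TopologicalSpace N] [ChartedSpace H' N] {f : N → CotangentBundle E M} {z : N}
  {f' : E' →L[ℝ] E × (E →L[ℝ] ℝ)}

theorem hasMFDerivAt_cotangent_proj (hf : HasMFDerivAt I' (cotModel E) f z f') :
    HasMFDerivAt I' 𝓘(ℝ, E) (fun n ↦ (f n).proj) z
      (show E' →L[ℝ] E from (ContinuousLinearMap.fst ℝ E (E →L[ℝ] ℝ)).comp f') := by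
  have h1 : HasMFDerivAt (cotModel E) 𝓘(ℝ, E) (fun a : CotangentBundle E M ↦ a.proj) (f z)
      (tangentProj (f z)) :=
    (contMDiff_cotangent_proj.mdifferentiableAt (by simp)).hasMFDerivAt
  refine (h1.comp z hf).congr_mfderiv ?_
  ext v
  exact tangentProj_apply (f z) (f' v)

theorem hasMFDerivAt_covector_coord (hf : HasMFDerivAt I' (cotModel E) f z f') :
    HasMFDerivAt I' 𝓘(ℝ, E →L[ℝ] ℝ)
      (fun n ↦ (covector (f n)).comp (ofCoord (f z).proj (f n).proj)) z
      (show E' →L[ℝ] (E →L[ℝ] ℝ) from (ContinuousLinearMap.snd ℝ E (E →L[ℝ] ℝ)).comp f') := by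
  have h1 := (mdifferentiableAt_extChartAt (I := cotModel E)
    (mem_chart_source _ (f z))).hasMFDerivAt
  rw [mfderiv_extChartAt_self] at h1
  have h2 := (ContinuousLinearMap.snd ℝ E (E →L[ℝ] ℝ)).hasMFDerivAt.comp z (h1.comp z hf)
  have h3 : (fun n ↦ (covector (f n)).comp (ofCoord (f z).proj (f n).proj)) =
      (ContinuousLinearMap.snd ℝ E (E →L[ℝ] ℝ)) ∘ extChartAt (cotModel E) (f z) ∘ f :=
    funext fun n ↦ (covector_coord (f z) (f n)).symm
  rw [h3]
  exact h2

end CotangentDerivative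

/-! ### Reduced dynamics -/

/-- Reduction of a Hamiltonian vector to a vector that solves the gyroscopic equation. -/
theorem gyroscopic_contraction {E ES : Type*} [NormedAddCommGroup E] [NormedSpace ℝ E]
    [NormedAddCommGroup ES] [NormedSpace ℝ ES] {h : ES →L[ℝ] E} {t : E →L[ℝ] ES} {P : E →L[ℝ] E}
    {A : E →L[ℝ] ES →L[ℝ] E} {p : E →L[ℝ] ℝ} {T : ES → ES → ES}
    {dH : ES × (ES →L[ℝ] ℝ) →L[ℝ] ℝ} {V : E × (E →L[ℝ] ℝ)}
    (hth : ∀ y, t (h y) = y) (hPh : ∀ y, P (h y) = h y) (hht : ∀ v, h (t (P v)) = P v)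
    (hp : ∀ v, p (P v) = p v) (hT : ∀ y z, T y z = t (P (A (h y) z - A (h z) y)))
    (hV : ∀ W : E × (E →L[ℝ] ℝ), W.2 V.1 - V.2 W.1 = dH (t W.1, W.2.comp h + p.comp (A W.1)))
    (Z : ES × (ES →L[ℝ] ℝ)) :
    Z.2 (t V.1) - (V.2.comp h + p.comp (A V.1)) Z.1 + (p.comp h) (T (t V.1) Z.1) = dH Z := by
  have hPV : P V.1 = V.1 := by
    refine (SeparatingDual.eq_iff_forall_dual_eq (R := ℝ)).2 fun ℓ ↦ ?_
    -- This test vector is killed by the derivative of the reduction map, since 1 - P vanishes on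
    -- horizontal vectors. It yields ℓ(V₁) = ℓ(P V₁), which is the constraint on V.
    have h1 := hV (0, ℓ.comp (ContinuousLinearMap.id ℝ E - P))
    have h2 : (ℓ.comp (ContinuousLinearMap.id ℝ E - P)).comp h = 0 := by
      ext y
      simp [hPh]
    rw [h2] at h1
    have h3 : ((0 : ES), (0 : ES →L[ℝ] ℝ)) = 0 := rfl
    simp only [map_zero, ContinuousLinearMap.comp_zero, add_zero, h3] at h1
    have h4 : ℓ V.1 - ℓ (P V.1) = 0 := by simpa using h1
    linarith
  have hhV : h (t V.1) = V.1 := by rw [← hPV, hht]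
  -- A lift of Z with horizontal base part. The fibre part is corrected by the derivative of the
  -- lift so that the image is exactly Z.
  have h1 := hV (h Z.1, (Z.2 - p.comp (A (h Z.1))).comp t)
  have h2 : ((Z.2 - p.comp (A (h Z.1))).comp t).comp h + p.comp (A (h Z.1)) = Z.2 := by
    ext y
    simp [hth]
  simp only [h2, hth] at h1
  rw [← Prod.mk.eta (p := Z), ← h1]
  simp only [hT, hhV, ContinuousLinearMap.comp_apply, add_apply,
    sub_apply, hht, hp, map_sub]
  ring

namespace ChaplyginSystem

section Dynamics

variable {E : Type*} [NormedAddCommGroup E] [NormedSpace ℝ E] [FiniteDimensional ℝ E]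
  {Q : Type*} [TopologicalSpace Q] [ChartedSpace E Q] [IsManifold 𝓘(ℝ, E) ∞ Q]
  {EG : Type*} [NormedAddCommGroup EG] [NormedSpace ℝ EG] [FiniteDimensional ℝ EG]
  {G : Type*} [TopologicalSpace G] [SecondCountableTopology G]
  [ChartedSpace EG G] [Group G] [LieGroup 𝓘(ℝ, EG) ∞ G]
  {ES : Type*} [NormedAddCommGroup ES] [NormedSpace ℝ ES] [FiniteDimensional ℝ ES]
  {S : Type*} [TopologicalSpace S] [T2Space S] [ChartedSpace ES S] [IsManifold 𝓘(ℝ, ES) ∞ S]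
  [MulAction G Q]
  (C : ChaplyginSystem E Q EG G ES S)

theorem hasMFDerivAt_cotReduction (α : CotangentBundle E Q) :
    HasMFDerivAt (cotModel E) (cotModel ES) C.cotReduction α
      (mfderiv (cotModel E) (cotModel ES) C.cotReduction α) :=
  (C.contMDiff_cotReduction.mdifferentiableAt (by simp)).hasMFDerivAt

/-- In coordinates the map is (q, p) ↦ (π(q), p ∘ hor_q), and the product rule applies. The summand
with `dhor` is the source of the gyroscopic form. -/
theorem mfderiv_cotReduction (α : CotangentBundle E Q) (X : E × (E →L[ℝ] ℝ)) :
    (mfderiv (cotModel E) (cotModel ES) C.cotReduction α X : ES × (ES →L[ℝ] ℝ)) =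
      ((show ES from C.Tprj α.proj X.1), X.2.comp (show ES →L[ℝ] E from C.horL α.proj) +
        (show E →L[ℝ] ℝ from covector α).comp (C.dhor α.proj X.1)) := by
  have hid : HasMFDerivAt (cotModel E) (cotModel E) (fun a : CotangentBundle E Q ↦ a) α
      (ContinuousLinearMap.id ℝ (E × (E →L[ℝ] ℝ))) := hasMFDerivAt_id α
  have hpr := hasMFDerivAt_cotangent_proj hid
  refine Prod.ext ?_ ?_
  · have h1 := hasMFDerivAt_cotangent_proj (C.hasMFDerivAt_cotReduction α)
    have h2 := (C.hasMFDerivAt_prj α.proj).comp α hpr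
    exact congrArg (fun L : E × (E →L[ℝ] ℝ) →L[ℝ] ES ↦ L X) (hasMFDerivAt_unique h1 h2)
  · have h1 := hasMFDerivAt_covector_coord (C.hasMFDerivAt_cotReduction α)
    have h2 := hasMFDerivAt_clm_comp (hasMFDerivAt_covector_coord hid)
      ((C.hasMFDerivAt_horCoord α.proj).comp α hpr)
    have h3 : (fun a ↦ (covector (C.cotReduction a)).comp
        (ofCoord (C.cotReduction α).proj (C.cotReduction a).proj)) =ᶠ[𝓝 α]
        fun a ↦ ((covector a).comp (ofCoord α.proj a.proj)).comp
          (C.horCoord α.proj a.proj) := by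
      filter_upwards [C.eventually_proj_mem_charts α] with a ha
      exact C.covector_cotReduction_coord ha.1
    have h4 := congrArg (fun L : E × (E →L[ℝ] ℝ) →L[ℝ] (ES →L[ℝ] ℝ) ↦ L X)
      (hasMFDerivAt_unique h1 (h2.congr_of_eventuallyEq h3))
    refine Eq.trans h4 ?_
    have e1 : C.horCoord α.proj α.proj = (show ES →L[ℝ] E from C.horL α.proj) := by
      ext y
      exact C.horCoord_self α.proj y
    have e2 : (covector α).comp (ofCoord α.proj α.proj) = (show E →L[ℝ] ℝ from covector α) := by
      ext e
      exact congrArg (covector α) (ofCoord_self (E := E) α.proj e)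
    change ((covector α).comp (ofCoord α.proj α.proj)).comp (C.dhor α.proj X.1) +
      X.2.comp (C.horCoord α.proj α.proj) = _
    rw [e1, e2, add_comm]

theorem gyroscopicForm_apply (α : CotangentBundle ES S) (u v : ES × (ES →L[ℝ] ℝ)) :
    C.gyroscopicForm α ![u, v] = covector α (C.gyroscopicTensor α.proj ![u.1, v.1]) := by
  change covector α (C.gyroscopicTensor α.proj _) = _
  refine congrArg (fun w ↦ covector α (C.gyroscopicTensor α.proj w)) ?_
  funext i
  fin_cases i
  · exact tangentProj_apply α u
  · exact tangentProj_apply α v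

theorem Ωnh_apply (α : CotangentBundle ES S) (u v : ES × (ES →L[ℝ] ℝ)) :
    C.Ωnh α ![u, v] = v.2 u.1 - u.2 v.1 +
      covector α (C.gyroscopicTensor α.proj ![u.1, v.1]) := by
  exact congrArg₂ (fun x y : ℝ ↦ x + y) (canonicalForm_apply α u v) (C.gyroscopicForm_apply α u v)

/-- Vertical test vectors do not see the gyroscopic term and force the base part of u to vanish.
Then that term vanishes altogether and the canonical form remains. -/
theorem Ωnh_nondegenerate : C.Ωnh.Nondegenerate := by
  intro α u hu
  have h : ∀ v : ES × (ES →L[ℝ] ℝ), v.2 (show ES × (ES →L[ℝ] ℝ) from u).1 -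
      (show ES × (ES →L[ℝ] ℝ) from u).2 v.1 + covector α (C.gyroscopicTensor α.proj
        ![(show ES × (ES →L[ℝ] ℝ) from u).1, v.1]) = 0 := fun v ↦
    (C.Ωnh_apply α u v).symm.trans (hu v)
  have h1 : (show ES × (ES →L[ℝ] ℝ) from u).1 = 0 := by
    refine (SeparatingDual.eq_zero_iff_forall_dual_eq_zero (R := ℝ) _).2 fun g ↦ ?_
    have h2 := h (0, g)
    have h3 : C.gyroscopicTensor α.proj ![(show ES × (ES →L[ℝ] ℝ) from u).1, (0 : ES)] = 0 :=
      (C.gyroscopicTensor α.proj).map_coord_zero 1 rfl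
    rw [h3] at h2
    simpa using h2
  refine eq_zero_of_forall_canonical_eq_zero (E := ES) u fun v ↦ ?_
  have h2 := h v
  have h3 : C.gyroscopicTensor α.proj ![(show ES × (ES →L[ℝ] ℝ) from u).1, v.1] = 0 :=
    (C.gyroscopicTensor α.proj).map_coord_zero 0 h1
  rw [h3, map_zero, add_zero] at h2
  exact h2

/-- The image of the Hamiltonian vector at a point of `𝒫^*(D^*)` solves `i_X Ω_nh = dH`. -/
theorem contractsTo_mfderiv_cotReduction (β : C.DualBundle) {H : CotangentBundle ES S → ℝ}
    (hH : IsSmoothFun H) :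
    C.Ωnh.ContractsTo H (C.cotReduction (C.projDstar β))
      (mfderiv (cotModel E) (cotModel ES) C.cotReduction (C.projDstar β)
        (hamiltonianVector (fun α ↦ H (C.cotReduction α)) (C.projDstar β))) := by
  obtain ⟨q, b⟩ := β
  set α := C.projDstar ⟨q, b⟩ with hα
  set V : E × (E →L[ℝ] ℝ) := hamiltonianVector (fun α ↦ H (C.cotReduction α)) α with hVdef
  let h : ES →L[ℝ] E := C.horL q
  let t : E →L[ℝ] ES := C.Tprj q
  let P : E →L[ℝ] E := (C.D q).subtypeL.comp (C.projD q)
  let A : E →L[ℝ] ES →L[ℝ] E := C.dhor q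
  let p : E →L[ℝ] ℝ := covector α
  let T : ES → ES → ES := fun y z ↦ C.gyroscopicTensor (C.prj q) ![y, z]
  let dH : ES × (ES →L[ℝ] ℝ) →L[ℝ] ℝ := mvfderiv (cotModel ES) H (C.cotReduction α)
  have hTΦ : ∀ X : E × (E →L[ℝ] ℝ),
      (mfderiv (cotModel E) (cotModel ES) C.cotReduction α X : ES × (ES →L[ℝ] ℝ)) =
      (t X.1, X.2.comp h + p.comp (A X.1)) := C.mfderiv_cotReduction α
  have hV : ∀ W : E × (E →L[ℝ] ℝ), W.2 V.1 - V.2 W.1 =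
      dH (t W.1, W.2.comp h + p.comp (A W.1)) := by
    intro W
    rw [← hTΦ W, ← canonicalForm_apply α V W]
    have h1 := contractsTo_hamiltonianVector (fun α ↦ H (C.cotReduction α)) α W
    refine h1.trans ?_
    have h2 := (((hH (C.cotReduction α)).mdifferentiableAt (by simp)).hasMFDerivAt).comp α
      (C.hasMFDerivAt_cotReduction α)
    exact congrArg (fun L : E × (E →L[ℝ] ℝ) →L[ℝ] ℝ ↦ L W) h2.mfderiv
  -- The hypothesis p ∘ P = p holds because α lies in the image of 𝒫^*.
  have key := gyroscopic_contraction (h := h) (t := t) (P := P) (A := A) (p := p) (T := T)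
    (dH := dH) (V := V) (C.Tprj_horL q)
    (fun y ↦ congrArg Subtype.val (C.projD_of_mem q (C.hor q y)))
    (C.horL_TprjProj q)
    (fun v ↦ congrArg b (C.projD_of_mem q (C.projD q v)))
    (C.gyroscopicTensor_prj q) hV
  intro Z
  refine Eq.trans ?_ (key Z)
  rw [hTΦ V]
  exact C.Ωnh_apply (C.cotReduction α) _ Z

end Dynamics

end ChaplyginSystem

/-! ### Coordinates of Ω_nh, closedness and the reduced field -/

/-- The exterior derivative of a 2-form on a vector space. -/
theorem extDeriv_two_form_apply {F : Type*} [NormedAddCommGroup F] [NormedSpace ℝ F]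
    {f : F → F [⋀^Fin 2]→L[ℝ] ℝ} {y : F} (hf : DifferentiableAt ℝ f y) (u : Fin 3 → F) :
    extDeriv f y u = fderiv ℝ (fun y ↦ f y ![u 1, u 2]) y (u 0) -
      fderiv ℝ (fun y ↦ f y ![u 0, u 2]) y (u 1) +
      fderiv ℝ (fun y ↦ f y ![u 0, u 1]) y (u 2) := by
  rw [extDeriv_apply hf]
  have h0 : (0 : Fin 3).removeNth u = ![u 1, u 2] := by ext i; fin_cases i <;> rfl
  have h1 : (1 : Fin 3).removeNth u = ![u 0, u 2] := by ext i; fin_cases i <;> rfl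
  have h2 : (2 : Fin 3).removeNth u = ![u 0, u 1] := by ext i; fin_cases i <;> rfl
  rw [Fin.sum_univ_three, h0, h1, h2]
  simp [sub_eq_add_neg]

theorem differentiableAt_alternating_apply {F : Type*} [NormedAddCommGroup F] [NormedSpace ℝ F]
    {k : ℕ} {f : F → F [⋀^Fin k]→L[ℝ] ℝ} {y : F} (hf : DifferentiableAt ℝ f y) (u : Fin k → F) :
    DifferentiableAt ℝ (fun y ↦ f y u) y :=
  (ContinuousAlternatingMap.apply ℝ F ℝ u).differentiableAt.comp y hf

namespace ChaplyginSystem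

section Main

variable {E : Type*} [NormedAddCommGroup E] [NormedSpace ℝ E] [FiniteDimensional ℝ E]
  {Q : Type*} [TopologicalSpace Q] [ChartedSpace E Q] [IsManifold 𝓘(ℝ, E) ∞ Q]
  {EG : Type*} [NormedAddCommGroup EG] [NormedSpace ℝ EG] [FiniteDimensional ℝ EG]
  {G : Type*} [TopologicalSpace G] [SecondCountableTopology G]
  [ChartedSpace EG G] [Group G] [LieGroup 𝓘(ℝ, EG) ∞ G]
  {ES : Type*} [NormedAddCommGroup ES] [NormedSpace ℝ ES] [FiniteDimensional ℝ ES]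
  {S : Type*} [TopologicalSpace S] [T2Space S] [ChartedSpace ES S] [IsManifold 𝓘(ℝ, ES) ∞ S]
  [MulAction G Q]
  (C : ChaplyginSystem E Q EG G ES S)

/-- The gyroscopic tensor in the preferred chart at `s₀`. -/
def gyroCoord (s₀ s : S) (u v : ES) : ES :=
  toCoord s₀ s (C.gyroscopicTensor s ![ofCoord s₀ s u, ofCoord s₀ s v])

theorem gyroCoord_zero_left (s₀ s : S) (v : ES) : C.gyroCoord s₀ s 0 v = 0 := by
  have h : C.gyroscopicTensor s ![ofCoord s₀ s 0, ofCoord s₀ s v] = 0 :=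
    (C.gyroscopicTensor s).map_coord_zero 0 (map_zero (ofCoord s₀ s))
  rw [gyroCoord, h, map_zero]

theorem gyroCoord_eq_zero (s₀ : S) {s : S} (h : C.gyroscopicTensor s = 0) (u v : ES) :
    C.gyroCoord s₀ s u v = 0 := by
  rw [gyroCoord, h]
  exact map_zero (toCoord s₀ s)

theorem gyroCoord_self (s : S) (u v : ES) :
    C.gyroCoord s s u v = C.gyroscopicTensor s ![u, v] := by
  rw [gyroCoord, toCoord_self]
  refine congrArg (C.gyroscopicTensor s) ?_
  funext i
  fin_cases i
  · exact ofCoord_self s u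
  · exact ofCoord_self s v

/-- The form `Ω_nh` in canonical coordinates. -/
theorem Ωnh_inChart (α₀ : CotangentBundle ES S) {y : ES × (ES →L[ℝ] ℝ)}
    (hy : y ∈ (extChartAt (cotModel ES) α₀).target) (u : Fin 2 → ES × (ES →L[ℝ] ℝ)) :
    C.Ωnh.inChart α₀ y u = (u 1).2 (u 0).1 - (u 0).2 (u 1).1 +
      y.2 (C.gyroCoord α₀.proj ((extChartAt 𝓘(ℝ, ES) α₀.proj).symm y.1) (u 0).1 (u 1).1) := by
  rw [← canonicalForm_inChart α₀ hy u, ← cotangent_symm_proj α₀ hy]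
  set α := (extChartAt (cotModel ES) α₀).symm y with hα
  have hs : α.proj ∈ (chartAt ES α₀.proj).source := by
    rw [← extChartAt_source 𝓘(ℝ, ES), ← cotangent_mem_source_iff]
    exact (extChartAt (cotModel ES) α₀).map_target hy
  have hy2 : y.2 = (covector α).comp (ofCoord α₀.proj α.proj) := by
    rw [← covector_coord, hα, (extChartAt (cotModel ES) α₀).right_inv hy]
  have hy1 : extChartAt 𝓘(ℝ, ES) α₀.proj α.proj = y.1 := by
    rw [← cotangent_extChartAt_fst, hα, (extChartAt (cotModel ES) α₀).right_inv hy]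
  have hof : ∀ v : ES, (ofCoord α₀.proj α.proj v : ES) =
      mfderivWithin 𝓘(ℝ, ES) 𝓘(ℝ, ES) (extChartAt 𝓘(ℝ, ES) α₀.proj).symm
        (Set.range 𝓘(ℝ, ES)) y.1 v := by
    intro v
    have h := congrArg (fun L : ES →L[ℝ] ES ↦ L v) (ofCoord_eq_mfderivWithin hs)
    rw [hy1] at h
    exact h
  refine congrArg (fun r : ℝ ↦ (canonicalForm ES S).inChart α₀ y u + r) ?_
  rw [hy2]
  change covector α (C.gyroscopicTensor α.proj _) =
    covector α (ofCoord _ _ (toCoord _ _ (C.gyroscopicTensor α.proj _)))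
  rw [ofCoord_toCoord hs]
  refine congrArg (fun w ↦ covector α (C.gyroscopicTensor α.proj w)) ?_
  have hi : ∀ i, tangentProj α (mfderivWithin 𝓘(ℝ, ES × (ES →L[ℝ] ℝ)) (cotModel ES)
      (extChartAt (cotModel ES) α₀).symm (Set.range (cotModel ES)) y (u i)) =
      ofCoord α₀.proj α.proj (u i).1 := fun i ↦
    (tangentProj_comp_mfderivWithin_symm α₀ hy (u i)).trans (hof (u i).1).symm
  funext i
  fin_cases i
  · exact hi 0
  · exact hi 1

theorem contDiffAt_gyroCoord {s₀ : S} {x : ES} (hx : x ∈ (extChartAt 𝓘(ℝ, ES) s₀).target)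
    (u v : ES) :
    ContDiffAt ℝ ∞ (fun x ↦ C.gyroCoord s₀ ((extChartAt 𝓘(ℝ, ES) s₀).symm x) u v) x := by
  rw [← contMDiffAt_iff_contDiffAt]
  have hs : (extChartAt 𝓘(ℝ, ES) s₀).symm x ∈ (chartAt ES s₀).source := by
    rw [← extChartAt_source 𝓘(ℝ, ES)]
    exact (extChartAt 𝓘(ℝ, ES) s₀).map_target hx
  have h1 : ContMDiffAt 𝓘(ℝ, ES) 𝓘(ℝ, ES) ∞ (extChartAt 𝓘(ℝ, ES) s₀).symm x :=
    (contMDiffOn_extChartAt_symm s₀).contMDiffAt ((isOpen_extChartAt_target s₀).mem_nhds hx)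
  exact ContMDiffAt.comp x (C.contMDiffAt_gyroscopicTensor hs u v) h1

theorem Ωnh_isSmooth : C.Ωnh.IsSmooth := by
  refine DiffForm.isSmooth_of_apply fun α y hy u ↦ ?_
  have hy1 := (cotangent_mem_target_iff α y).1 hy
  have h1 : ContDiffAt ℝ ∞ (fun y : ES × (ES →L[ℝ] ℝ) ↦ C.gyroCoord α.proj
      ((extChartAt 𝓘(ℝ, ES) α.proj).symm y.1) (u 0).1 (u 1).1) y :=
    ContDiffAt.comp (g := fun x ↦ C.gyroCoord α.proj ((extChartAt 𝓘(ℝ, ES) α.proj).symm x)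
      (u 0).1 (u 1).1) y (C.contDiffAt_gyroCoord hy1 _ _) contDiffAt_fst
  have h2 : ContDiffAt ℝ ∞ (fun y : ES × (ES →L[ℝ] ℝ) ↦ (u 1).2 (u 0).1 - (u 0).2 (u 1).1 +
      y.2 (C.gyroCoord α.proj ((extChartAt 𝓘(ℝ, ES) α.proj).symm y.1) (u 0).1 (u 1).1)) y :=
    contDiffAt_const.add (contDiffAt_snd.clm_apply h1)
  refine h2.congr_of_eventuallyEq ?_
  filter_upwards [(isOpen_extChartAt_target α).mem_nhds hy] with y' hy'
  exact C.Ωnh_inChart α hy' u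

theorem differentiableAt_Ωnh_inChart (α : CotangentBundle ES S) :
    DifferentiableAt ℝ (C.Ωnh.inChart α) (extChartAt (cotModel ES) α α) :=
  ((C.Ωnh_isSmooth α).contDiffAt ((isOpen_extChartAt_target α).mem_nhds
    (mem_extChartAt_target α))).differentiableAt (by simp)

/-- Without 𝒯 the coefficients in canonical coordinates are constant. -/
theorem Ωnh_isClosed_of_gyroscopicTensor_eq_zero (h : ∀ s, C.gyroscopicTensor s = 0) :
    C.Ωnh.IsClosed := by
  rw [DiffForm.isClosed_iff]
  intro α
  have hc : ∀ u v w : ES × (ES →L[ℝ] ℝ), fderiv ℝ (fun y ↦ C.Ωnh.inChart α y ![u, v])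
      (extChartAt (cotModel ES) α α) w = 0 := by
    intro u v w
    have h1 : (fun y ↦ C.Ωnh.inChart α y ![u, v]) =ᶠ[𝓝 (extChartAt (cotModel ES) α α)]
        fun _ ↦ v.2 u.1 - u.2 v.1 := by
      filter_upwards [(isOpen_extChartAt_target α).mem_nhds (mem_extChartAt_target α)] with y hy
      rw [C.Ωnh_inChart α hy]
      simp [C.gyroCoord_eq_zero _ (h _)]
    rw [h1.fderiv_eq]
    simp
  ext u
  rw [extDeriv_two_form_apply (C.differentiableAt_Ωnh_inChart α), hc, hc, hc]
  simp

/-- On (0, g), (v₀, 0), (v₁, 0) the exterior derivative is g(𝒯(v₀, v₁)). The other two terms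
differentiate coefficients with a vertical argument, which are constant. -/
theorem gyroscopicTensor_eq_zero_of_isClosed (h : C.Ωnh.IsClosed) (s : S) :
    C.gyroscopicTensor s = 0 := by
  rw [DiffForm.isClosed_iff] at h
  -- Any point over s would do: the fibre derivative of a term linear in p does not depend on p.
  let α : CotangentBundle ES S := mkCovector s 0
  have hmem := mem_extChartAt_target (I := cotModel ES) α
  set y₀ := extChartAt (cotModel ES) α α with hy₀
  have hev := (isOpen_extChartAt_target (I := cotModel ES) α).mem_nhds hmem
  ext v
  refine (SeparatingDual.eq_zero_iff_forall_dual_eq_zero (R := ℝ) (V := ES) _).2 fun g ↦ ?_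
  have h1 := congrArg (fun η ↦ η ![((0 : ES), g), ((show ES from v 0), 0),
    ((show ES from v 1), 0)]) (h α)
  have h2 := extDeriv_two_form_apply (C.differentiableAt_Ωnh_inChart α)
    ![((0 : ES), g), ((show ES from v 0), 0), ((show ES from v 1), 0)]
  have hconst : ∀ w z : ES × (ES →L[ℝ] ℝ),
      fderiv ℝ (fun y ↦ C.Ωnh.inChart α y ![((0 : ES), g), w]) y₀ z = 0 := by
    intro w z
    have h3 : (fun y ↦ C.Ωnh.inChart α y ![((0 : ES), g), w]) =ᶠ[𝓝 y₀]
        fun _ ↦ w.2 0 - g w.1 := by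
      filter_upwards [hev] with y hy
      rw [C.Ωnh_inChart α hy]
      simp [gyroCoord_zero_left]
    rw [h3.fderiv_eq]
    simp
  have hline : fderiv ℝ (fun y ↦ C.Ωnh.inChart α y
      ![((show ES from v 0), (0 : ES →L[ℝ] ℝ)), ((show ES from v 1), 0)]) y₀ (0, g) =
      g (C.gyroscopicTensor s ![v 0, v 1]) := by
    have hdiff : DifferentiableAt ℝ (fun y ↦ C.Ωnh.inChart α y
        ![((show ES from v 0), (0 : ES →L[ℝ] ℝ)), ((show ES from v 1), 0)]) y₀ :=
      differentiableAt_alternating_apply (C.differentiableAt_Ωnh_inChart α) _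
    -- Along the fibre the base point is fixed, so the coefficient is affine in t with slope g(𝒯(v₀,
    -- v₁)).
    rw [← hdiff.lineDeriv_eq_fderiv, lineDeriv]
    have hy1 : (extChartAt 𝓘(ℝ, ES) s).symm y₀.1 = s := by
      rw [hy₀, cotangent_extChartAt_fst]
      exact extChartAt_to_inv s
    have h3 : (fun t : ℝ ↦ C.Ωnh.inChart α (y₀ + t • ((0 : ES), g))
        ![((show ES from v 0), (0 : ES →L[ℝ] ℝ)), ((show ES from v 1), 0)]) =
        fun t ↦ y₀.2 (C.gyroscopicTensor s ![v 0, v 1]) +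
          t * g (C.gyroscopicTensor s ![v 0, v 1]) := by
      funext t
      have hfst : (y₀ + t • ((0 : ES), g)).1 = y₀.1 := by simp
      have hmem' : y₀ + t • ((0 : ES), g) ∈ (extChartAt (cotModel ES) α).target := by
        rw [cotangent_mem_target_iff, hfst, ← cotangent_mem_target_iff]
        exact hmem
      have h4 := C.Ωnh_inChart α hmem'
        ![((show ES from v 0), (0 : ES →L[ℝ] ℝ)), ((show ES from v 1), 0)]
      rw [hfst] at h4
      have h5 : C.gyroCoord α.proj ((extChartAt 𝓘(ℝ, ES) α.proj).symm y₀.1) (v 0) (v 1) =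
          C.gyroscopicTensor s ![v 0, v 1] := by
        have h6 := C.gyroCoord_self s (v 0) (v 1)
        rw [← h6]
        exact congrArg (fun x ↦ C.gyroCoord s x (v 0) (v 1)) hy1
      refine h4.trans ((congrArg (fun k : ES ↦ _ + (y₀ + t • ((0 : ES), g)).2 k) h5).trans ?_)
      change (0 : ℝ) - 0 + (y₀.2 _ + t * g _) = _
      rw [sub_zero, zero_add]
    rw [h3]
    simp
  have hv : v = ![v 0, v 1] := by
    ext i
    fin_cases i <;> rfl
  rw [hv, ← hline]
  have h3 := h2.symm.trans h1
  have e1 := hconst ((show ES from v 1), 0) ((show ES from v 0), 0)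
  have e2 := hconst ((show ES from v 0), 0) ((show ES from v 1), 0)
  simp only [Matrix.cons_val] at h3
  rw [e1, e2] at h3
  rw [sub_zero, add_zero] at h3
  exact h3

theorem Ωnh_isClosed_iff : C.Ωnh.IsClosed ↔ ∀ s : S, C.gyroscopicTensor s = 0 :=
  ⟨C.gyroscopicTensor_eq_zero_of_isClosed, C.Ωnh_isClosed_of_gyroscopicTensor_eq_zero⟩

/-- A solution of `i_X Ω_nh = dH` is the reduced nonholonomic vector field. -/
theorem isReducedField_of_contractsTo
    {X : (α : CotangentBundle ES S) → TangentSpace (cotModel ES) α}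
    (hX : ∀ α, C.Ωnh.ContractsTo C.reducedHamiltonian α (X α)) : C.IsReducedField X := by
  obtain ⟨hH, hHβ⟩ := C.isReducedHamiltonian
  refine ⟨C.Ωnh_nondegenerate.isSmoothField C.Ωnh_isSmooth hH hX, fun F hF β ↦ ?_⟩
  have hham : (fun α : CotangentBundle E Q ↦ C.constrainedHamiltonian (C.iDstar α)) =
      fun α ↦ C.reducedHamiltonian (C.cotReduction α) := funext fun α ↦ (hHβ _).symm
  -- The points ρ(β) and Φ(𝒫^*β) agree by `iDstar_projDstar`. At the latter, non-degeneracy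
  -- identifies X with the image of the Hamiltonian vector under TΦ, and the chain rule for F ∘ Φ
  -- concludes.
  have key : ∀ γ, γ = C.cotReduction (C.projDstar β) →
      mvfderiv (cotModel ES) F γ (X γ) =
        C.nonholonomicField (fun β' ↦ F (C.reduction β')) β := by
    rintro _ rfl
    rw [(hX _).unique C.Ωnh_nondegenerate (C.contractsTo_mfderiv_cotReduction β hH)]
    change _ = mvfderiv (cotModel E) (F ∘ C.cotReduction) (C.projDstar β)
      (hamiltonianVector (fun α : CotangentBundle E Q ↦ C.constrainedHamiltonian (C.iDstar α))
        (C.projDstar β))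
    rw [hham]
    have h2 := (((hF (C.cotReduction (C.projDstar β))).mdifferentiableAt
      (by simp)).hasMFDerivAt).comp (C.projDstar β) (C.hasMFDerivAt_cotReduction _)
    exact (congrArg (fun L : E × (E →L[ℝ] ℝ) →L[ℝ] ℝ ↦ L (hamiltonianVector
      (fun α ↦ C.reducedHamiltonian (C.cotReduction α)) (C.projDstar β))) h2.mfderiv).symm
  exact key _ (congrArg C.reduction (C.iDstar_projDstar β).symm)

/-- The reduction map is onto and smooth functions separate tangent vectors. -/
theorem isReducedField_unique {X X' : (α : CotangentBundle ES S) → TangentSpace (cotModel ES) α}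
    (hX : C.IsReducedField X) (hX' : C.IsReducedField X') : X = X' := by
  funext γ
  obtain ⟨β, rfl⟩ := C.surjective_reduction γ
  exact eq_of_forall_mvfderiv_eq fun F hF ↦ (hX.2 F hF β).trans (hX'.2 F hF β).symm

theorem exists_contractsTo_reducedHamiltonian :
    ∃ X : (α : CotangentBundle ES S) → TangentSpace (cotModel ES) α,
      ∀ α, C.Ωnh.ContractsTo C.reducedHamiltonian α (X α) :=
  ⟨fun α ↦ (C.Ωnh_nondegenerate.exists_contractsTo _ α).choose,
    fun α ↦ (C.Ωnh_nondegenerate.exists_contractsTo _ α).choose_spec⟩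

theorem existsUnique_reducedField :
    ∃! X : (α : CotangentBundle ES S) → TangentSpace (cotModel ES) α, C.IsReducedField X := by
  obtain ⟨X, hX⟩ := C.exists_contractsTo_reducedHamiltonian
  exact ⟨X, C.isReducedField_of_contractsTo hX,
    fun _ h ↦ C.isReducedField_unique h (C.isReducedField_of_contractsTo hX)⟩

theorem isReducedField : C.IsReducedField C.reducedField :=
  Classical.epsilon_spec C.existsUnique_reducedField.exists

/-- A solution exists and every solution is a reduced field. As there is only one reduced field, the
converse follows. -/
theorem contractsTo_iff_eq_reducedField
    (X : (α : CotangentBundle ES S) → TangentSpace (cotModel ES) α) :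
    (∀ α, C.Ωnh.ContractsTo C.reducedHamiltonian α (X α)) ↔ X = C.reducedField := by
  constructor
  · intro hX
    exact C.isReducedField_unique (C.isReducedField_of_contractsTo hX) C.isReducedField
  · rintro rfl
    obtain ⟨X, hX⟩ := C.exists_contractsTo_reducedHamiltonian
    rwa [← C.isReducedField_unique (C.isReducedField_of_contractsTo hX) C.isReducedField]

end Main

end ChaplyginSystem

end Chaplygin

end

open Chaplygin in
theorem theoremT
    {E : Type*} [NormedAddCommGroup E] [NormedSpace ℝ E] [FiniteDimensional ℝ E]
    {Q : Type*} [TopologicalSpace Q] [T2Space Q] [SecondCountableTopology Q]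
    [ChartedSpace E Q] [IsManifold 𝓘(ℝ, E) ∞ Q]
    {EG : Type*} [NormedAddCommGroup EG] [NormedSpace ℝ EG] [FiniteDimensional ℝ EG]
    {G : Type*} [TopologicalSpace G] [T2Space G] [SecondCountableTopology G]
    [ChartedSpace EG G] [Group G] [LieGroup 𝓘(ℝ, EG) ∞ G]
    {ES : Type*} [NormedAddCommGroup ES] [NormedSpace ℝ ES] [FiniteDimensional ℝ ES]
    {S : Type*} [TopologicalSpace S] [T2Space S] [SecondCountableTopology S]
    [ChartedSpace ES S] [IsManifold 𝓘(ℝ, ES) ∞ S]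
    [MulAction G Q] (C : ChaplyginSystem E Q EG G ES S) :
    C.CotangentIsReducedSpace ∧
    (∃! T : (s : S) → TangentSpace 𝓘(ℝ, ES) s [⋀^Fin 2]→L[ℝ] TangentSpace 𝓘(ℝ, ES) s,
      C.IsGyroscopicTensor T) ∧
    (∃! H : CotangentBundle ES S → ℝ, C.IsReducedHamiltonian H) ∧
    (∃! X : (α : CotangentBundle ES S) → TangentSpace (cotModel ES) α,
      C.IsReducedField X) ∧
    C.Ωnh.IsSmooth ∧
    C.Ωnh.Nondegenerate ∧
    (∀ X : (α : CotangentBundle ES S) → TangentSpace (cotModel ES) α,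
      (∀ α, C.Ωnh.ContractsTo C.reducedHamiltonian α (X α)) ↔ X = C.reducedField) ∧
    (C.Ωnh.IsClosed ↔ ∀ s : S, C.gyroscopicTensor s = 0) := by
  exact ⟨C.cotangentIsReducedSpace, C.existsUnique_gyroscopicTensor,
    C.existsUnique_reducedHamiltonian, C.existsUnique_reducedField, C.Ωnh_isSmooth,
    C.Ωnh_nondegenerate, C.contractsTo_iff_eq_reducedField, C.Ωnh_isClosed_iff⟩
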